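/- Let $B$ be an indefinite rational quaternion algebra of discriminant $D_B>1$, with canonical involution $\iota$, reduced trace $\mathrm{Trd}$ and reduced norm $\mathrm{Nrd}$, and let $\mathcal O_B\subset B$ be a maximal order. Let $\Delta<0$ be an even squarefree integer and $k=\mathbb Q(\sqrt\Delta)$, with ring of integers $o_k$, and assume that every prime dividing $D_B$ is inert in $k$. Fix an element $\theta\in\mathcal O_B$ with $\theta^2=-D_B$ and an embedding $\phi\colon o_k\to\mathcal O_B$, and write also $\phi\colon k\to B$ for its extension. Put $(y,y)_\phi:=\Delta\,\mathrm{Nrd}(y)$ for $y\in B$. For a positive integer $m$ and a fractional ideal $\mathfrak a$ of $o_k$ define $$\Omega^{\pm}(m,\mathfrak a,\phi)=\Big\{y\in\phi(\mathfrak a)^{-1}\mathcal O_B \;:\; (y,y)_\phi=\pm\frac{m}{N(\mathfrak a)}\Big\},\qquad \Omega^o(n)=\{\xi\in\mathcal O_B : \mathrm{Trd}(\xi)=0,\ \mathrm{Nrd}(\xi)=n\},$$ where $\phi(\mathfrak a)^{-1}\mathcal O_B$ is the additive group generated by the products $\phi(x)b$ with $x\in\mathfrak a^{-1}$, $b\in\mathcal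 O_B$. Let $\Omega^o(|\Delta|m^2)^{\phi\text{-pos}}$ (respectively $\Omega^o(|\Delta|m^2)^{\phi\text{-neg}}$) be the set of $\xi\in\Omega^o(|\Delta|m^2)$ such that $\xi=m\,b^{-1}\phi(\sqrt\Delta)\,b$ for some $b\in B^\times$ with $(b,b)_\phi>0$ (respectively $(b,b)_\phi<0$). For $\xi\in\Omega^o(|\Delta|m^2)$ let $i_\xi\colon k\to B$ be the embedding with $i_\xi(m\sqrt\Delta)=\xi$. The conductor $c(\xi)$ is the least positive integer $c$ with $i_\xi(\mathbb Z[c\sqrt\Delta])\subset\mathcal O_B$. The Frobenius type is $\nu(\xi,\phi)=\prod_{p\mid D_B}\nu_p(\xi,\phi)$, where $\nu_p(\xi,\phi)=1$ if $\phi$ and $i_\xi$ induce the same map $o_{k,p}/(p)\to\mathcal O_{B,p}/(\theta)$, and $\nu_p(\xi,\phi)=p$ otherwise. For a rational number $x$ let $\rho(x)$ be the number of integral ideals of $o_k$ of norm $x$ (so $\rho(x)=0$ if $x$ is not an integer). Let $\mathfrak a_1,\dots,\mathfrak a_h$ be fractional ideals representing each ideal class of $k$ exactly once. Then $\eta\mapsto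 m\,\eta^{-1}\phi(\sqrt\Delta)\,\eta$ defines maps $$f\colon\coprod_{i=1}^h\Omega^+(m,\mathfrak a_i,\phi)\to\Omega^o(|\Delta|m^2)^{\phi\text{-pos}},\qquad g\colon\coprod_{i=1}^h\Omega^-(m,\mathfrak a_i,\phi)\to\Omega^o(|\Delta|m^2)^{\phi\text{-neg}},$$ and for every $\xi$ in $\Omega^o(|\Delta|m^2)^{\phi\text{-pos}}$, respectively in $\Omega^o(|\Delta|m^2)^{\phi\text{-neg}}$, $$\# f^{-1}(\xi)=|o_k^\times|\;\rho\!\left(\frac{m}{c(\xi)\,\nu(\xi,\phi)\,|\Delta|}\right),\qquad\text{respectively}\qquad \# g^{-1}(\xi)=|o_k^\times|\;\rho\!\left(\frac{m}{c(\xi)\,\nu(\xi,\phi)\,|\Delta|}\right).$$ -/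

import Mathlib

open scoped Quaternion TensorProduct nonZeroDivisors NumberField

namespace QuatCycles

noncomputable section

/-! ### Rational quaternion algebras

A quaternion algebra over `ℚ` is written as `ℍ[ℚ, α, β]` with `α, β ≠ 0`
(`i ^ 2 = α`, `j ^ 2 = β`, `i j = - j i`); its canonical involution is `star`. -/

/-- Reduced trace `Trd(x) = x + x^ι`. -/
def trd {α β : ℚ} (x : ℍ[ℚ, α, β]) : ℚ := (x + star x).re

/-- Reduced norm `Nrd(x) = x x^ι`. -/
def nrd {α β : ℚ} (x : ℍ[ℚ, α, β]) : ℚ := (x * star x).re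

/-- `x + x^ι` is the rational number `Trd(x)`. -/
theorem coe_trd {α β : ℚ} (x : ℍ[ℚ, α, β]) :
    algebraMap ℚ ℍ[ℚ, α, β] (trd x) = x + star x := by
  ext <;> simp [trd]

/-- `x x^ι` is the rational number `Nrd(x)`. -/
theorem coe_nrd {α β : ℚ} (x : ℍ[ℚ, α, β]) :
    algebraMap ℚ ℍ[ℚ, α, β] (nrd x) = x * star x := by
  ext <;> simp [nrd] <;> ring

/-- `B` is indefinite: `B ⊗ ℝ ≃ M₂(ℝ)`. -/
def IsIndefinite (B : Type*) [Ring B] [Algebra ℚ B] : Prop :=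
  Nonempty ((ℝ ⊗[ℚ] B) ≃ₐ[ℝ] Matrix (Fin 2) (Fin 2) ℝ)

/-- `B` is ramified at `p`: `B ⊗ ℚ_p` is not a matrix algebra. -/
def IsRamifiedAt (B : Type*) [Ring B] [Algebra ℚ B] (p : ℕ) [Fact p.Prime] : Prop :=
  ¬ Nonempty ((ℚ_[p] ⊗[ℚ] B) ≃ₐ[ℚ_[p]] Matrix (Fin 2) (Fin 2) ℚ_[p])

/-- `D` is the discriminant of `B`: the product of the primes at which `B` is ramified. -/
def IsDiscriminant (B : Type*) [Ring B] [Algebra ℚ B] (D : ℕ) : Prop :=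
  Squarefree D ∧ ∀ (p : ℕ) [Fact p.Prime], p ∣ D ↔ IsRamifiedAt B p

/-- A subring of `B` is an order if it is a finitely generated `ℤ`-module that spans `B`
over `ℚ`. -/
def IsOrder {B : Type*} [Ring B] [Algebra ℚ B] (O : Subring B) : Prop :=
  O.toAddSubgroup.FG ∧ Submodule.span ℚ (O : Set B) = ⊤

/-- A maximal order. -/
def IsMaximalOrder {B : Type*} [Ring B] [Algebra ℚ B] (O : Subring B) : Prop :=
  Maximal IsOrder O

/-! ### The field `k = ℚ(√Δ)` is a quadratic field `K` with an element `s`, `s ^ 2 = Δ`. -/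

/-- `ρ(x)`: the number of integral ideals of `o_k` of norm `x` (zero if `x` is not an integer). -/
def rho (K : Type*) [Field K] [NumberField K] (x : ℚ) : ℕ :=
  Nat.card {I : Ideal (𝓞 K) // (Ideal.absNorm I : ℚ) = x}

section Cycles

variable {K : Type*} [Field K] {α β : ℚ}

/-- `Ω^o(n)`. -/
def OmegaO (O : Subring ℍ[ℚ, α, β]) (n : ℚ) : Set ℍ[ℚ, α, β] :=
  {ξ | ξ ∈ O ∧ trd ξ = 0 ∧ nrd ξ = n}

/-- The quadratic form `(y, y)_φ = Δ Nrd(y)`. -/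
def quadForm (Δ : ℤ) (y : ℍ[ℚ, α, β]) : ℚ := Δ * nrd y

/-- The lattice `φ(𝔞)⁻¹ O_B`, generated by the products `φ(x) b` with `x ∈ 𝔞⁻¹`, `b ∈ O_B`. -/
def idealLattice [NumberField K] (O : Subring ℍ[ℚ, α, β]) (φ : K →ₐ[ℚ] ℍ[ℚ, α, β])
    (𝔞 : (FractionalIdeal (𝓞 K)⁰ K)ˣ) : AddSubgroup ℍ[ℚ, α, β] :=
  AddSubgroup.closure
    {y | ∃ x ∈ ((𝔞⁻¹ : (FractionalIdeal (𝓞 K)⁰ K)ˣ) : FractionalIdeal (𝓞 K)⁰ K),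
      ∃ b ∈ O, y = φ x * b}

/-- `Ω^+(m, 𝔞, φ)`. -/
def OmegaPlus [NumberField K] (Δ : ℤ) (O : Subring ℍ[ℚ, α, β]) (φ : K →ₐ[ℚ] ℍ[ℚ, α, β])
    (m : ℕ) (𝔞 : (FractionalIdeal (𝓞 K)⁰ K)ˣ) : Set ℍ[ℚ, α, β] :=
  {y | y ∈ idealLattice O φ 𝔞 ∧
    quadForm Δ y = m / FractionalIdeal.absNorm (𝔞 : FractionalIdeal (𝓞 K)⁰ K)}

/-- `Ω^-(m, 𝔞, φ)`. -/
def OmegaMinus [NumberField K] (Δ : ℤ) (O : Subring ℍ[ℚ, α, β]) (φ : K →ₐ[ℚ] ℍ[ℚ, α, β])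
    (m : ℕ) (𝔞 : (FractionalIdeal (𝓞 K)⁰ K)ˣ) : Set ℍ[ℚ, α, β] :=
  {y | y ∈ idealLattice O φ 𝔞 ∧
    quadForm Δ y = -(m / FractionalIdeal.absNorm (𝔞 : FractionalIdeal (𝓞 K)⁰ K))}

/-- `Ω^o(|Δ| m²)^{φ-pos}`. -/
def OmegaPos (Δ : ℤ) (s : K) [Algebra ℚ K] (O : Subring ℍ[ℚ, α, β])
    (φ : K →ₐ[ℚ] ℍ[ℚ, α, β]) (m : ℕ) : Set ℍ[ℚ, α, β] :=
  {ξ | ξ ∈ OmegaO O (|Δ| * m ^ 2) ∧ ∃ b : (ℍ[ℚ, α, β])ˣ,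
    0 < quadForm Δ (b : ℍ[ℚ, α, β]) ∧ ξ = m * (↑b⁻¹ * φ s * b)}

/-- `Ω^o(|Δ| m²)^{φ-neg}`. -/
def OmegaNeg (Δ : ℤ) (s : K) [Algebra ℚ K] (O : Subring ℍ[ℚ, α, β])
    (φ : K →ₐ[ℚ] ℍ[ℚ, α, β]) (m : ℕ) : Set ℍ[ℚ, α, β] :=
  {ξ | ξ ∈ OmegaO O (|Δ| * m ^ 2) ∧ ∃ b : (ℍ[ℚ, α, β])ˣ,
    quadForm Δ (b : ℍ[ℚ, α, β]) < 0 ∧ ξ = m * (↑b⁻¹ * φ s * b)}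

/-- The map `η ↦ m η⁻¹ φ(√Δ) η` (`Ring.inverse η` is the inverse of `η` if `η` is a unit, as is
every `η` of nonzero reduced norm). -/
def conjMap (s : K) [Algebra ℚ K] (φ : K →ₐ[ℚ] ℍ[ℚ, α, β]) (m : ℕ) (η : ℍ[ℚ, α, β]) :
    ℍ[ℚ, α, β] :=
  m * (Ring.inverse η * φ s * η)

/-- `i` is the embedding `i_ξ : k → B` induced by `ξ ∈ Ω^o(|Δ| t²)`, that is,
`i(t √Δ) = ξ`. See `existsUnique_isInduced`. -/
def IsInduced (s : K) [Algebra ℚ K] (t : ℕ) (ξ : ℍ[ℚ, α, β]) (i : K →ₐ[ℚ] ℍ[ℚ, α, β]) : Prop :=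
  i (t * s) = ξ

/-- The conductor `c(ξ)` of `ξ ∈ Ω^o(|Δ| t²)`: the least positive integer `c` such that
`i_ξ(o_c) ⊆ O_B`, where `o_c = ℤ[c √Δ]`. -/
def conductor (s : K) [Algebra ℚ K] (O : Subring ℍ[ℚ, α, β]) (t : ℕ) (ξ : ℍ[ℚ, α, β]) : ℕ :=
  sInf {c : ℕ | 0 < c ∧ ∃ i : K →ₐ[ℚ] ℍ[ℚ, α, β], IsInduced s t ξ i ∧
    ∀ x ∈ Algebra.adjoin ℤ {(c : K) * s}, i x ∈ O}

/-- The local order `O_{B,p} = O_B ⊗ ℤ_p` inside `B ⊗ ℚ_p`. -/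
def localOrder (O : Subring ℍ[ℚ, α, β]) (p : ℕ) [Fact p.Prime] :
    Submodule ℤ_[p] (ℚ_[p] ⊗[ℚ] ℍ[ℚ, α, β]) :=
  Submodule.span ℤ_[p] ((fun b => (1 : ℚ_[p]) ⊗ₜ[ℚ] b) '' (O : Set ℍ[ℚ, α, β]))

/-- The embeddings `i, j : k → B` have the same reduction `o_{k,p} / (p) → O_{B,p} / (θ)`: the
elements `i(a)` and `j(a)` are congruent modulo `θ O_{B,p}` for all `a ∈ o_k`
(whose classes exhaust `o_{k,p} / (p)`). -/
def SameReduction (O : Subring ℍ[ℚ, α, β]) (θ : ℍ[ℚ, α, β]) [Algebra ℚ K]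
    (i j : K →ₐ[ℚ] ℍ[ℚ, α, β]) (p : ℕ) [Fact p.Prime] : Prop :=
  ∀ a : 𝓞 K, ∃ x ∈ localOrder O p,
    (1 : ℚ_[p]) ⊗ₜ[ℚ] (i a - j a) = ((1 : ℚ_[p]) ⊗ₜ[ℚ] θ) * x

open Classical in
/-- The local Frobenius type `ν_p(ξ, φ)`: it is `1` if `φ` and `i_ξ` have the same reduction
at `p`, and `p` otherwise. -/
def localFrobeniusType (s : K) [Algebra ℚ K] (O : Subring ℍ[ℚ, α, β]) (θ : ℍ[ℚ, α, β])
    (φ : K →ₐ[ℚ] ℍ[ℚ, α, β]) (t : ℕ) (ξ : ℍ[ℚ, α, β]) (p : ℕ) [Fact p.Prime] : ℕ :=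
  if ∃ i : K →ₐ[ℚ] ℍ[ℚ, α, β], IsInduced s t ξ i ∧ SameReduction O θ φ i p then 1 else p

/-- The Frobenius type `ν(ξ, φ) = ∏_{p ∣ D} ν_p(ξ, φ)` of `ξ ∈ Ω^o(|Δ| t²)` relative to `φ`. -/
def frobeniusType (s : K) [Algebra ℚ K] (O : Subring ℍ[ℚ, α, β]) (θ : ℍ[ℚ, α, β]) (D : ℕ)
    (φ : K →ₐ[ℚ] ℍ[ℚ, α, β]) (t : ℕ) (ξ : ℍ[ℚ, α, β]) : ℕ :=
  ∏ p ∈ D.primeFactors.attach,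
    haveI : Fact (p : ℕ).Prime := ⟨Nat.prime_of_mem_primeFactors p.2⟩
    localFrobeniusType s O θ φ t ξ p

/-- The embedding induced by `ξ ∈ Ω^o(|Δ| t²)` exists and is unique, so that `conductor` and
`frobeniusType` refer to a well determined embedding. -/
theorem existsUnique_isInduced [NumberField K] (Δ : ℤ) (hΔ : Δ < 0) (s : K)
    (hs : s ^ 2 = (Δ : K)) (hK : Module.finrank ℚ K = 2) (O : Subring ℍ[ℚ, α, β])
    (t : ℕ) (ht : 0 < t) (ξ : ℍ[ℚ, α, β]) (hξ : ξ ∈ OmegaO O (|Δ| * t ^ 2)) :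
    ∃! i : K →ₐ[ℚ] ℍ[ℚ, α, β], IsInduced s t ξ i := by
  have ht0 : (t : ℚ) ≠ 0 := by positivity
  have hnot : ∀ q : ℚ, algebraMap ℚ K q ≠ s := by
    intro q hq
    have h1 : algebraMap ℚ K (q ^ 2) = algebraMap ℚ K (Δ : ℚ) := by
      rw [map_pow, hq, hs]; simp
    have h2 : q ^ 2 = (Δ : ℚ) := (algebraMap ℚ K).injective h1
    have h3 : (Δ : ℚ) < 0 := by exact_mod_cast hΔ
    nlinarith [sq_nonneg q]
  have htop : Algebra.adjoin ℚ {s} = ⊤ := by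
    have : IsSimpleOrder (Subalgebra ℚ K) :=
      Subalgebra.isSimpleOrder_of_finrank_prime ℚ K (hK ▸ Nat.prime_two)
    rcases eq_bot_or_eq_top (Algebra.adjoin ℚ {s}) with h | h
    · exfalso
      have : s ∈ (⊥ : Subalgebra ℚ K) := h ▸ Algebra.subset_adjoin rfl
      obtain ⟨q, hq⟩ := Algebra.mem_bot.mp this
      exact hnot q hq
    · exact h
  have hint : IsIntegral ℚ s := Algebra.IsIntegral.isIntegral s
  let pb := PowerBasis.ofAdjoinEqTop hint htop
  have hgen : pb.gen = s := PowerBasis.ofAdjoinEqTop_gen hint htop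
  have hmin : minpoly ℚ s = Polynomial.X ^ 2 - Polynomial.C (Δ : ℚ) := by
    symm
    apply minpoly.eq_of_irreducible_of_monic
    · refine (Polynomial.irreducible_iff_roots_eq_zero_of_degree_le_three ?_ ?_).2 ?_
      · rw [Polynomial.natDegree_X_pow_sub_C]
      · rw [Polynomial.natDegree_X_pow_sub_C]; norm_num
      · rw [Multiset.eq_zero_iff_forall_notMem]
        intro q hq
        have h := Polynomial.isRoot_of_mem_roots hq
        simp only [Polynomial.IsRoot.def, Polynomial.eval_sub, Polynomial.eval_pow,
          Polynomial.eval_X, Polynomial.eval_C] at h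
        have h3 : (Δ : ℚ) < 0 := by exact_mod_cast hΔ
        nlinarith [sq_nonneg q]
    · simp [hs]
    · exact Polynomial.monic_X_pow_sub_C _ two_ne_zero
  have hstar : star ξ = -ξ := by
    have h := coe_trd ξ
    rw [hξ.2.1, map_zero] at h
    exact eq_neg_of_add_eq_zero_right h.symm
  have hsq : ξ * ξ = algebraMap ℚ ℍ[ℚ, α, β] ((Δ : ℚ) * t ^ 2) := by
    have h := coe_nrd ξ
    rw [hξ.2.2, hstar, mul_neg] at h
    have habs : |(Δ : ℚ)| = -(Δ : ℚ) := abs_of_neg (by exact_mod_cast hΔ)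
    have hc : (((|Δ| : ℤ) : ℚ)) = -(Δ : ℚ) := by rw [Int.cast_abs, habs]
    rw [hc, neg_mul, map_neg] at h
    exact (neg_injective h).symm
  let y : ℍ[ℚ, α, β] := (t : ℚ)⁻¹ • ξ
  have hy2 : y ^ 2 = algebraMap ℚ ℍ[ℚ, α, β] (Δ : ℚ) := by
    simp only [y, pow_two, smul_mul_assoc, mul_smul_comm, hsq, smul_smul]
    rw [Algebra.algebraMap_eq_smul_one, Algebra.algebraMap_eq_smul_one, smul_smul]
    congr 1
    field_simp
  have hy : Polynomial.aeval y (minpoly ℚ pb.gen) = 0 := by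
    rw [hgen, hmin]
    simp [hy2]
  refine ⟨pb.lift y hy, ?_, ?_⟩
  · have h := pb.lift_gen y hy
    rw [hgen] at h
    simp only [IsInduced, map_mul, map_natCast, h, y]
    rw [← map_natCast (algebraMap ℚ ℍ[ℚ, α, β]) t, ← Algebra.smul_def, smul_smul,
      mul_inv_cancel₀ ht0, one_smul]
  · intro j hj
    apply pb.algHom_ext
    rw [pb.lift_gen y hy, hgen]
    simp only [y]
    have hj' : j (t * s) = ξ := hj
    rw [← hj', map_mul, map_natCast, ← map_natCast (algebraMap ℚ ℍ[ℚ, α, β]) t,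
      ← Algebra.smul_def, smul_smul, inv_mul_cancel₀ ht0, one_smul]

end Cycles

end

end QuatCycles

/-! Let `ξ = m b⁻¹ φ(√Δ) b` and let `I` be the fractional ideal of all `x` in `k` with `φ(x) b ∈
O_B` (`leftIdeal`). Because `φ(k)` is its own centralizer, the `η` over `ξ` have the form `φ(x) b`
with `x ≠ 0`. Such an `η` lies in `φ(𝔞)⁻¹ O_B` exactly if `x 𝔞 ⊆ I`, and its norm is right exactly
if the integral ideal `J = x 𝔞 I⁻¹` has norm `m / (N(I) |Nrd b| |Δ|)`. Norms from `k` are positive,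
so the sign of `(b, b)_φ` decides between `f` and `g`. Since the `𝔞ᵢ` represent each class once, `J`
determines `i`, and `x` up to a unit; this yields `|o_k^×| ρ(m / (N(I) |Nrd b| |Δ|))`
(`encard_idealMultiples`, `encard_fibre`).

It remains to see that `N(I) |Nrd b| = c(ξ) ν(ξ, φ)` (`absNorm_mul_abs_nrd_eq`). Put `i = b⁻¹ φ b`.
As `Ī I = N(I) o_k`, the products `(φ(x) b)^ι φ(y) b = Nrd(b) i(x̄ y)` with `x, y ∈ I` generate
`N(I) Nrd(b) i(o_k)`, which is therefore contained in `O_B`. So `N = N(I) |Nrd b|` is an integer and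
`N = c t` with `c` the conductor. The primes of `t` are found one at a time.

At an unramified `p`, `O_B / p` is a matrix algebra. If `p ∣ t`, all the products above vanish
modulo `p`, so the elements of `φ(I) b` reduce to matrices whose columns lie on one line. That line
is stable under `φ(√Δ)`, which acts on it by a scalar `z`; then `(√Δ - z) / p` preserves `I` and is
integral, contradicting `o_k = ℤ[√Δ]` (`not_dvd_of_not_isRamifiedAt`).

At a ramified `p`, which is inert in `k`, `B_p = k_p + k_p j` with `j²` a uniformizer, and `O_{B,p}`
is the set of elements of integral norm. Hence `p ∤ c` and `p² ∤ N`. As `N(I)` has even valuation at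
`p`, the parity of `v_p(N)` is that of `v_p(Nrd b)`, and this parity decides whether conjugation by
`b` changes the reduction of `φ` modulo `θ` (`norm_nrd_sub_conj`). So `t` contains exactly the
factor `ν_p`.

Local properties of the maximal order come from comparing it with `O[1/p] ∩ V`, where `V ⊇ O` is a
subring with `p`-integral traces (`mem_of_mem_awayFrom`). -/

namespace QuatCycles

/-! ### Reduced norm and trace. -/

section Algebra

variable {α β : ℚ}

theorem nrd_eq (x : ℍ[ℚ, α, β]) :
    nrd x = x.re ^ 2 - α * x.imI ^ 2 - β * x.imJ ^ 2 + α * β * x.imK ^ 2 := by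
  simp [nrd]; ring

theorem trd_eq (x : ℍ[ℚ, α, β]) : trd x = 2 * x.re := by
  simp [trd]; ring

@[simp] theorem nrd_mul (x y : ℍ[ℚ, α, β]) : nrd (x * y) = nrd x * nrd y := by
  simp only [nrd_eq, QuaternionAlgebra.re_mul, QuaternionAlgebra.imI_mul,
    QuaternionAlgebra.imJ_mul, QuaternionAlgebra.imK_mul]
  ring

@[simp] theorem nrd_one : nrd (1 : ℍ[ℚ, α, β]) = 1 := by simp [nrd_eq]

@[simp] theorem nrd_zero : nrd (0 : ℍ[ℚ, α, β]) = 0 := by simp [nrd_eq]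

@[simp] theorem nrd_smul (q : ℚ) (x : ℍ[ℚ, α, β]) : nrd (q • x) = q ^ 2 * nrd x := by
  simp [nrd_eq]; ring

@[simp] theorem trd_smul (q : ℚ) (x : ℍ[ℚ, α, β]) : trd (q • x) = q * trd x := by
  simp [trd_eq]; ring

@[simp] theorem trd_add (x y : ℍ[ℚ, α, β]) : trd (x + y) = trd x + trd y := by
  simp [trd_eq]; ring

@[simp] theorem trd_one : trd (1 : ℍ[ℚ, α, β]) = 2 := by simp [trd_eq]

theorem nrd_pow (x : ℍ[ℚ, α, β]) (n : ℕ) : nrd (x ^ n) = nrd x ^ n := by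
  induction n with
  | zero => simp
  | succ n ih => rw [pow_succ, nrd_mul, ih, pow_succ]

theorem nrd_one_add (x : ℍ[ℚ, α, β]) : nrd (1 + x) = 1 + trd x + nrd x := by
  simp [nrd_eq, trd_eq]; ring

theorem star_mul_self_eq (x : ℍ[ℚ, α, β]) : star x * x = nrd x • 1 := by
  ext <;> simp [nrd_eq] <;> ring

theorem mul_star_self_eq (x : ℍ[ℚ, α, β]) : x * star x = nrd x • 1 := by
  ext <;> simp [nrd_eq] <;> ring

theorem star_eq_trd_sub (x : ℍ[ℚ, α, β]) : star x = trd x • 1 - x := by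
  ext <;> simp [trd_eq]; ring

theorem mul_self_eq (x : ℍ[ℚ, α, β]) : x * x = trd x • x - nrd x • 1 := by
  rw [← star_mul_self_eq, star_eq_trd_sub, sub_mul, smul_mul_assoc, one_mul]; abel

theorem isUnit_of_nrd_ne_zero {x : ℍ[ℚ, α, β]} (h : nrd x ≠ 0) : IsUnit x := by
  refine ⟨⟨x, (nrd x)⁻¹ • star x, ?_, ?_⟩, rfl⟩
  · rw [mul_smul_comm, mul_star_self_eq, smul_smul, inv_mul_cancel₀ h, one_smul]
  · rw [smul_mul_assoc, star_mul_self_eq, smul_smul, inv_mul_cancel₀ h, one_smul]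

theorem nrd_unit_ne_zero (b : (ℍ[ℚ, α, β])ˣ) : nrd (b : ℍ[ℚ, α, β]) ≠ 0 := by
  intro h
  have h1 : nrd ((b : ℍ[ℚ, α, β]) * ((b⁻¹ : (ℍ[ℚ, α, β])ˣ) : ℍ[ℚ, α, β])) = 1 := by simp
  rw [nrd_mul, h, zero_mul] at h1
  exact zero_ne_one h1

theorem coe_inv_eq (b : (ℍ[ℚ, α, β])ˣ) :
    ((b⁻¹ : (ℍ[ℚ, α, β])ˣ) : ℍ[ℚ, α, β]) = (nrd (b : ℍ[ℚ, α, β]))⁻¹ • star (b : ℍ[ℚ, α, β]) := by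
  rw [Units.inv_eq_of_mul_eq_one_right]
  rw [mul_smul_comm, mul_star_self_eq, smul_smul, inv_mul_cancel₀ (nrd_unit_ne_zero b), one_smul]

theorem nrd_coe_inv (b : (ℍ[ℚ, α, β])ˣ) :
    nrd ((b⁻¹ : (ℍ[ℚ, α, β])ˣ) : ℍ[ℚ, α, β]) = (nrd (b : ℍ[ℚ, α, β]))⁻¹ := by
  refine eq_inv_of_mul_eq_one_left ?_
  rw [← nrd_mul]; simp

end Algebra

/-! ### Integrality in orders, and a trace criterion for maximality. -/

section Orders

variable {α β : ℚ} {O : Subring ℍ[ℚ, α, β]}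

theorem zsmul_mem_of_mem {x : ℍ[ℚ, α, β]} (n : ℤ) (hx : x ∈ O) : (n : ℚ) • x ∈ O := by
  rw [Int.cast_smul_eq_zsmul]; exact zsmul_mem hx n

theorem nsmul_mem_of_mem {x : ℍ[ℚ, α, β]} (n : ℕ) (hx : x ∈ O) : (n : ℚ) • x ∈ O := by
  simpa using zsmul_mem_of_mem (n : ℤ) hx

theorem IsOrder.exists_natCast_smul_mem (hO : IsOrder O) (x : ℍ[ℚ, α, β]) :
    ∃ M : ℕ, 0 < M ∧ (M : ℚ) • x ∈ O := by
  have hx : x ∈ Submodule.span ℚ (O : Set ℍ[ℚ, α, β]) := hO.2 ▸ Submodule.mem_top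
  induction hx using Submodule.span_induction with
  | mem x hx => exact ⟨1, one_pos, by simpa using hx⟩
  | zero => exact ⟨1, one_pos, by simp⟩
  | add x y _ _ hx hy =>
    obtain ⟨M, hM, hx⟩ := hx
    obtain ⟨N, hN, hy⟩ := hy
    refine ⟨M * N, Nat.mul_pos hM hN, ?_⟩
    rw [smul_add]
    refine add_mem ?_ ?_
    · have := nsmul_mem_of_mem N hx
      rwa [smul_smul, mul_comm, ← Nat.cast_mul] at this
    · have := nsmul_mem_of_mem M hy
      rwa [smul_smul, ← Nat.cast_mul] at this
  | smul q x _ hx =>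
    obtain ⟨M, hM, hx⟩ := hx
    refine ⟨M * q.den, Nat.mul_pos hM q.pos, ?_⟩
    have := zsmul_mem_of_mem q.num hx
    rw [smul_smul] at this ⊢
    convert this using 2
    push_cast
    rw [mul_assoc, mul_comm (q.den : ℚ), Rat.mul_den_eq_num, mul_comm]

/-- Linear functionals have bounded denominators on an order. -/
theorem IsOrder.exists_bounded_den (hO : IsOrder O) (l : ℍ[ℚ, α, β] →ₗ[ℚ] ℚ) :
    ∃ N : ℕ, 0 < N ∧ ∀ x ∈ O, ∃ n : ℤ, N * l x = n := by
  obtain ⟨T, hT⟩ := hO.1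
  refine ⟨∏ g ∈ T, (l g).den, Finset.prod_pos fun g _ => (l g).pos, fun x hx => ?_⟩
  have hx' : x ∈ AddSubgroup.closure (T : Set ℍ[ℚ, α, β]) := by rw [hT]; exact hx
  clear hx
  induction hx' using AddSubgroup.closure_induction with
  | mem x hx =>
    obtain ⟨k, hk⟩ := Finset.dvd_prod_of_mem (fun g => (l g).den) hx
    refine ⟨k * (l x).num, ?_⟩
    rw [hk]
    push_cast
    rw [mul_right_comm, mul_comm ((l x).den : ℚ), Rat.mul_den_eq_num, mul_comm]
  | zero => exact ⟨0, by simp⟩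
  | add x y hx hy hx1 hy1 =>
    obtain ⟨a, ha⟩ := hx1
    obtain ⟨c, hc⟩ := hy1
    exact ⟨a + c, by rw [map_add, mul_add, ha, hc]; push_cast; rfl⟩
  | neg x hx hx1 =>
    obtain ⟨a, ha⟩ := hx1
    exact ⟨-a, by rw [map_neg, mul_neg, ha]; push_cast; rfl⟩

/-- Every power of the denominator of `q` divides the fixed `C`, so the denominator is `1`. -/
theorem exists_int_of_pow_bounded_den {q : ℚ} {C : ℕ} (hC : 0 < C)
    (h : ∀ n : ℕ, ∃ k : ℤ, C * q ^ n = k) : ∃ k : ℤ, q = k := by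
  have hd : ∀ n, q.den ^ n ∣ C := by
    intro n
    obtain ⟨k, hk⟩ := h n
    have hden : ((q.den : ℚ) ^ n) ≠ 0 := pow_ne_zero _ (by exact_mod_cast q.den_nz)
    have h1 : (C : ℤ) * q.num ^ n = k * (q.den : ℤ) ^ n := by
      have : (C : ℚ) * q.num ^ n = k * (q.den : ℚ) ^ n := by
        rw [← hk, mul_assoc, ← mul_pow, Rat.mul_den_eq_num]
      exact_mod_cast this
    have h2 : (q.den : ℤ) ^ n ∣ (C : ℤ) * q.num ^ n := ⟨k, by rw [h1, mul_comm]⟩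
    have h3 : IsCoprime ((q.den : ℤ) ^ n) (q.num ^ n) :=
      IsCoprime.pow (Int.isCoprime_iff_gcd_eq_one.2 (by
        rw [Int.gcd_comm]; simpa [Int.gcd] using q.reduced))
    have h4 := h3.dvd_of_dvd_mul_right h2
    exact_mod_cast h4
  have h1 : q.den = 1 := by
    by_contra hne
    have hlt : 1 < q.den := lt_of_le_of_ne q.pos (Ne.symm hne)
    have := Nat.le_of_dvd hC (hd C)
    exact absurd (Nat.lt_pow_self hlt (n := C)) (not_lt.2 this)
  exact ⟨q.num, ((Rat.den_eq_one_iff q).1 h1).symm⟩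

/-- All powers of `x` lie in the order, where coordinates have bounded denominators; hence so do the
powers of `nrd x`. -/
theorem IsOrder.exists_nrd_eq (hO : IsOrder O) {x : ℍ[ℚ, α, β]} (hx : x ∈ O) :
    ∃ n : ℤ, nrd x = n := by
  obtain ⟨N₁, hN₁, h₁⟩ := hO.exists_bounded_den
    { toFun := fun x => x.re, map_add' := by simp, map_smul' := by simp }
  obtain ⟨N₂, hN₂, h₂⟩ := hO.exists_bounded_den
    { toFun := fun x => x.imI, map_add' := by simp, map_smul' := by simp }
  obtain ⟨N₃, hN₃, h₃⟩ := hO.exists_bounded_den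
    { toFun := fun x => x.imJ, map_add' := by simp, map_smul' := by simp }
  obtain ⟨N₄, hN₄, h₄⟩ := hO.exists_bounded_den
    { toFun := fun x => x.imK, map_add' := by simp, map_smul' := by simp }
  -- The `Nᵢ` clear the four coordinates, which enter the norm form squared; the other factor clears
  -- the coefficients `α`, `β`, `α β`.
  refine exists_int_of_pow_bounded_den (C := (N₁ * N₂ * N₃ * N₄) ^ 2 * (α.den * β.den))
    (by have := α.pos; have := β.pos; positivity) fun n => ?_
  rw [← nrd_pow]
  have hn : x ^ n ∈ O := pow_mem hx n
  generalize x ^ n = y at hn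
  obtain ⟨a, ha⟩ := h₁ y hn
  obtain ⟨b, hb⟩ := h₂ y hn
  obtain ⟨c, hc⟩ := h₃ y hn
  obtain ⟨d, hd⟩ := h₄ y hn
  simp only [LinearMap.coe_mk, AddHom.coe_mk] at ha hb hc hd
  refine ⟨α.den * β.den * (a * N₂ * N₃ * N₄) ^ 2 - α.num * β.den * (b * N₁ * N₃ * N₄) ^ 2 -
    β.num * α.den * (c * N₁ * N₂ * N₄) ^ 2 + α.num * β.num * (d * N₁ * N₂ * N₃) ^ 2, ?_⟩
  push_cast
  rw [nrd_eq, ← ha, ← hb, ← hc, ← hd, ← Rat.mul_den_eq_num α, ← Rat.mul_den_eq_num β]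
  ring

theorem IsOrder.exists_trd_eq (hO : IsOrder O) {x : ℍ[ℚ, α, β]} (hx : x ∈ O) :
    ∃ n : ℤ, trd x = n := by
  obtain ⟨a, ha⟩ := hO.exists_nrd_eq hx
  obtain ⟨c, hc⟩ := hO.exists_nrd_eq (add_mem O.one_mem hx)
  refine ⟨c - 1 - a, ?_⟩
  push_cast
  rw [← ha, ← hc, nrd_one_add]; ring

theorem IsOrder.star_mem (hO : IsOrder O) {x : ℍ[ℚ, α, β]} (hx : x ∈ O) : star x ∈ O := by
  obtain ⟨t, ht⟩ := hO.exists_trd_eq hx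
  rw [star_eq_trd_sub, ht]
  exact sub_mem (zsmul_mem_of_mem t O.one_mem) hx

/-- If `q` is a rational scalar in an order then it is an integer. -/
theorem IsOrder.exists_int_of_smul_one_mem (hO : IsOrder O) {q : ℚ}
    (h : q • (1 : ℍ[ℚ, α, β]) ∈ O) : ∃ n : ℤ, q = n := by
  refine exists_int_of_pow_bounded_den (C := 1) one_pos fun n => ?_
  obtain ⟨k, hk⟩ := hO.exists_trd_eq (pow_mem h n)
  obtain ⟨l, hl⟩ := hO.exists_nrd_eq h
  rw [nrd_smul, nrd_one, mul_one] at hl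
  have hq : ∃ z : ℤ, q = z := by
    have h1 : IsIntegral ℤ q := by
      refine IsIntegral.of_pow two_pos ?_
      rw [hl]; exact isIntegral_algebraMap (A := ℚ) (x := l)
    obtain ⟨z, hz⟩ := IsIntegrallyClosed.isIntegral_iff.1 h1
    exact ⟨z, by simpa using hz.symm⟩
  obtain ⟨z, rfl⟩ := hq
  exact ⟨z ^ n, by push_cast; ring⟩

/-- An overring of a maximal order with integral reduced traces is the order itself. -/
theorem IsMaximalOrder.eq_of_trd_integral (hα : α ≠ 0) (hβ : β ≠ 0) (hO : IsMaximalOrder O)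
    {O' : Subring ℍ[ℚ, α, β]} (hle : O ≤ O') (htr : ∀ x ∈ O', ∃ n : ℤ, trd x = n) : O' = O := by
  have hO1 : IsOrder O := hO.1
  obtain ⟨M₁, hM₁, h₁⟩ := hO1.exists_natCast_smul_mem (⟨0, 1, 0, 0⟩ : ℍ[ℚ, α, β])
  obtain ⟨M₂, hM₂, h₂⟩ := hO1.exists_natCast_smul_mem (⟨0, 0, 1, 0⟩ : ℍ[ℚ, α, β])
  obtain ⟨M₃, hM₃, h₃⟩ := hO1.exists_natCast_smul_mem (⟨0, 0, 0, 1⟩ : ℍ[ℚ, α, β])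
  have hM₁' : (M₁ : ℚ) ≠ 0 := by positivity
  have hM₂' : (M₂ : ℚ) ≠ 0 := by positivity
  have hM₃' : (M₃ : ℚ) ≠ 0 := by positivity
  have hfg : O'.toAddSubgroup.FG := by
    -- The dual basis, under the trace form, of `1, M₁ i, M₂ j, M₃ k`, which lie in `O`. Integral
    -- traces place `O'` in its `ℤ`-span; the minus sign comes from `k² = -α β`.
    let v : Fin 4 → ℍ[ℚ, α, β] := ![⟨1 / 2, 0, 0, 0⟩, ⟨0, 1 / (2 * M₁ * α), 0, 0⟩,
      ⟨0, 0, 1 / (2 * M₂ * β), 0⟩, ⟨0, 0, 0, -1 / (2 * M₃ * (α * β))⟩]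
    have hsub : AddSubgroup.toIntSubmodule O'.toAddSubgroup ≤
        Submodule.span ℤ (Set.range v) := by
      intro x hx
      have hx : x ∈ O' := hx
      obtain ⟨a, ha⟩ := htr x hx
      obtain ⟨b, hb⟩ := htr _ (mul_mem hx (hle h₁))
      obtain ⟨c, hc⟩ := htr _ (mul_mem hx (hle h₂))
      obtain ⟨d, hd⟩ := htr _ (mul_mem hx (hle h₃))
      simp [trd_eq] at ha hb hc hd
      have hxe : x = a • v 0 + b • v 1 + c • v 2 + d • v 3 := by
        have e0 : x.re = a * (1 / 2) := by rw [← ha]; ring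
        have e1 : x.imI = b * (1 / (2 * M₁ * α)) := by rw [← hb]; field_simp
        have e2 : x.imJ = c * (1 / (2 * M₂ * β)) := by rw [← hc]; field_simp
        have e3 : x.imK = d * (-1 / (2 * M₃ * (α * β))) := by rw [← hd]; field_simp
        ext
        · simp [v, e0]
        · simp [v, e1]
        · simp [v, e2]
        · simp [v, e3]
      rw [hxe]
      refine add_mem (add_mem (add_mem ?_ ?_) ?_) ?_ <;>
        exact Submodule.smul_mem _ _ (Submodule.subset_span ⟨_, rfl⟩)
    have h := Submodule.FG.of_le (Submodule.fg_span (R := ℤ) (Set.finite_range v)) hsub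
    have := (Submodule.fg_iff_addSubgroup_fg _).1 h
    simpa using this
  have hO' : IsOrder O' :=
    ⟨hfg, top_le_iff.1 (hO1.2.symm.le.trans (Submodule.span_mono (by exact_mod_cast hle)))⟩
  exact le_antisymm (hO.2 hO' hle) hle

end Orders

/-! ### Arithmetic of the quadratic field in the basis `1, √Δ`. -/

/-- `K` is the imaginary quadratic field generated by `s = √Δ`, with `Δ` even and squarefree. -/
structure IsEvenImaginaryQuadratic {K : Type*} [Field K] [NumberField K] (Δ : ℤ) (s : K) :
    Prop where
  neg : Δ < 0
  squarefree : Squarefree Δ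
  even : Even Δ
  sq : s ^ 2 = (Δ : K)
  finrank : Module.finrank ℚ K = 2

/-- The nontrivial automorphism of a quadratic field, as the map `x ↦ Tr(x) - x`. -/
noncomputable def conj {K : Type*} [Field K] [NumberField K] (x : K) : K :=
  algebraMap ℚ K (Algebra.trace ℚ K x) - x

theorem conj_smul {K : Type*} [Field K] [NumberField K] (q : ℚ) (x : K) :
    conj (q • x) = q • conj x := by
  rw [conj, conj, map_smul, smul_sub, smul_eq_mul, map_mul, Algebra.smul_def q (algebraMap ℚ K _)]

namespace IsEvenImaginaryQuadratic

variable {K : Type*} [Field K] [NumberField K] {Δ : ℤ} {s : K}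

theorem neg_rat (h : IsEvenImaginaryQuadratic Δ s) : (Δ : ℚ) < 0 := by exact_mod_cast h.neg

theorem mul_self (h : IsEvenImaginaryQuadratic Δ s) : s * s = (Δ : ℚ) • (1 : K) := by
  rw [← pow_two, h.sq, ← Algebra.algebraMap_eq_smul_one]; simp

/-- The norm form `u² - Δ v²` is positive definite because `Δ < 0`. -/
theorem coords_eq_zero (h : IsEvenImaginaryQuadratic Δ s) {u v : ℚ}
    (huv : u • (1 : K) + v • s = 0) : u = 0 ∧ v = 0 := by
  have h1 : (u ^ 2 - Δ * v ^ 2) • (1 : K) = 0 := by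
    have : (u • (1 : K) + v • s) * (u • (1 : K) - v • s) = (u ^ 2 - Δ * v ^ 2) • (1 : K) := by
      have e : v • s * v • s = (Δ * v ^ 2) • (1 : K) := by
        rw [smul_mul_smul_comm, h.mul_self, smul_smul]; congr 1; ring
      have e' : u • (1 : K) * u • (1 : K) = (u ^ 2) • (1 : K) := by
        rw [smul_mul_smul_comm, one_mul, pow_two]
      rw [sub_smul, ← e, ← e']; ring
    rw [← this, huv, zero_mul]
  have h2 : u ^ 2 - Δ * v ^ 2 = 0 := by
    rcases smul_eq_zero.1 h1 with h | h
    · exact h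
    · exact absurd h one_ne_zero
  have hΔ := h.neg_rat
  have hu : u = 0 := by nlinarith [sq_nonneg u, sq_nonneg v]
  subst hu
  refine ⟨rfl, ?_⟩
  rcases mul_eq_zero.1 (show (Δ : ℚ) * v ^ 2 = 0 by linarith) with h3 | h3
  · exact absurd h3 hΔ.ne
  · exact pow_eq_zero_iff two_ne_zero |>.1 h3

/-- The basis `1, √Δ`. -/
noncomputable def basis (h : IsEvenImaginaryQuadratic Δ s) : Module.Basis (Fin 2) ℚ K :=
  basisOfLinearIndependentOfCardEqFinrank (b := ![1, s])
    (LinearIndependent.pair_iff.2 fun _ _ huv => h.coords_eq_zero huv) (by simp [h.finrank])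

theorem basis_zero (h : IsEvenImaginaryQuadratic Δ s) : h.basis 0 = 1 := by simp [basis]

theorem basis_one (h : IsEvenImaginaryQuadratic Δ s) : h.basis 1 = s := by simp [basis]

theorem exists_coords (h : IsEvenImaginaryQuadratic Δ s) (x : K) :
    ∃ u v : ℚ, x = u • (1 : K) + v • s := by
  refine ⟨h.basis.repr x 0, h.basis.repr x 1, ?_⟩
  have := h.basis.sum_repr x
  rw [Fin.sum_univ_two, h.basis_zero, h.basis_one] at this
  exact this.symm

theorem mul_coords (h : IsEvenImaginaryQuadratic Δ s) (u v u' v' : ℚ) :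
    (u • (1 : K) + v • s) * (u' • (1 : K) + v' • s) =
      (u * u' + Δ * (v * v')) • (1 : K) + (u * v' + v * u') • s := by
  simp only [add_mul, mul_add, smul_mul_smul_comm, h.mul_self, one_mul, mul_one, smul_smul,
    add_smul]
  rw [mul_comm (Δ : ℚ)]; abel

theorem leftMulMatrix_coords (h : IsEvenImaginaryQuadratic Δ s) (u v : ℚ) :
    Algebra.leftMulMatrix h.basis (u • (1 : K) + v • s) = !![u, Δ * v; v, u] := by
  have hrepr : ∀ a c : ℚ, ⇑(h.basis.repr (a • (1 : K) + c • s)) = ![a, c] := by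
    intro a c
    have : h.basis.repr (a • (1 : K) + c • s) = a • Finsupp.single 0 1 + c • Finsupp.single 1 1 := by
      rw [← h.basis.repr_self, ← h.basis.repr_self, h.basis_zero, h.basis_one, map_add,
        map_smul, map_smul]
    rw [this]
    ext i; fin_cases i <;> simp
  have h0 : (u • (1 : K) + v • s) * h.basis 0 = u • (1 : K) + v • s := by simp [h.basis_zero]
  have h1 : (u • (1 : K) + v • s) * h.basis 1 = (Δ * v) • (1 : K) + u • s := by
    have := h.mul_coords u v 0 1
    rw [zero_smul, zero_add, one_smul] at this
    rw [h.basis_one, this]; simp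
  ext i j
  rw [Algebra.leftMulMatrix_eq_repr_mul]
  fin_cases j
  · simp only [Fin.zero_eta, h0, hrepr]; fin_cases i <;> simp
  · simp only [Fin.mk_one, h1, hrepr]; fin_cases i <;> simp

theorem norm_coords (h : IsEvenImaginaryQuadratic Δ s) (u v : ℚ) :
    Algebra.norm ℚ (u • (1 : K) + v • s) = u ^ 2 - Δ * v ^ 2 := by
  rw [Algebra.norm_eq_matrix_det h.basis, h.leftMulMatrix_coords, Matrix.det_fin_two]
  simp; ring

theorem trace_coords (h : IsEvenImaginaryQuadratic Δ s) (u v : ℚ) :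
    Algebra.trace ℚ K (u • (1 : K) + v • s) = 2 * u := by
  rw [Algebra.trace_eq_matrix_trace h.basis, h.leftMulMatrix_coords, Matrix.trace_fin_two]
  simp; ring

theorem conj_coords (h : IsEvenImaginaryQuadratic Δ s) (u v : ℚ) :
    conj (u • (1 : K) + v • s) = u • (1 : K) - v • s := by
  rw [conj, h.trace_coords, Algebra.algebraMap_eq_smul_one, mul_smul, two_smul]; abel

theorem conj_conj (h : IsEvenImaginaryQuadratic Δ s) (x : K) : conj (conj x) = x := by
  obtain ⟨u, v, rfl⟩ := h.exists_coords x
  rw [h.conj_coords, sub_eq_add_neg, ← neg_smul, h.conj_coords]; simp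

theorem conj_mul_self (h : IsEvenImaginaryQuadratic Δ s) (x : K) :
    conj x * x = Algebra.norm ℚ x • (1 : K) := by
  obtain ⟨u, v, rfl⟩ := h.exists_coords x
  rw [h.conj_coords, sub_eq_add_neg, ← neg_smul, h.mul_coords, h.norm_coords]
  have : u * v + -v * u = 0 := by ring
  rw [this, zero_smul, add_zero]; congr 1; ring

theorem norm_conj (h : IsEvenImaginaryQuadratic Δ s) (x : K) :
    Algebra.norm ℚ (conj x) = Algebra.norm ℚ x := by
  obtain ⟨u, v, rfl⟩ := h.exists_coords x
  rw [h.conj_coords, sub_eq_add_neg, ← neg_smul, h.norm_coords, h.norm_coords]; ring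

theorem norm_add (h : IsEvenImaginaryQuadratic Δ s) (x y : K) :
    Algebra.norm ℚ (x + y) =
      Algebra.norm ℚ x + Algebra.norm ℚ y + Algebra.trace ℚ K (conj x * y) := by
  obtain ⟨u, v, rfl⟩ := h.exists_coords x
  obtain ⟨u', v', rfl⟩ := h.exists_coords y
  have : u • (1 : K) + v • s + (u' • (1 : K) + v' • s) =
      (u + u') • (1 : K) + (v + v') • s := by rw [add_smul, add_smul]; abel
  rw [this, h.conj_coords, sub_eq_add_neg, ← neg_smul, h.mul_coords, h.trace_coords,
    h.norm_coords, h.norm_coords, h.norm_coords]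
  ring

theorem norm_pos (h : IsEvenImaginaryQuadratic Δ s) {x : K} (hx : x ≠ 0) :
    0 < Algebra.norm ℚ x := by
  refine lt_of_le_of_ne ?_ (Ne.symm (Algebra.norm_ne_zero_iff.2 hx))
  obtain ⟨u, v, rfl⟩ := h.exists_coords x
  rw [h.norm_coords]
  nlinarith [sq_nonneg u, sq_nonneg v, h.neg_rat]

theorem norm_smul (h : IsEvenImaginaryQuadratic Δ s) (q : ℚ) (x : K) :
    Algebra.norm ℚ (q • x) = q ^ 2 * Algebra.norm ℚ x := by
  rw [Algebra.smul_def, map_mul, Algebra.norm_algebraMap, h.finrank]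

theorem isIntegral_of_trace_norm (h : IsEvenImaginaryQuadratic Δ s) {x : K} {t n : ℤ}
    (ht : Algebra.trace ℚ K x = t) (hn : Algebra.norm ℚ x = n) : IsIntegral ℤ x := by
  refine ⟨Polynomial.X ^ 2 - Polynomial.C t * Polynomial.X + Polynomial.C n, ?_, ?_⟩
  · monicity!
  · have h1 := h.conj_mul_self x
    rw [conj, ht, hn, Algebra.smul_def] at h1
    simp only [map_intCast, mul_one] at h1
    change Polynomial.aeval x _ = 0
    simp only [map_add, map_sub, map_mul, map_pow, Polynomial.aeval_X, eq_intCast, map_intCast]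
    linear_combination -h1

/-- The form in which `o_k = ℤ[√Δ]` is used at a prime `p`: no translate of `√Δ` by an integer is
divisible by `p`. The trace for odd `p`, and the norm for `p = 2`, force `p ∣ a`. -/
theorem not_isIntegral (h : IsEvenImaginaryQuadratic Δ s) {p : ℕ} (hp : p.Prime) (a : ℤ) :
    ¬ IsIntegral ℤ ((p : ℚ)⁻¹ • (s - (a : ℚ) • (1 : K))) := by
  intro hi
  have hp0 : (p : ℚ) ≠ 0 := by exact_mod_cast hp.ne_zero
  have e : (p : ℚ)⁻¹ • (s - (a : ℚ) • (1 : K)) = (-(a / p) : ℚ) • (1 : K) + (p : ℚ)⁻¹ • s := by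
    rw [smul_sub, smul_smul, neg_smul, div_eq_inv_mul]; abel
  obtain ⟨t, ht⟩ := IsIntegrallyClosed.isIntegral_iff.1 (Algebra.isIntegral_trace (L := ℚ) hi)
  obtain ⟨n, hn⟩ := IsIntegrallyClosed.isIntegral_iff.1 (Algebra.isIntegral_norm ℚ hi)
  rw [e, h.trace_coords] at ht
  rw [e, h.norm_coords] at hn
  simp only [eq_intCast] at ht hn
  have ht' : t * p = -2 * a := by
    have : (t : ℚ) * p = -2 * a := by rw [ht]; field_simp
    exact_mod_cast this
  have hn' : n * p ^ 2 = a ^ 2 - Δ := by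
    have : (n : ℚ) * p ^ 2 = a ^ 2 - Δ := by rw [hn]; field_simp
    exact_mod_cast this
  have hpi : Prime (p : ℤ) := Nat.prime_iff_prime_int.1 hp
  have hpa : (p : ℤ) ∣ a := by
    rcases hp.eq_two_or_odd' with rfl | hodd
    · obtain ⟨d, hd⟩ := h.even
      refine hpi.dvd_of_dvd_pow (n := 2) ⟨2 * n + d, ?_⟩
      push_cast at hn' ⊢
      linarith
    · have h2 : (p : ℤ) ∣ 2 * a := ⟨-t, by linarith⟩
      rcases hpi.dvd_or_dvd h2 with h3 | h3
      · have h4 : p ∣ 2 := by exact_mod_cast h3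
        rw [(Nat.prime_dvd_prime_iff_eq hp Nat.prime_two).1 h4] at hodd
        exact absurd hodd (by decide)
      · exact h3
  obtain ⟨c, rfl⟩ := hpa
  -- Once `p ∣ a`, integrality of the norm `(a² - Δ) / p²` gives `p² ∣ Δ`.
  have h4 : (p : ℤ) * p ∣ Δ := ⟨c ^ 2 - n, by linarith⟩
  exact hpi.not_isUnit (h.squarefree _ h4)

/-- This is `o_k = ℤ[√Δ]`, which holds because an even squarefree `Δ` is `2` modulo `4`. -/
theorem exists_int_coords (h : IsEvenImaginaryQuadratic Δ s) {x : K} (hx : IsIntegral ℤ x) :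
    ∃ u v : ℤ, x = (u : ℚ) • (1 : K) + (v : ℚ) • s := by
  obtain ⟨u, v, rfl⟩ := h.exists_coords x
  obtain ⟨t, ht⟩ := IsIntegrallyClosed.isIntegral_iff.1 (Algebra.isIntegral_trace (L := ℚ) hx)
  obtain ⟨n, hn⟩ := IsIntegrallyClosed.isIntegral_iff.1 (Algebra.isIntegral_norm ℚ hx)
  rw [h.trace_coords] at ht
  rw [h.norm_coords] at hn
  simp only [eq_intCast] at ht hn
  have h4 : (t : ℚ) ^ 2 - Δ * (2 * v) ^ 2 = 4 * n := by rw [ht, hn]; ring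
  -- As `Δ (2v)²` is an integer, the squared denominator of `2v` divides the squarefree `Δ`.
  have hv : ∃ w : ℤ, 2 * v = w := by
    have h5 : (Δ : ℚ) * (2 * v) ^ 2 = (t ^ 2 - 4 * n : ℤ) := by push_cast; linarith
    set q := 2 * v with hq
    have h6 : Δ * q.num ^ 2 = (t ^ 2 - 4 * n) * (q.den : ℤ) ^ 2 := by
      have : (Δ : ℚ) * q.num ^ 2 = (t ^ 2 - 4 * n : ℤ) * (q.den : ℚ) ^ 2 := by
        rw [← h5, ← Rat.mul_den_eq_num q]; ring
      exact_mod_cast this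
    have hc : IsCoprime ((q.den : ℤ) ^ 2) (q.num ^ 2) :=
      IsCoprime.pow (Int.isCoprime_iff_gcd_eq_one.2 (by
        rw [Int.gcd_comm]; simpa [Int.gcd] using q.reduced))
    have hd : (q.den : ℤ) * q.den ∣ Δ := by
      rw [← pow_two]
      exact hc.dvd_of_dvd_mul_right ⟨t ^ 2 - 4 * n, by rw [h6]; ring⟩
    have hu := h.squarefree _ hd
    have h1 : q.den = 1 := by
      have := Int.isUnit_iff.1 hu
      omega
    exact ⟨q.num, ((Rat.den_eq_one_iff q).1 h1).symm⟩
  obtain ⟨w, hw⟩ := hv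
  rw [hw] at h4
  have h5 : t ^ 2 - Δ * w ^ 2 = 4 * n := by exact_mod_cast h4
  obtain ⟨d, hd⟩ := h.even
  -- With `Δ = 2d` and `d` odd, `t² - 2d w² = 4n` makes first `t` and then `w` even.
  have hdodd : ¬ (2 : ℤ) ∣ d := by
    rintro ⟨c, rfl⟩
    have := h.squarefree 2 ⟨c, by rw [hd]; ring⟩
    rw [Int.isUnit_iff] at this
    omega
  have ht2 : (2 : ℤ) ∣ t :=
    Int.prime_two.dvd_of_dvd_pow (n := 2) ⟨2 * n + d * w ^ 2, by rw [hd] at h5; linarith⟩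
  obtain ⟨a, rfl⟩ := ht2
  have hw2 : (2 : ℤ) ∣ w := by
    have : (2 : ℤ) ∣ d * w ^ 2 := ⟨a ^ 2 - n, by rw [hd] at h5; linarith⟩
    rcases Int.prime_two.dvd_or_dvd this with h6 | h6
    · exact absurd h6 hdodd
    · exact Int.prime_two.dvd_of_dvd_pow h6
  obtain ⟨c, rfl⟩ := hw2
  refine ⟨a, c, ?_⟩
  congr 2
  · push_cast at ht; linarith
  · push_cast at hw; linarith

theorem isIntegral_gen (h : IsEvenImaginaryQuadratic Δ s) : IsIntegral ℤ s := by
  refine IsIntegral.of_pow two_pos ?_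
  rw [h.sq]; exact isIntegral_algebraMap (A := K) (x := Δ)

/-- A unit `u + v √Δ` satisfies `u² - Δ v² = 1` with `-Δ ≥ 1`, which bounds `|u|` and `|v|` by `1`.
-/
theorem finite_units (h : IsEvenImaginaryQuadratic Δ s) : Finite (𝓞 K)ˣ := by
  have hfin : (Set.image2 (fun u v : ℤ => (u : ℚ) • (1 : K) + (v : ℚ) • s)
      (Set.Icc (-1) 1) (Set.Icc (-1) 1)).Finite :=
    Set.Finite.image2 _ (Set.finite_Icc _ _) (Set.finite_Icc _ _)
  have : Finite (Set.image2 (fun u v : ℤ => (u : ℚ) • (1 : K) + (v : ℚ) • s)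
      (Set.Icc (-1) 1) (Set.Icc (-1) 1)) := hfin
  refine Finite.of_injective (β := Set.image2 (fun u v : ℤ => (u : ℚ) • (1 : K) + (v : ℚ) • s)
      (Set.Icc (-1) 1) (Set.Icc (-1) 1)) (fun e => ⟨((e : 𝓞 K) : K), ?_⟩) ?_
  · obtain ⟨u, v, huv⟩ := h.exists_int_coords (e : 𝓞 K).isIntegral_coe
    have hn := (NumberField.isUnit_iff_norm (K := K)).1 e.isUnit
    rw [RingOfIntegers.coe_norm] at hn
    change |Algebra.norm ℚ (algebraMap (𝓞 K) K e)| = 1 at hn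
    rw [huv, h.norm_coords] at hn
    have hn' : |u ^ 2 - Δ * v ^ 2| = 1 := by exact_mod_cast hn
    have hΔ := h.neg
    have hle : u ^ 2 - Δ * v ^ 2 ≤ 1 := hn' ▸ le_abs_self _
    refine ⟨u, ?_, v, ?_, huv.symm⟩
    · rw [Set.mem_Icc]; constructor <;> nlinarith [sq_nonneg v]
    · rw [Set.mem_Icc]; constructor <;> nlinarith [sq_nonneg u, sq_nonneg v]
  · intro e e' hee
    simpa [Units.ext_iff] using hee

/-! ### Trace, norm and conjugation under an embedding into `B`. -/

section Embedding

variable {α β : ℚ}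

theorem map_mul_self (h : IsEvenImaginaryQuadratic Δ s) (φ : K →ₐ[ℚ] ℍ[ℚ, α, β]) : φ s * φ s = (Δ : ℚ) • 1 := by
  rw [← map_mul, h.mul_self, map_smul, map_one]

/-- If the trace were nonzero, the quadratic equation of `φ s`, whose square is rational, would make
`φ s` a rational scalar. -/
theorem trd_map_gen (h : IsEvenImaginaryQuadratic Δ s) (φ : K →ₐ[ℚ] ℍ[ℚ, α, β]) : trd (φ s) = 0 := by
  by_contra hne
  have h1 := mul_self_eq (φ s)
  rw [h.map_mul_self φ] at h1
  have h2 : φ s = ((trd (φ s))⁻¹ * (Δ + nrd (φ s))) • (1 : ℍ[ℚ, α, β]) := by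
    rw [mul_smul, add_smul, h1, sub_add_cancel, smul_smul, inv_mul_cancel₀ hne, one_smul]
  have h3 : φ (s - ((trd (φ s))⁻¹ * (Δ + nrd (φ s))) • 1) = 0 := by
    rw [map_sub, map_smul, map_one, ← h2, sub_self]
  have h4 := φ.toRingHom.injective (h3.trans (map_zero φ).symm)
  have h5 := h.coords_eq_zero (u := -((trd (φ s))⁻¹ * (Δ + nrd (φ s)))) (v := 1)
    (by rw [← h4, neg_smul, one_smul]; abel)
  exact one_ne_zero h5.2

theorem nrd_map_gen (h : IsEvenImaginaryQuadratic Δ s) (φ : K →ₐ[ℚ] ℍ[ℚ, α, β]) : nrd (φ s) = -Δ := by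
  have h1 := mul_self_eq (φ s)
  rw [h.map_mul_self φ, h.trd_map_gen φ, zero_smul, zero_sub] at h1
  have h2 := congrArg QuaternionAlgebra.re h1
  simp at h2
  linarith

theorem trd_map (h : IsEvenImaginaryQuadratic Δ s) (φ : K →ₐ[ℚ] ℍ[ℚ, α, β]) (x : K) :
    trd (φ x) = Algebra.trace ℚ K x := by
  obtain ⟨u, v, rfl⟩ := h.exists_coords x
  rw [h.trace_coords, map_add, map_smul, map_smul, map_one, trd_add, trd_smul, trd_smul,
    h.trd_map_gen φ, trd_one]; ring

theorem star_map (h : IsEvenImaginaryQuadratic Δ s) (φ : K →ₐ[ℚ] ℍ[ℚ, α, β]) (x : K) :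
    star (φ x) = φ (conj x) := by
  rw [star_eq_trd_sub, h.trd_map φ, conj, map_sub, AlgHom.commutes, Algebra.algebraMap_eq_smul_one]

theorem nrd_map (h : IsEvenImaginaryQuadratic Δ s) (φ : K →ₐ[ℚ] ℍ[ℚ, α, β]) (x : K) :
    nrd (φ x) = Algebra.norm ℚ x := by
  have h1 : nrd (φ x) • (1 : ℍ[ℚ, α, β]) = Algebra.norm ℚ x • (1 : ℍ[ℚ, α, β]) := by
    rw [← star_mul_self_eq, h.star_map φ, ← map_mul, h.conj_mul_self, map_smul, map_one]
  have h2 := congrArg QuaternionAlgebra.re h1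
  simpa using h2

end Embedding

end IsEvenImaginaryQuadratic

/-! ### Norms of fractional ideals, and inert primes. -/

section FractionalIdeals

variable {K : Type*} [Field K] [NumberField K]

theorem mem_one_iff_isIntegral {K : Type*} [Field K] {x : K} :
    x ∈ (1 : FractionalIdeal (𝓞 K)⁰ K) ↔ IsIntegral ℤ x := by
  rw [FractionalIdeal.mem_one_iff]
  constructor
  · rintro ⟨a, rfl⟩; exact a.isIntegral_coe
  · intro hx; exact ⟨⟨x, hx⟩, rfl⟩

theorem absNorm_pos {I : FractionalIdeal (𝓞 K)⁰ K} (hI : I ≠ 0) :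
    0 < FractionalIdeal.absNorm I :=
  lt_of_le_of_ne (FractionalIdeal.absNorm_nonneg I)
    (Ne.symm fun h => hI (FractionalIdeal.absNorm_eq_zero_iff.1 h))

/-- The inclusion `x I ⊆ I` can be multiplied by `I⁻¹`. -/
theorem isIntegral_of_forall_mul_mem {I : FractionalIdeal (𝓞 K)⁰ K} (hI : I ≠ 0) {x : K}
    (hx : ∀ y ∈ I, x * y ∈ I) : IsIntegral ℤ x := by
  rw [← mem_one_iff_isIntegral, ← FractionalIdeal.spanSingleton_le_iff_mem]
  have h1 := FractionalIdeal.spanSingleton_mul_le_iff.2 hx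
  calc FractionalIdeal.spanSingleton (𝓞 K)⁰ x
      = FractionalIdeal.spanSingleton (𝓞 K)⁰ x * I * I⁻¹ := by
        rw [mul_assoc, mul_inv_cancel₀ hI, mul_one]
    _ ≤ I * I⁻¹ := mul_le_mul_left h1 _
    _ = 1 := mul_inv_cancel₀ hI

namespace IsEvenImaginaryQuadratic

variable {Δ : ℤ} {s : K}

/-- The ideal `(x) I⁻¹` is integral, and norms from an imaginary quadratic field are nonnegative. -/
theorem exists_norm_eq_mul_absNorm (h : IsEvenImaginaryQuadratic Δ s)
    {I : FractionalIdeal (𝓞 K)⁰ K} (hI : I ≠ 0) {x : K} (hx : x ∈ I) :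
    ∃ n : ℤ, Algebra.norm ℚ x = n * FractionalIdeal.absNorm I := by
  have h1 : FractionalIdeal.spanSingleton (𝓞 K)⁰ x * I⁻¹ ≤ 1 := by
    rw [← mul_inv_cancel₀ hI]
    exact mul_le_mul_left (FractionalIdeal.spanSingleton_le_iff_mem.2 hx) _
  obtain ⟨J, hJ⟩ := FractionalIdeal.le_one_iff_exists_coeIdeal.1 h1
  have h2 : FractionalIdeal.spanSingleton (𝓞 K)⁰ x = J * I := by
    rw [hJ, mul_assoc, inv_mul_cancel₀ hI, mul_one]
  have h3 := congrArg FractionalIdeal.absNorm h2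
  rw [map_mul, FractionalIdeal.absNorm_span_singleton, FractionalIdeal.coeIdeal_absNorm] at h3
  refine ⟨Ideal.absNorm J, ?_⟩
  have h4 : 0 ≤ Algebra.norm ℚ x := by
    by_cases hx0 : x = 0
    · subst hx0; simp
    · exact (h.norm_pos hx0).le
  rw [← abs_of_nonneg h4, h3]; simp

theorem trace_conj_mul (h : IsEvenImaginaryQuadratic Δ s)
    {I : FractionalIdeal (𝓞 K)⁰ K} {q : ℚ}
    (hq : ∀ x ∈ I, ∃ n : ℤ, Algebra.norm ℚ x = n * q) {x y : K} (hx : x ∈ I) (hy : y ∈ I) :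
    ∃ n : ℤ, Algebra.trace ℚ K (conj x * y) = n * q := by
  obtain ⟨a, ha⟩ := hq x hx
  obtain ⟨b, hb⟩ := hq y hy
  obtain ⟨c, hc⟩ := hq (x + y) (Submodule.add_mem _ hx hy)
  refine ⟨c - a - b, ?_⟩
  rw [h.norm_add] at hc
  push_cast
  linarith

/-- The norm of `x̄ y` is divisible by `N(I)²`, and its trace by `N(I)` through polarization of the
norm form. -/
theorem isIntegral_conj_mul (h : IsEvenImaginaryQuadratic Δ s)
    {I : FractionalIdeal (𝓞 K)⁰ K} (hI : I ≠ 0) {x y : K} (hx : x ∈ I) (hy : y ∈ I) :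
    IsIntegral ℤ ((FractionalIdeal.absNorm I)⁻¹ • (conj x * y)) := by
  have hI0 := (absNorm_pos hI).ne'
  obtain ⟨t, ht⟩ := h.trace_conj_mul (fun x hx => h.exists_norm_eq_mul_absNorm hI hx) hx hy
  obtain ⟨a, ha⟩ := h.exists_norm_eq_mul_absNorm hI hx
  obtain ⟨b, hb⟩ := h.exists_norm_eq_mul_absNorm hI hy
  refine h.isIntegral_of_trace_norm (t := t) (n := a * b) ?_ ?_
  · rw [map_smul, ht, smul_eq_mul]; field_simp
  · rw [h.norm_smul, map_mul, h.norm_conj, ha, hb]; push_cast; field_simp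

theorem smul_conj_mem (h : IsEvenImaginaryQuadratic Δ s)
    {I : FractionalIdeal (𝓞 K)⁰ K} (hI : I ≠ 0) {x : K} (hx : x ∈ I⁻¹) :
    FractionalIdeal.absNorm I • conj x ∈ I := by
  rw [← inv_inv I, FractionalIdeal.mem_inv_iff (inv_ne_zero hI)]
  intro y hy
  rw [mem_one_iff_isIntegral, inv_inv]
  have := h.isIntegral_conj_mul (inv_ne_zero hI) hx hy
  rwa [map_inv₀, inv_inv, ← smul_mul_assoc] at this

/-- The identity `Ī I = N(I) o_k`, in additive form. -/
theorem absNorm_smul_mem_closure (h : IsEvenImaginaryQuadratic Δ s)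
    {I : FractionalIdeal (𝓞 K)⁰ K} (hI : I ≠ 0) {x : K} (hx : IsIntegral ℤ x) :
    FractionalIdeal.absNorm I • x ∈
      AddSubgroup.closure {z | ∃ a ∈ I, ∃ b ∈ I, z = conj a * b} := by
  have h1 : x ∈ I⁻¹ * I := by rw [inv_mul_cancel₀ hI]; exact mem_one_iff_isIntegral.2 hx
  refine FractionalIdeal.mul_induction_on h1 (fun k hk l hl => ?_) (fun x y hx hy => ?_)
  · refine AddSubgroup.subset_closure ⟨_, h.smul_conj_mem hI hk, l, hl, ?_⟩
    rw [conj_smul, h.conj_conj, smul_mul_assoc]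
  · rw [smul_add]; exact add_mem hx hy

/-- The product of `u + v √Δ` and its conjugate lies in the prime ideal `(p)`, hence one factor
does, and `p` divides its coordinates. -/
theorem int_anisotropic (h : IsEvenImaginaryQuadratic Δ s) {p : ℕ} (hp : p.Prime)
    (hin : (Ideal.span {(p : 𝓞 K)}).IsPrime) {u v : ℤ} (huv : (p : ℤ) ∣ u ^ 2 - Δ * v ^ 2) :
    (p : ℤ) ∣ u ∧ (p : ℤ) ∣ v := by
  have hp0 : (p : ℚ) ≠ 0 := by exact_mod_cast hp.ne_zero
  have hpi : Prime (p : ℤ) := Nat.prime_iff_prime_int.1 hp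
  let S : 𝓞 K := ⟨s, h.isIntegral_gen⟩
  have hS : S * S = (Δ : 𝓞 K) := by
    apply NumberField.RingOfIntegers.coe_injective
    change s * s = _
    rw [← pow_two, h.sq]; simp
  -- If `p ∤ c`, write `y p + z c = 1`; multiplying by `z` turns the hypothesis into integrality of
  -- `(√Δ + z a) / p`.
  have key : ∀ a c : ℤ, (a : 𝓞 K) + c * S ∈ Ideal.span {(p : 𝓞 K)} → (p : ℤ) ∣ c := by
    intro a c hac
    by_contra hpc
    obtain ⟨y, z, hyz⟩ := (hpi.coprime_iff_not_dvd.2 hpc : IsCoprime (p : ℤ) c)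
    obtain ⟨w, hw⟩ := Ideal.mem_span_singleton.1 hac
    refine h.not_isIntegral hp (-(z * a)) ?_
    have e : (p : ℚ)⁻¹ • (s - ((-(z * a) : ℤ) : ℚ) • (1 : K)) =
        (((z : 𝓞 K) * w + y * S : 𝓞 K) : K) := by
      rw [inv_smul_eq_iff₀ hp0]
      have hw' := congrArg (fun t : 𝓞 K => (t : K)) hw
      have hyz' : (y : K) * p + z * c = 1 := by exact_mod_cast hyz
      have hSs : ((S : 𝓞 K) : K) = s := rfl
      simp only [map_add, map_mul, map_intCast, map_natCast, hSs] at hw'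
      simp only [Algebra.smul_def, map_add, map_mul, map_intCast, map_natCast, hSs]
      push_cast
      linear_combination (z : K) * hw' - s * hyz'
    rw [e]; exact NumberField.RingOfIntegers.isIntegral_coe _
  obtain ⟨w, hw⟩ := huv
  have hmem : ((u : 𝓞 K) + v * S) * (u + ((-v : ℤ) : 𝓞 K) * S) ∈ Ideal.span {(p : 𝓞 K)} := by
    rw [Ideal.mem_span_singleton]
    refine ⟨(w : 𝓞 K), ?_⟩
    have hw' : (u : 𝓞 K) ^ 2 - Δ * v ^ 2 = p * w := by exact_mod_cast congrArg (Int.cast (R := 𝓞 K)) hw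
    rw [← hw']; push_cast
    linear_combination -(v : 𝓞 K) ^ 2 * hS
  have hv : (p : ℤ) ∣ v := by
    rcases hin.mem_or_mem hmem with h1 | h1
    · exact key _ _ h1
    · exact (dvd_neg.1 (key _ _ h1))
  refine ⟨?_, hv⟩
  refine hpi.dvd_of_dvd_pow (n := 2) ?_
  have : u ^ 2 = p * w + Δ * v ^ 2 := by linarith
  rw [this]
  exact dvd_add (dvd_mul_right _ _) (Dvd.dvd.mul_left (Dvd.dvd.pow hv two_ne_zero) _)

/-- At an inert prime, the norm of a fractional ideal is the norm of one of its elements up to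
units. -/
theorem exists_norm_not_dvd (h : IsEvenImaginaryQuadratic Δ s) {p : ℕ} (hp : p.Prime)
    (hin : (Ideal.span {(p : 𝓞 K)}).IsPrime) {I : FractionalIdeal (𝓞 K)⁰ K} (hI : I ≠ 0) :
    ∃ x ∈ I, ∃ n : ℤ, Algebra.norm ℚ x = n * FractionalIdeal.absNorm I ∧ ¬ (p : ℤ) ∣ n := by
  by_contra! hcon
  have hp0 : (p : ℚ) ≠ 0 := by exact_mod_cast hp.ne_zero
  have hpi : Prime (p : ℤ) := Nat.prime_iff_prime_int.1 hp
  have hI0 := (absNorm_pos hI).ne'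
  have hq : ∀ x ∈ I, ∃ n : ℤ, Algebra.norm ℚ x = n * (p * FractionalIdeal.absNorm I) := by
    intro x hx
    obtain ⟨n, hn⟩ := h.exists_norm_eq_mul_absNorm hI hx
    obtain ⟨c, rfl⟩ := hcon x hx n hn
    exact ⟨c, by rw [hn]; push_cast; ring⟩
  -- If every norm from `I` were divisible by `p N(I)`, anisotropy would make every `x̄ y / N(I)`
  -- divisible by `p`.
  have hint : ∀ x ∈ I, ∀ y ∈ I,
      IsIntegral ℤ ((p : ℚ)⁻¹ • (FractionalIdeal.absNorm I)⁻¹ • (conj x * y)) := by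
    intro x hx y hy
    obtain ⟨u, v, huv⟩ := h.exists_int_coords (h.isIntegral_conj_mul hI hx hy)
    obtain ⟨a, ha⟩ := hq x hx
    obtain ⟨b, hb⟩ := hq y hy
    have hn := congrArg (Algebra.norm ℚ) huv
    rw [h.norm_coords, h.norm_smul, map_mul, h.norm_conj, ha, hb] at hn
    have hn' : u ^ 2 - Δ * v ^ 2 = p * (p * (a * b)) := by
      have : (u : ℚ) ^ 2 - Δ * v ^ 2 = p * (p * (a * b)) := by rw [← hn]; field_simp
      exact_mod_cast this
    obtain ⟨⟨u', rfl⟩, ⟨v', rfl⟩⟩ := h.int_anisotropic hp hin ⟨_, hn'⟩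
    rw [huv, smul_add, smul_smul, smul_smul]
    have e : ∀ w : ℤ, (p : ℚ)⁻¹ * ((p * w : ℤ) : ℚ) = w := fun w => by
      push_cast; field_simp
    rw [e, e, Int.cast_smul_eq_zsmul, Int.cast_smul_eq_zsmul]
    exact (isIntegral_one.smul u').add (h.isIntegral_gen.smul v')
  -- Applied to `x = N(I) ȳ` with `y ∈ I⁻¹`, the previous divisibility says that `1/p` preserves
  -- `I⁻¹`.
  have hinv : ∀ y ∈ I⁻¹, ((p : ℚ)⁻¹ • (1 : K)) * y ∈ I⁻¹ := by
    intro y hy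
    rw [FractionalIdeal.mem_inv_iff hI]
    intro z hz
    rw [mem_one_iff_isIntegral]
    have := hint _ (h.smul_conj_mem hI hy) z hz
    rw [conj_smul, h.conj_conj, smul_mul_assoc, smul_smul (FractionalIdeal.absNorm I)⁻¹,
      inv_mul_cancel₀ hI0, one_smul] at this
    rwa [smul_mul_assoc, one_mul, smul_mul_assoc]
  have h1 := isIntegral_of_forall_mul_mem (inv_ne_zero hI) hinv
  obtain ⟨n, hn⟩ := IsIntegrallyClosed.isIntegral_iff.1 (Algebra.isIntegral_norm ℚ h1)
  rw [h.norm_smul, map_one, mul_one] at hn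
  simp only [eq_intCast] at hn
  have hn' : n * p ^ 2 = 1 := by
    have : (n : ℚ) * p ^ 2 = 1 := by rw [hn]; field_simp
    exact_mod_cast this
  exact hpi.not_isUnit (isUnit_of_dvd_one ⟨n * p, by rw [← hn']; ring⟩)

end IsEvenImaginaryQuadratic

end FractionalIdeals

/-! ### Local maximality, and reduction at unramified primes. -/

section Local

variable {α β : ℚ} {O : Subring ℍ[ℚ, α, β]}

theorem exists_int_of_norm_le_one {p : ℕ} [hp : Fact p.Prime] {q : ℚ} {k : ℕ} {n : ℤ}
    (hq : (p : ℚ) ^ k * q = n) (h1 : ‖(q : ℚ_[p])‖ ≤ 1) : ∃ z : ℤ, q = z := by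
  have hp0 : (p : ℚ) ≠ 0 := by exact_mod_cast hp.out.ne_zero
  have h2 : ‖(n : ℚ_[p])‖ ≤ (p : ℝ) ^ (-k : ℤ) := by
    have : (n : ℚ_[p]) = (p : ℚ_[p]) ^ k * (q : ℚ_[p]) := by exact_mod_cast congrArg (Rat.cast (K := ℚ_[p])) hq.symm
    rw [this, norm_mul, norm_pow, Padic.norm_p, zpow_neg, zpow_natCast, inv_pow]
    exact mul_le_of_le_one_right (by positivity) h1
  obtain ⟨z, hz⟩ := (Padic.norm_int_le_pow_iff_dvd n k).1 h2
  refine ⟨z, mul_left_cancel₀ (pow_ne_zero k hp0) ?_⟩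
  rw [hq, hz]; push_cast; rfl

/-- The subring `O[1/p]`. -/
def awayFrom (O : Subring ℍ[ℚ, α, β]) (p : ℕ) : Subring ℍ[ℚ, α, β] where
  carrier := {x | ∃ k : ℕ, ((p : ℚ) ^ k) • x ∈ O}
  mul_mem' := by
    rintro x y ⟨k, hk⟩ ⟨l, hl⟩
    refine ⟨k + l, ?_⟩
    rw [pow_add, ← smul_mul_smul_comm]
    exact mul_mem hk hl
  one_mem' := ⟨0, by simp⟩
  add_mem' := by
    rintro x y ⟨k, hk⟩ ⟨l, hl⟩
    refine ⟨k + l, ?_⟩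
    rw [smul_add]
    refine add_mem ?_ ?_
    · have := nsmul_mem_of_mem (p ^ l) hk
      rwa [smul_smul, Nat.cast_pow, ← pow_add, add_comm] at this
    · have := nsmul_mem_of_mem (p ^ k) hl
      rwa [smul_smul, Nat.cast_pow, ← pow_add] at this
  zero_mem' := ⟨0, by simp⟩
  neg_mem' := by
    rintro x ⟨k, hk⟩
    exact ⟨k, by rw [smul_neg]; exact neg_mem hk⟩

theorem le_awayFrom (O : Subring ℍ[ℚ, α, β]) (p : ℕ) : O ≤ awayFrom O p :=
  fun x hx => ⟨0, by simpa using hx⟩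

theorem inv_smul_mem_awayFrom {p : ℕ} (hp : p ≠ 0) {x : ℍ[ℚ, α, β]} (hx : x ∈ O) :
    (p : ℚ)⁻¹ • x ∈ awayFrom O p :=
  ⟨1, by rwa [pow_one, smul_smul, mul_inv_cancel₀ (by exact_mod_cast hp), one_smul]⟩

/-- Local maximality of a maximal order. -/
theorem IsMaximalOrder.mem_of_mem_awayFrom (hα : α ≠ 0) (hβ : β ≠ 0) (hO : IsMaximalOrder O)
    (p : ℕ) [hp : Fact p.Prime] {V : Subring ℍ[ℚ, α, β]} (hV : ∀ x ∈ V, ‖(trd x : ℚ_[p])‖ ≤ 1)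
    (hle : O ≤ V) {x : ℍ[ℚ, α, β]} (hx : x ∈ awayFrom O p) (hxV : x ∈ V) : x ∈ O := by
  -- Traces on `O[1/p] ∩ V` are integral away from `p` because of `O[1/p]`, and at `p` because of
  -- `V`.
  have h := hO.eq_of_trd_integral hα hβ (O' := awayFrom O p ⊓ V)
    (le_inf (le_awayFrom O p) hle) ?_
  · rw [← h]; exact ⟨hx, hxV⟩
  · rintro y ⟨⟨k, hk⟩, hyV⟩
    obtain ⟨n, hn⟩ := hO.1.exists_trd_eq hk
    rw [trd_smul] at hn
    exact exists_int_of_norm_le_one hn (hV y hyV)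

theorem eq_coords (x : ℍ[ℚ, α, β]) : x = x.re • (1 : ℍ[ℚ, α, β]) +
    x.imI • (⟨0, 1, 0, 0⟩ : ℍ[ℚ, α, β]) + x.imJ • (⟨0, 0, 1, 0⟩ : ℍ[ℚ, α, β]) +
    x.imK • (⟨0, 0, 0, 1⟩ : ℍ[ℚ, α, β]) := by
  ext <;> simp

/-- Reduced traces are the traces of any two-dimensional representation. -/
theorem trace_algHom_eq (hα : α ≠ 0) (hβ : β ≠ 0) {F : Type*} [Field F] [Algebra ℚ F]
    (f : ℍ[ℚ, α, β] →ₐ[ℚ] Matrix (Fin 2) (Fin 2) F) (x : ℍ[ℚ, α, β]) :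
    (f x).trace = algebraMap ℚ F (trd x) := by
  have : CharZero F := algebraRat.charZero F
  let T : ℍ[ℚ, α, β] →ₗ[ℚ] F := (Matrix.traceLinearMap (Fin 2) ℚ F).comp f.toLinearMap
  have hT : ∀ y, T y = (f y).trace := fun y => rfl
  -- If `z` anticommutes with `y` and `z² = c`, cyclicity of the trace gives `c T(y) = T(z y z) = -c
  -- T(y)`. So `i`, `j`, `k` have trace `0`.
  have key : ∀ (y z : ℍ[ℚ, α, β]) (c : ℚ), c ≠ 0 → z * z = c • 1 → z * y * z = (-c) • y →
      T y = 0 := by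
    intro y z c hc hz hyz
    have h1 : T (z * y * z) = c • T y := by
      rw [hT, map_mul, Matrix.trace_mul_comm, ← map_mul, ← mul_assoc, hz, smul_mul_assoc,
        one_mul, ← hT, map_smul]
    rw [hyz, map_smul, neg_smul] at h1
    have h2 : (2 * c) • T y = 0 := by
      rw [mul_smul, two_smul]; nth_rw 1 [← h1]; simp
    exact (smul_eq_zero.1 h2).resolve_left (mul_ne_zero two_ne_zero hc)
  have hi : T ⟨0, 1, 0, 0⟩ = 0 :=
    key _ ⟨0, 0, 1, 0⟩ β hβ (by ext <;> simp) (by ext <;> simp)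
  have hj : T ⟨0, 0, 1, 0⟩ = 0 :=
    key _ ⟨0, 1, 0, 0⟩ α hα (by ext <;> simp) (by ext <;> simp)
  have hk : T ⟨0, 0, 0, 1⟩ = 0 :=
    key _ ⟨0, 1, 0, 0⟩ α hα (by ext <;> simp) (by ext <;> simp)
  have h1 : T 1 = 2 := by rw [hT, map_one, Matrix.trace_one]; simp
  rw [← hT]
  conv_lhs => rw [eq_coords x]
  have hs : ∀ (c : ℚ) y, T y = 0 → T (c • y) = 0 := fun c y hy => by
    rw [map_smul, hy]; exact (Algebra.smul_def c (0 : F)).trans (mul_zero _)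
  rw [map_add, map_add, map_add, hs _ _ hi, hs _ _ hj, hs _ _ hk, map_smul, h1, trd_eq,
    map_mul, map_ofNat, Algebra.smul_def, mul_comm, add_zero, add_zero, add_zero]

/-- A two-dimensional `p`-adic representation can be conjugated so that an order acts by
`p`-integral matrices. -/
theorem IsOrder.exists_integral_rep (hO : IsOrder O) (p : ℕ) [hp : Fact p.Prime]
    (f : ℍ[ℚ, α, β] →ₐ[ℚ] Matrix (Fin 2) (Fin 2) ℚ_[p]) :
    ∃ g : ℍ[ℚ, α, β] →ₐ[ℚ] Matrix (Fin 2) (Fin 2) ℚ_[p],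
      ∀ x ∈ O, ∀ i j, ‖g x i j‖ ≤ 1 := by
  obtain ⟨T, hT⟩ := hO.1
  -- `L` is the lattice generated by the translates of `ℤ_p²` under `O`. It is stable under `O`, and
  -- the representation is rewritten in a `ℤ_p`-basis of `L`.
  let w : T × Fin 2 → (Fin 2 → ℚ_[p]) := fun t => (f t.1).mulVec (Pi.single t.2 1)
  let L : Submodule ℤ_[p] (Fin 2 → ℚ_[p]) := Submodule.span ℤ_[p] (Set.range w)
  have hL : ∀ x ∈ O, ∀ i, (f x).mulVec (Pi.single i 1) ∈ L := by
    intro x hx i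
    have hx' : x ∈ AddSubgroup.closure (T : Set ℍ[ℚ, α, β]) := by rw [hT]; exact hx
    clear hx
    induction hx' using AddSubgroup.closure_induction with
    | mem x hx => exact Submodule.subset_span ⟨(⟨x, hx⟩, i), rfl⟩
    | zero => rw [map_zero, Matrix.zero_mulVec]; exact zero_mem _
    | add x y _ _ hx hy => rw [map_add, Matrix.add_mulVec]; exact add_mem hx hy
    | neg x _ hx => rw [map_neg, Matrix.neg_mulVec]; exact neg_mem hx
  have hstab : ∀ x ∈ O, ∀ v ∈ L, (f x).mulVec v ∈ L := by
    intro x hx v hv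
    induction hv using Submodule.span_induction with
    | mem v hv =>
      obtain ⟨⟨t, i⟩, rfl⟩ := hv
      simp only [w]
      rw [Matrix.mulVec_mulVec, ← map_mul]
      refine hL _ (mul_mem hx ?_) i
      have : (t : ℍ[ℚ, α, β]) ∈ AddSubgroup.closure (T : Set ℍ[ℚ, α, β]) :=
        AddSubgroup.subset_closure t.2
      rw [hT] at this; exact this
    | zero => rw [Matrix.mulVec_zero]; exact zero_mem _
    | add u v _ _ hu hv => rw [Matrix.mulVec_add]; exact add_mem hu hv
    | smul c v _ hv => rw [Matrix.mulVec_smul]; exact Submodule.smul_mem _ _ hv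
  have hlat : Submodule.IsLattice ℚ_[p] L := by
    refine ⟨Submodule.fg_span (Set.finite_range w), top_le_iff.1 ?_⟩
    rw [← (Pi.basisFun ℚ_[p] (Fin 2)).span_eq]
    refine Submodule.span_mono ?_
    rintro _ ⟨i, rfl⟩
    have := hL 1 O.one_mem i
    rw [map_one, Matrix.one_mulVec] at this
    rw [Pi.basisFun_apply]; exact this
  have hfr : Module.finrank ℤ_[p] L = 2 := by
    rw [Submodule.IsLattice.finrank_of_pi]; simp
  let b : Module.Basis (Fin 2) ℤ_[p] L := Module.finBasisOfFinrankEq _ _ hfr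
  let b' : Module.Basis (Fin 2) ℚ_[p] (Fin 2 → ℚ_[p]) := b.extendOfIsLattice ℚ_[p]
  let E : Matrix (Fin 2) (Fin 2) ℚ_[p] →ₐ[ℚ_[p]] Matrix (Fin 2) (Fin 2) ℚ_[p] :=
    (LinearMap.toMatrixAlgEquiv b').toAlgHom.comp
      (Matrix.toLinAlgEquiv (Pi.basisFun ℚ_[p] (Fin 2))).toAlgHom
  refine ⟨(E.restrictScalars ℚ).comp f, fun x hx i j => ?_⟩
  have hmem : (f x).mulVec (b j : Fin 2 → ℚ_[p]) ∈ L := hstab x hx _ (b j).2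
  have h1 : (((E.restrictScalars ℚ).comp f) x) i j =
      b'.repr ((f x).mulVec (b j : Fin 2 → ℚ_[p])) i := by
    change LinearMap.toMatrixAlgEquiv b' (Matrix.toLinAlgEquiv (Pi.basisFun ℚ_[p] (Fin 2)) (f x)) i j = _
    rw [LinearMap.toMatrixAlgEquiv_apply]
    congr 2
    rw [Module.Basis.extendOfIsLattice_apply]
    change Matrix.toLin (Pi.basisFun ℚ_[p] (Fin 2)) (Pi.basisFun ℚ_[p] (Fin 2)) (f x) _ = _
    rw [Matrix.toLin_eq_toLin', Matrix.toLin'_apply]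
  have h2 : b'.repr ((f x).mulVec (b j : Fin 2 → ℚ_[p])) i = (b.repr ⟨_, hmem⟩ i : ℤ_[p]) := by
    have h3 : (f x).mulVec (b j : Fin 2 → ℚ_[p]) =
        ∑ l, ((b.repr ⟨_, hmem⟩ l : ℤ_[p]) : ℚ_[p]) • b' l := by
      have := congrArg (Submodule.subtype L) (b.sum_repr ⟨_, hmem⟩)
      rw [map_sum] at this
      refine this.symm.trans (Finset.sum_congr rfl fun l _ => ?_)
      rw [Module.Basis.extendOfIsLattice_apply]; rfl
    conv_lhs => rw [h3]
    rw [Module.Basis.repr_sum_self]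
  rw [h1, h2]
  exact PadicInt.norm_le_one _

/-- At an unramified prime a maximal order reduces to a matrix algebra over `𝔽_p`. -/
theorem IsMaximalOrder.exists_residue (hα : α ≠ 0) (hβ : β ≠ 0) (hO : IsMaximalOrder O)
    (p : ℕ) [hp : Fact p.Prime] (hsplit : ¬ IsRamifiedAt ℍ[ℚ, α, β] p) :
    ∃ r : O →+* Matrix (Fin 2) (Fin 2) (ZMod p),
      (∀ x : O, r x = 0 → (p : ℚ)⁻¹ • (x : ℍ[ℚ, α, β]) ∈ O) ∧
      ∀ x y : O, (y : ℍ[ℚ, α, β]) = star (x : ℍ[ℚ, α, β]) → r y = (r x).adjugate := by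
  obtain ⟨e⟩ := not_not.1 hsplit
  obtain ⟨g, hg⟩ := hO.1.exists_integral_rep p
    ((e.toAlgHom.restrictScalars ℚ).comp Algebra.TensorProduct.includeRight)
  let V : Subring ℍ[ℚ, α, β] :=
    ((PadicInt.subring p).matrix (n := Fin 2)).comap (g : ℍ[ℚ, α, β] →+* _)
  have hV : ∀ x, x ∈ V ↔ ∀ i j, ‖g x i j‖ ≤ 1 := fun x => Iff.rfl
  -- By local maximality, integrality of the matrix is the only condition at `p`. Hence an element
  -- whose matrix is divisible by `p` lies in `p O`.
  have hmem : ∀ x ∈ awayFrom O p, (∀ i j, ‖g x i j‖ ≤ 1) → x ∈ O := by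
    intro x hx hxV
    refine hO.mem_of_mem_awayFrom hα hβ p (V := V) (fun y hy => ?_)
      (fun y hy => (hV y).2 (hg y hy)) hx ((hV x).2 hxV)
    have h1 := trace_algHom_eq hα hβ g y
    rw [eq_ratCast] at h1
    rw [← h1, Matrix.trace_fin_two]
    exact (Padic.nonarchimedean _ _).trans (max_le ((hV y).1 hy _ _) ((hV y).1 hy _ _))
  let G : O →+* Matrix (Fin 2) (Fin 2) ℤ_[p] :=
    { toFun := fun x => Matrix.of fun i j => ⟨g x i j, hg x x.2 i j⟩
      map_one' := by
        refine Matrix.ext fun i j => PadicInt.ext ?_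
        change g 1 i j = _
        rw [map_one]
        fin_cases i <;> fin_cases j <;> simp
      map_mul' := fun x y => by
        refine Matrix.ext fun i j => PadicInt.ext ?_
        change g (x * y) i j = _
        rw [map_mul, Matrix.mul_apply, Matrix.mul_apply, Fin.sum_univ_two, Fin.sum_univ_two]
        rfl
      map_zero' := by
        refine Matrix.ext fun i j => PadicInt.ext ?_
        change g 0 i j = _
        rw [map_zero]; rfl
      map_add' := fun x y => by
        refine Matrix.ext fun i j => PadicInt.ext ?_
        change g (x + y) i j = _
        rw [map_add]; rfl }
  have hG : ∀ x i j, ((G x i j : ℤ_[p]) : ℚ_[p]) = g x i j := fun x i j => rfl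
  refine ⟨(PadicInt.toZMod (p := p)).mapMatrix.comp G, ?_, ?_⟩
  · intro x hx
    refine hmem _ (inv_smul_mem_awayFrom hp.out.ne_zero x.2) fun i j => ?_
    have h1 : PadicInt.toZMod (G x i j) = 0 := congrFun (congrFun hx i) j
    have h2 : G x i j ∈ RingHom.ker (PadicInt.toZMod (p := p)) := h1
    rw [PadicInt.ker_toZMod, PadicInt.maximalIdeal_eq_span_p, Ideal.mem_span_singleton] at h2
    obtain ⟨c, hc⟩ := h2
    have hp0 : (p : ℚ_[p]) ≠ 0 := by exact_mod_cast hp.out.ne_zero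
    have h3 : g ((p : ℚ)⁻¹ • (x : ℍ[ℚ, α, β])) i j = c := by
      rw [map_smul, Matrix.smul_apply, ← hG, hc, Algebra.smul_def]
      push_cast
      rw [inv_mul_cancel_left₀ hp0]
    rw [h3]; exact PadicInt.norm_le_one c
  · intro x y hxy
    -- For `2 × 2` matrices the adjugate is the trace minus the matrix, just as `star x = trd x -
    -- x`.
    have h1 : G y = (G x).adjugate := by
      have h2 : g y = algebraMap ℚ ℚ_[p] (trd (x : ℍ[ℚ, α, β])) • 1 - g x := by
        rw [hxy, star_eq_trd_sub, map_sub, map_smul, map_one, algebraMap_smul]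
      rw [← trace_algHom_eq hα hβ g, Matrix.trace_fin_two] at h2
      have h3 : ∀ i j, ((G y i j : ℤ_[p]) : ℚ_[p]) = (G x).adjugate i j := by
        intro i j
        rw [hG, h2, Matrix.adjugate_fin_two]
        fin_cases i <;> fin_cases j <;> simp [hG]
      ext i j
      exact PadicInt.ext (h3 i j)
    change (PadicInt.toZMod (p := p)).mapMatrix (G y) = ((PadicInt.toZMod (p := p)).mapMatrix (G x)).adjugate
    rw [h1, RingHom.map_adjugate]

end Local

/-! ### Coordinates of `B` adapted to `φ(√Δ)`. -/

section Coordinates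

variable {α β : ℚ} {K : Type*} [Field K] [NumberField K] {Δ : ℤ} {s : K}

/-- Every commutator `x φ(s) - φ(s) x` anticommutes with `φ(s)` and has trace `0`. If those with `x
= i, j, k` all had norm `0`, the three resulting equations would force `Nrd(φ s) = 0`, that is, `Δ =
0`. -/
theorem IsEvenImaginaryQuadratic.exists_anticommuting (h : IsEvenImaginaryQuadratic Δ s)
    (hα : α ≠ 0) (hβ : β ≠ 0) (φ : K →ₐ[ℚ] ℍ[ℚ, α, β]) :
    ∃ J : ℍ[ℚ, α, β], J * φ s = -(φ s * J) ∧ trd J = 0 ∧ nrd J ≠ 0 := by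
  have hcomm : ∀ x, (x * φ s - φ s * x) * φ s = -(φ s * (x * φ s - φ s * x)) := by
    intro x
    rw [sub_mul, mul_sub, ← mul_assoc, ← mul_assoc, h.map_mul_self φ, mul_assoc x,
      h.map_mul_self φ, smul_mul_assoc, mul_smul_comm, one_mul, mul_one]
    abel
  have htr : ∀ x, trd (x * φ s - φ s * x) = 0 := by
    intro x; simp [trd_eq]; ring
  have hre := h.trd_map_gen φ
  have hn := h.nrd_map_gen φ
  rw [trd_eq] at hre
  rw [nrd_eq] at hn
  by_contra! hcon
  have e1 := hcon _ (hcomm ⟨0, 1, 0, 0⟩) (htr _)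
  have e2 := hcon _ (hcomm ⟨0, 0, 1, 0⟩) (htr _)
  have e3 := hcon _ (hcomm ⟨0, 0, 0, 1⟩) (htr _)
  have hre' : (φ s).re = 0 := by linarith
  simp [nrd_eq, hre'] at e1 e2 e3 hn
  have hΔ := h.neg_rat
  generalize (φ s).imI = a at *
  generalize (φ s).imJ = b at *
  generalize (φ s).imK = c at *
  have f1 : b ^ 2 = α * c ^ 2 := by
    refine mul_left_cancel₀ (mul_ne_zero (mul_ne_zero four_ne_zero hα) hβ) ?_
    linear_combination e1
  have f2 : a ^ 2 = β * c ^ 2 := by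
    refine mul_left_cancel₀ (mul_ne_zero (mul_ne_zero four_ne_zero hα) hβ) ?_
    linear_combination e2
  have f3 : α * a ^ 2 + β * b ^ 2 = 0 := by
    refine mul_left_cancel₀ (mul_ne_zero (mul_ne_zero four_ne_zero hα) hβ) ?_
    linear_combination -e3
  have f4 : (Δ : ℚ) = 0 := by
    linear_combination hn + (1/2) * α * f2 + (1/2) * β * f1 + (1/2) * f3
  exact hΔ.ne f4

/-- The algebra `B` in the coordinates given by `φ(√Δ)` and an element anticommuting with it. -/
theorem IsEvenImaginaryQuadratic.exists_algEquiv (h : IsEvenImaginaryQuadratic Δ s)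
    (φ : K →ₐ[ℚ] ℍ[ℚ, α, β]) {J : ℍ[ℚ, α, β]} (hJ : J * φ s = -(φ s * J)) (htr : trd J = 0)
    (hn : nrd J ≠ 0) :
    ∃ E : ℍ[ℚ, (Δ : ℚ), -nrd J] ≃ₐ[ℚ] ℍ[ℚ, α, β], E ⟨0, 1, 0, 0⟩ = φ s ∧
      ∀ x, nrd (E x) = nrd x := by
  let q : QuaternionAlgebra.Basis ℍ[ℚ, α, β] (Δ : ℚ) 0 (-nrd J) :=
    { i := φ s
      j := J
      k := φ s * J
      i_mul_i := by rw [h.map_mul_self φ, zero_smul, add_zero]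
      j_mul_j := by rw [mul_self_eq, htr, zero_smul, zero_sub, neg_smul]
      i_mul_j := rfl
      j_mul_i := by rw [hJ, zero_smul, zero_sub] }
  have hq : ∀ x : ℍ[ℚ, (Δ : ℚ), -nrd J], q.liftHom x =
      x.re • 1 + x.imI • φ s + x.imJ • J + x.imK • (φ s * J) := by
    intro x
    change q.lift x = _
    rw [QuaternionAlgebra.Basis.lift, Algebra.algebraMap_eq_smul_one]
  have hinj : Function.Injective q.liftHom := by
    rw [injective_iff_map_eq_zero]
    intro x hx
    have hk : ∀ u v : ℚ, q.liftHom ⟨u, v, 0, 0⟩ = 0 → u = 0 ∧ v = 0 := by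
      intro u v huv
      rw [hq] at huv
      refine h.coords_eq_zero (φ.toRingHom.injective ?_)
      change φ _ = φ 0
      rw [map_add, map_smul, map_smul, map_one, map_zero, ← huv]
      simp
    -- The operator `x ↦ Δ x + i x i` kills the `j` and `k` parts and multiplies the rest by `2Δ`.
    have e1 : q.liftHom ((Δ : ℚ) • x + ⟨0, 1, 0, 0⟩ * x * ⟨0, 1, 0, 0⟩) = 0 := by
      rw [map_add, map_smul, map_mul, map_mul, hx, smul_zero, mul_zero, zero_mul, add_zero]
    have e2 : (Δ : ℚ) • x + ⟨0, 1, 0, 0⟩ * x * ⟨0, 1, 0, 0⟩ =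
        (⟨2 * Δ * x.re, 2 * Δ * x.imI, 0, 0⟩ : ℍ[ℚ, (Δ : ℚ), -nrd J]) := by
      ext <;> simp <;> ring
    rw [e2] at e1
    have hΔ := h.neg_rat.ne
    obtain ⟨f1, f2⟩ := hk _ _ e1
    have f1 : x.re = 0 := by simpa [hΔ, h.neg.ne] using f1
    have f2 : x.imI = 0 := by simpa [hΔ, h.neg.ne] using f2
    have e3 : q.liftHom ⟨x.imJ, x.imK, 0, 0⟩ * J = 0 := by
      rw [← hx, hq, hq, f1, f2]
      simp [add_mul]
    have e4 := (isUnit_of_nrd_ne_zero hn).mul_left_eq_zero.1 e3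
    obtain ⟨f3, f4⟩ := hk _ _ e4
    ext
    · exact f1
    · exact f2
    · exact f3
    · exact f4
  have hbij : Function.Bijective q.liftHom := by
    refine ⟨hinj, ?_⟩
    refine (LinearMap.injective_iff_surjective_of_finrank_eq_finrank (f := q.liftHom.toLinearMap)
      ?_).1 hinj
    rw [QuaternionAlgebra.finrank_eq_four, QuaternionAlgebra.finrank_eq_four]
  refine ⟨AlgEquiv.ofBijective _ hbij, ?_, ?_⟩
  · rw [AlgEquiv.coe_ofBijective, hq]; simp
  · intro x
    have hst : star (q.liftHom x) = q.liftHom (star x) := by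
      have hS : star (φ s) = -φ s := by rw [star_eq_trd_sub, h.trd_map_gen φ, zero_smul, zero_sub]
      have hJs : star J = -J := by rw [star_eq_trd_sub, htr, zero_smul, zero_sub]
      rw [hq, hq]
      simp only [star_add, star_smul, star_mul, star_one, hS, hJs, star_trivial]
      simp [hJ]
    have e1 : nrd (q.liftHom x) • (1 : ℍ[ℚ, α, β]) = nrd x • 1 := by
      rw [← star_mul_self_eq, hst, ← map_mul, star_mul_self_eq, map_smul, map_one]
    have e2 := congrArg QuaternionAlgebra.re e1
    simpa using e2

end Coordinates

/-! ### Norms from quadratic extensions of `ℚ_p`, and splitting. -/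

section Padic

variable {p : ℕ} [hp : Fact p.Prime]

theorem toZMod_eq_zero_iff {x : ℤ_[p]} : PadicInt.toZMod x = 0 ↔ ‖x‖ < 1 := by
  rw [← RingHom.mem_ker, PadicInt.ker_toZMod, IsLocalRing.mem_maximalIdeal, PadicInt.mem_nonunits]

theorem exists_sq_eq (hp2 : p ≠ 2) {a c : ℤ_[p]} (hc : ‖c‖ = 1) (hac : ‖c ^ 2 - a‖ < 1) :
    ∃ z : ℤ_[p], z ^ 2 = a := by
  have h2 : ‖(2 : ℤ_[p])‖ = 1 := by
    refine le_antisymm (PadicInt.norm_le_one _) (not_lt.1 fun hlt => hp2 ?_)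
    have h3 : ‖((2 : ℤ) : ℤ_[p])‖ < 1 := by exact_mod_cast hlt
    rw [PadicInt.norm_int_lt_one_iff_dvd] at h3
    exact (Nat.prime_dvd_prime_iff_eq hp.out Nat.prime_two).1 (by exact_mod_cast h3)
  obtain ⟨z, hz, -⟩ := hensels_lemma (F := Polynomial.X ^ 2 - Polynomial.C a) (a := c) (by
    simpa [h2, hc, one_add_one_eq_two] using hac)
  refine ⟨z, ?_⟩
  simpa [sub_eq_zero] using hz

/-- Counting values gives a solution modulo `p`. Its coordinates are not both zero because `e` is a
unit, and Hensel's lemma corrects a nonzero one. -/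
theorem exists_sq_sub_mul_sq_eq (hp2 : p ≠ 2) {d e : ℤ_[p]} (hd : ‖d‖ = 1) (he : ‖e‖ = 1) :
    ∃ u v : ℤ_[p], u ^ 2 - d * v ^ 2 = e := by
  have hd0 : PadicInt.toZMod d ≠ 0 := fun h0 => by
    rw [toZMod_eq_zero_iff, hd] at h0; exact lt_irrefl _ h0
  have he0 : PadicInt.toZMod e ≠ 0 := fun h0 => by
    rw [toZMod_eq_zero_iff, he] at h0; exact lt_irrefl _ h0
  obtain ⟨x, y, hxy⟩ := FiniteField.exists_root_sum_quadratic
    (f := Polynomial.X ^ 2 - Polynomial.C (PadicInt.toZMod e))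
    (g := Polynomial.C (-PadicInt.toZMod d) * Polynomial.X ^ 2)
    (Polynomial.degree_X_pow_sub_C two_pos _) (Polynomial.degree_C_mul_X_pow 2 (neg_ne_zero.2 hd0))
    (by rw [ZMod.card]; exact Nat.odd_iff.1 (hp.out.odd_of_ne_two hp2))
  simp only [Polynomial.eval_sub, Polynomial.eval_pow, Polynomial.eval_X, Polynomial.eval_C,
    Polynomial.eval_mul] at hxy
  obtain ⟨u, rfl⟩ := ZMod.ringHom_surjective PadicInt.toZMod x
  obtain ⟨v, rfl⟩ := ZMod.ringHom_surjective PadicInt.toZMod y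
  have hunit : ∀ w : ℤ_[p], PadicInt.toZMod w ≠ 0 → ‖w‖ = 1 := fun w hw =>
    le_antisymm (PadicInt.norm_le_one _) (not_lt.1 fun hlt => hw (toZMod_eq_zero_iff.2 hlt))
  by_cases hu : PadicInt.toZMod u = 0
  · have hv : PadicInt.toZMod v ≠ 0 := by
      intro hv
      rw [hu, hv] at hxy
      apply he0
      linear_combination -hxy
    obtain ⟨d', hd'⟩ := (PadicInt.isUnit_iff.2 hd).exists_right_inv
    obtain ⟨z, hz⟩ := exists_sq_eq hp2 (a := -(e * d')) (hunit v hv) (by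
      rw [← toZMod_eq_zero_iff]
      have h1 := congrArg (PadicInt.toZMod (p := p)) hd'
      simp only [map_mul, map_one, map_sub, map_neg, map_pow] at h1 ⊢
      rw [hu] at hxy
      linear_combination -(PadicInt.toZMod d') * hxy - (PadicInt.toZMod v) ^ 2 * h1)
    refine ⟨0, z, ?_⟩
    rw [hz]
    linear_combination e * hd'
  · obtain ⟨z, hz⟩ := exists_sq_eq hp2 (a := e + d * v ^ 2) (hunit u hu) (by
      rw [← toZMod_eq_zero_iff]
      simp only [map_mul, map_add, map_sub, map_pow]
      linear_combination hxy)
    exact ⟨z, v, by rw [hz]; ring⟩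

/-- When `e` is a value of the norm form of `ℚ_p[√d]`, the algebra acts on this two-dimensional
space, and the action is surjective onto matrices. -/
theorem not_isRamifiedAt_of_eq {α β d e : ℚ} (hd : d ≠ 0) (he : e ≠ 0)
    (E : ℍ[ℚ, d, e] ≃ₐ[ℚ] ℍ[ℚ, α, β]) {u v : ℚ_[p]} (huv : u ^ 2 - d * v ^ 2 = e) :
    ¬ IsRamifiedAt ℍ[ℚ, α, β] p := by
  have hd' : (d : ℚ_[p]) ≠ 0 := by exact_mod_cast hd
  have he' : (e : ℚ_[p]) ≠ 0 := by exact_mod_cast he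
  -- In the basis `1, √d`, `I` is multiplication by `√d`, and `J` is conjugation followed by
  -- multiplication by `u + v √d`.
  let I : Matrix (Fin 2) (Fin 2) ℚ_[p] := !![0, (d : ℚ_[p]); 1, 0]
  let J : Matrix (Fin 2) (Fin 2) ℚ_[p] := !![u, -(d * v); v, -u]
  have hsm : ∀ c : ℚ, c • (1 : Matrix (Fin 2) (Fin 2) ℚ_[p]) = !![(c : ℚ_[p]), 0; 0, (c : ℚ_[p])] := by
    intro c
    rw [← Algebra.algebraMap_eq_smul_one, IsScalarTower.algebraMap_apply ℚ ℚ_[p], eq_ratCast,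
      Algebra.algebraMap_eq_smul_one]
    ext i j; fin_cases i <;> fin_cases j <;> simp
  let q : QuaternionAlgebra.Basis (Matrix (Fin 2) (Fin 2) ℚ_[p]) d 0 e :=
    { i := I
      j := J
      k := I * J
      i_mul_i := by
        rw [hsm, zero_smul, add_zero]
        ext i j; fin_cases i <;> fin_cases j <;> simp [I]
      j_mul_j := by
        rw [hsm]
        ext i j; fin_cases i <;> fin_cases j <;> simp [J, ← huv] <;> ring
      i_mul_j := rfl
      j_mul_i := by
        rw [zero_smul, zero_sub]
        ext i j; fin_cases i <;> fin_cases j <;> simp [I, J, mul_comm] }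
  let f : ℍ[ℚ, α, β] →ₐ[ℚ] Matrix (Fin 2) (Fin 2) ℚ_[p] := q.liftHom.comp E.symm.toAlgHom
  let F : (ℚ_[p] ⊗[ℚ] ℍ[ℚ, α, β]) →ₐ[ℚ_[p]] Matrix (Fin 2) (Fin 2) ℚ_[p] :=
    Algebra.TensorProduct.lift (Algebra.ofId _ _) f
      (fun a b => Algebra.commutes a (f b))
  have hF : ∀ x : ℍ[ℚ, d, e], q.liftHom x ∈ F.range := by
    intro x
    refine ⟨1 ⊗ₜ E x, ?_⟩
    refine (Algebra.TensorProduct.lift_tmul _ _ _ _ _).trans ?_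
    rw [map_one, one_mul]
    change q.liftHom (E.symm (E x)) = _
    rw [AlgEquiv.symm_apply_apply]
  have hI : I ∈ F.range := by
    have h1 : q.liftHom ⟨0, 1, 0, 0⟩ = I := by
      change q.lift _ = I
      simp [QuaternionAlgebra.Basis.lift, q]
    rw [← h1]; exact hF _
  have hJ : J ∈ F.range := by
    have h1 : q.liftHom ⟨0, 0, 1, 0⟩ = J := by
      change q.lift _ = J
      simp [QuaternionAlgebra.Basis.lift, q]
    rw [← h1]; exact hF _
  -- This is conjugation, recovered as `(u + v √d)⁻¹ J = e⁻¹ (u - v I) J`; it separates the two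
  -- diagonal matrix units.
  have hG : !![(1 : ℚ_[p]), 0; 0, -1] ∈ F.range := by
    have h1 : !![(1 : ℚ_[p]), 0; 0, -1] = (e : ℚ_[p])⁻¹ • (u • J - v • (I * J)) := by
      rw [eq_inv_smul_iff₀ he']
      ext i j; fin_cases i <;> fin_cases j <;> simp [I, J, ← huv] <;> ring
    rw [h1]
    exact F.range.smul_mem (sub_mem (F.range.smul_mem hJ _)
      (F.range.smul_mem (mul_mem hI hJ) _)) _
  have hE1 : !![(1 : ℚ_[p]), 0; 0, 0] ∈ F.range := by
    have h1 : !![(1 : ℚ_[p]), 0; 0, 0] = (2 : ℚ_[p])⁻¹ • (1 + !![(1 : ℚ_[p]), 0; 0, -1]) := by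
      ext i j; fin_cases i <;> fin_cases j <;> simp; norm_num
    rw [h1]; exact F.range.smul_mem (add_mem (one_mem _) hG) _
  have hsurj : Function.Surjective F := by
    intro M
    change M ∈ F.range
    have hE2 : !![(0 : ℚ_[p]), 0; 0, 1] ∈ F.range := by
      have h1 : !![(0 : ℚ_[p]), 0; 0, 1] = 1 - !![(1 : ℚ_[p]), 0; 0, 0] := by
        ext i j; fin_cases i <;> fin_cases j <;> simp
      rw [h1]; exact sub_mem (one_mem _) hE1
    have h1 : M = M 0 0 • !![(1 : ℚ_[p]), 0; 0, 0] + M 1 0 • (I * !![(1 : ℚ_[p]), 0; 0, 0]) +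
        (M 0 1 * (d : ℚ_[p])⁻¹) • (I * !![(0 : ℚ_[p]), 0; 0, 1]) +
        M 1 1 • !![(0 : ℚ_[p]), 0; 0, 1] := by
      ext i j; fin_cases i <;> fin_cases j <;> simp [I, hd]
    rw [h1]
    exact add_mem (add_mem (add_mem (F.range.smul_mem hE1 _) (F.range.smul_mem (mul_mem hI hE1) _))
      (F.range.smul_mem (mul_mem hI hE2) _)) (F.range.smul_mem hE2 _)
  have hinj : Function.Injective F := by
    refine (LinearMap.injective_iff_surjective_of_finrank_eq_finrank (f := F.toLinearMap) ?_).2 hsurj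
    rw [Module.finrank_baseChange, QuaternionAlgebra.finrank_eq_four, Module.finrank_matrix]
    simp
  exact not_not.2 ⟨AlgEquiv.ofBijective F ⟨hinj, hsurj⟩⟩

end Padic

/-! ### Conjugate embeddings, and the local structure of `B` at ramified inert primes. -/

/-- The conjugate embedding `x ↦ b⁻¹ φ(x) b`. -/
noncomputable def conjEmbedding {K : Type*} [Field K] [Algebra ℚ K] {α β : ℚ}
    (φ : K →ₐ[ℚ] ℍ[ℚ, α, β]) (b : (ℍ[ℚ, α, β])ˣ) : K →ₐ[ℚ] ℍ[ℚ, α, β] where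
  toFun x := ((b⁻¹ : (ℍ[ℚ, α, β])ˣ) : ℍ[ℚ, α, β]) * φ x * b
  map_one' := by rw [map_one, mul_one, Units.inv_mul]
  map_mul' x y := by
    rw [map_mul]
    simp only [mul_assoc, Units.mul_inv_cancel_left]
  map_zero' := by rw [map_zero, mul_zero, zero_mul]
  map_add' x y := by rw [map_add, mul_add, add_mul]
  commutes' q := by
    rw [AlgHom.commutes, mul_assoc, Algebra.commutes, ← mul_assoc, Units.inv_mul, one_mul]

theorem conjEmbedding_apply {K : Type*} [Field K] [Algebra ℚ K] {α β : ℚ}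
    (φ : K →ₐ[ℚ] ℍ[ℚ, α, β]) (b : (ℍ[ℚ, α, β])ˣ) (x : K) :
    conjEmbedding φ b x = ((b⁻¹ : (ℍ[ℚ, α, β])ˣ) : ℍ[ℚ, α, β]) * φ x * b := rfl

section Ramified

variable {α β : ℚ} {K : Type*} [Field K] [NumberField K] {Δ : ℤ} {s : K} {p : ℕ}

theorem padic_norm_sub_eq_max [hp : Fact p.Prime] {a b : ℚ_[p]} (h : ‖a‖ ≠ ‖b‖) :
    ‖a - b‖ = max ‖a‖ ‖b‖ := by
  rw [sub_eq_add_neg, Padic.add_eq_max_of_ne (by rwa [norm_neg]), norm_neg]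

/-- The norm `-Δ` of `√Δ` is even, although its coordinates `0, 1` are not both even. -/
theorem IsEvenImaginaryQuadratic.ne_two_of_inert (h : IsEvenImaginaryQuadratic Δ s)
    (hp : p.Prime) (hin : (Ideal.span {(p : 𝓞 K)}).IsPrime) : p ≠ 2 := by
  rintro rfl
  obtain ⟨d, hd⟩ := h.even
  have := (h.int_anisotropic hp hin (u := 0) (v := 1) ⟨-d, by rw [hd]; push_cast; ring⟩).2
  norm_num at this

theorem padic_norm_int_eq_one [hp : Fact p.Prime] {z : ℤ} (hz : ¬ (p : ℤ) ∣ z) :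
    ‖(z : ℚ_[p])‖ = 1 := by
  refine le_antisymm (Padic.norm_int_le_one z) (not_lt.1 fun hlt => hz ?_)
  exact (Padic.norm_intCast_lt_one_iff).1 hlt

theorem IsEvenImaginaryQuadratic.norm_disc (h : IsEvenImaginaryQuadratic Δ s)
    [hp : Fact p.Prime] (hin : (Ideal.span {(p : 𝓞 K)}).IsPrime) : ‖(Δ : ℚ_[p])‖ = 1 := by
  refine padic_norm_int_eq_one fun ⟨c, hc⟩ => ?_
  have := (h.int_anisotropic hp.out hin (u := 0) (v := 1) ⟨-c, by rw [hc]; ring⟩).2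
  exact (Nat.prime_iff_prime_int.1 hp.out).not_isUnit (isUnit_of_dvd_one this)

theorem padic_norm_two [hp : Fact p.Prime] (hp2 : p ≠ 2) : ‖(2 : ℚ_[p])‖ = 1 := by
  have := padic_norm_int_eq_one (p := p) (z := 2) fun h =>
    hp2 ((Nat.prime_dvd_prime_iff_eq hp.out Nat.prime_two).1 (by exact_mod_cast h))
  exact_mod_cast this

/-- The norm form of a quadratic field is anisotropic at inert primes. -/
theorem IsEvenImaginaryQuadratic.padic_norm_eq (h : IsEvenImaginaryQuadratic Δ s)
    [hp : Fact p.Prime] (hin : (Ideal.span {(p : 𝓞 K)}).IsPrime) (u v : ℚ_[p]) :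
    ‖u ^ 2 - Δ * v ^ 2‖ = max ‖u‖ ‖v‖ ^ 2 := by
  have hΔ := h.norm_disc hin
  have e1 : ‖u ^ 2‖ = ‖u‖ ^ 2 := norm_pow _ _
  have e2 : ‖Δ * v ^ 2‖ = ‖v‖ ^ 2 := by rw [norm_mul, hΔ, one_mul, norm_pow]
  by_cases huv : ‖u‖ = ‖v‖
  · rw [huv, max_self]
    by_cases hv : v = 0
    · subst hv
      rw [norm_zero, norm_eq_zero] at huv
      subst huv; simp
    have hv' : ‖v‖ ≠ 0 := norm_ne_zero_iff.2 hv
    have ht : ‖u / v‖ = 1 := by rw [norm_div, huv, div_self hv']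
    -- Otherwise an integer `n` congruent to `u / v` would satisfy `p ∣ n² - Δ`, against anisotropy
    -- modulo `p`.
    have key : ‖(u / v) ^ 2 - Δ‖ = 1 := by
      refine le_antisymm ?_ (not_lt.1 fun hlt => ?_)
      · rw [sub_eq_add_neg]
        refine (Padic.nonarchimedean _ _).trans ?_
        rw [norm_neg, norm_pow, ht, hΔ, one_pow, max_self]
      · let t : ℤ_[p] := ⟨u / v, ht.le⟩
        obtain ⟨n, -, hn⟩ := PadicInt.exists_mem_range (p := p) t
        have hlt' : ‖t ^ 2 - (Δ : ℤ_[p])‖ < 1 := by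
          rw [PadicInt.norm_def]; push_cast; exact hlt
        rw [← toZMod_eq_zero_iff] at hlt'
        rw [← PadicInt.ker_toZMod, RingHom.mem_ker] at hn
        have h3 : PadicInt.toZMod (p := p) ((n ^ 2 - Δ * 1 ^ 2 : ℤ) : ℤ_[p]) = 0 := by
          push_cast
          simp only [map_sub, map_pow, map_natCast, map_intCast, map_mul, map_one] at hn hlt' ⊢
          linear_combination hlt' - (PadicInt.toZMod t + n) * hn
        rw [toZMod_eq_zero_iff, PadicInt.norm_int_lt_one_iff_dvd] at h3
        have := (h.int_anisotropic hp.out hin h3).2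
        exact (Nat.prime_iff_prime_int.1 hp.out).not_isUnit (isUnit_of_dvd_one this)
    have e3 : u ^ 2 - Δ * v ^ 2 = ((u / v) ^ 2 - Δ) * v ^ 2 := by field_simp
    rw [e3, norm_mul, key, one_mul, norm_pow]
  · rw [padic_norm_sub_eq_max, e1, e2]
    · rcases le_total ‖u‖ ‖v‖ with hle | hle
      · rw [max_eq_right hle, max_eq_right (pow_le_pow_left₀ (norm_nonneg _) hle 2)]
      · rw [max_eq_left hle, max_eq_left (pow_le_pow_left₀ (norm_nonneg _) hle 2)]
    · rw [e1, e2]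
      exact fun h' => huv ((pow_left_inj₀ (norm_nonneg _) (norm_nonneg _) two_ne_zero).1 h')

theorem exists_max_norm_eq_zpow [hp : Fact p.Prime] (u v : ℚ_[p]) :
    (u = 0 ∧ v = 0) ∨ ∃ n : ℤ, max ‖u‖ ‖v‖ = (p : ℝ) ^ n := by
  have hx : ∀ x : ℚ_[p], x ≠ 0 → ∃ n : ℤ, ‖x‖ = (p : ℝ) ^ n :=
    fun x hx => ⟨_, Padic.norm_eq_zpow_neg_valuation hx⟩
  by_cases hu : u = 0
  · by_cases hv : v = 0
    · exact Or.inl ⟨hu, hv⟩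
    · right
      rw [hu, norm_zero, max_eq_right (norm_nonneg _)]
      exact hx v hv
  · right
    rcases le_total ‖u‖ ‖v‖ with hle | hle
    · rw [max_eq_right hle]
      refine hx v fun hv => hu ?_
      rw [hv, norm_zero] at hle
      exact norm_le_zero_iff.1 hle
    · rw [max_eq_left hle]; exact hx u hu

theorem one_lt_prime_real [hp : Fact p.Prime] : (1 : ℝ) < p := by
  exact_mod_cast hp.out.one_lt

/-- At a ramified inert prime, `B` has the form `K + K j` with `j ^ 2` a uniformizer. -/
theorem IsEvenImaginaryQuadratic.exists_ramified_coords (h : IsEvenImaginaryQuadratic Δ s)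
    (hα : α ≠ 0) (hβ : β ≠ 0) (φ : K →ₐ[ℚ] ℍ[ℚ, α, β]) [hp : Fact p.Prime]
    (hin : (Ideal.span {(p : 𝓞 K)}).IsPrime) (hram : IsRamifiedAt ℍ[ℚ, α, β] p) :
    ∃ e : ℚ, ‖(e : ℚ_[p])‖ = (p : ℝ)⁻¹ ∧ ∃ E : ℍ[ℚ, (Δ : ℚ), e] ≃ₐ[ℚ] ℍ[ℚ, α, β],
      E ⟨0, 1, 0, 0⟩ = φ s ∧ ∀ x, nrd (E x) = nrd x := by
  obtain ⟨J, hJ, htr, hn⟩ := h.exists_anticommuting hα hβ φ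
  have hp0 : (p : ℚ) ≠ 0 := by exact_mod_cast hp.out.ne_zero
  have hp0' : (p : ℝ) ≠ 0 := by exact_mod_cast hp.out.ne_zero
  -- Replacing `J` by `p^k J` shifts the valuation of `e = -nrd J` by `2k`, so it can be normalized
  -- to `0` or `1`.
  have hscale : ∀ k : ℤ, ∃ E : ℍ[ℚ, (Δ : ℚ), -(((p : ℚ) ^ k) ^ 2 * nrd J)] ≃ₐ[ℚ] ℍ[ℚ, α, β],
      E ⟨0, 1, 0, 0⟩ = φ s ∧ ∀ x, nrd (E x) = nrd x := by
    intro k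
    rw [← nrd_smul]
    refine h.exists_algEquiv φ ?_ ?_ ?_
    · rw [smul_mul_assoc, hJ, mul_smul_comm, smul_neg]
    · rw [trd_smul, htr, mul_zero]
    · rw [nrd_smul]; exact mul_ne_zero (pow_ne_zero 2 (zpow_ne_zero k hp0)) hn
  have hn' : ((nrd J : ℚ) : ℚ_[p]) ≠ 0 := by exact_mod_cast hn
  have hnorm : ∀ k : ℤ, ‖((-(((p : ℚ) ^ k) ^ 2 * nrd J) : ℚ) : ℚ_[p])‖ =
      (p : ℝ) ^ (-(2 * k) - Padic.valuation ((nrd J : ℚ) : ℚ_[p])) := by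
    intro k
    push_cast
    rw [norm_neg, norm_mul, norm_pow, norm_zpow, Padic.norm_p, inv_zpow',
      Padic.norm_eq_zpow_neg_valuation hn', ← zpow_natCast, ← zpow_mul, ← zpow_add₀ hp0']
    congr 1; push_cast; ring
  rcases Int.even_or_odd' (Padic.valuation ((nrd J : ℚ) : ℚ_[p])) with ⟨c, hc | hc⟩
  -- For even valuation `e` becomes a unit, hence a norm from `ℚ_p[√Δ]`, and `B` would split at `p`.
  · exfalso
    obtain ⟨E, -, -⟩ := hscale (-c)
    have h1 := hnorm (-c)
    rw [hc, show -(2 * -c) - 2 * c = 0 by ring, zpow_zero] at h1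
    obtain ⟨u, v, huv⟩ := exists_sq_sub_mul_sq_eq (h.ne_two_of_inert hp.out hin)
      (d := ⟨(Δ : ℚ_[p]), (h.norm_disc hin).le⟩) (e := ⟨_, h1.le⟩)
      (h.norm_disc hin) h1
    refine not_isRamifiedAt_of_eq (p := p) h.neg_rat.ne ?_ E (u := u) (v := v) ?_ hram
    · exact neg_ne_zero.2 (mul_ne_zero (pow_ne_zero 2 (zpow_ne_zero _ hp0)) hn)
    · exact congrArg (fun z : ℤ_[p] => (z : ℚ_[p])) huv
  · obtain ⟨E, hE⟩ := hscale (-c)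
    refine ⟨_, ?_, E, hE⟩
    rw [hnorm, hc, ← zpow_neg_one]; congr 1; ring

/-- The norms of the `k`-part and of the `k j`-part have valuations of opposite parity, so they
cannot cancel. -/
theorem IsEvenImaginaryQuadratic.norm_nrd_eq (h : IsEvenImaginaryQuadratic Δ s)
    [hp : Fact p.Prime] (hin : (Ideal.span {(p : 𝓞 K)}).IsPrime) {e : ℚ}
    (he : ‖(e : ℚ_[p])‖ = (p : ℝ)⁻¹) (x : ℍ[ℚ, (Δ : ℚ), e]) :
    ‖((nrd x : ℚ) : ℚ_[p])‖ = max (max ‖(x.re : ℚ_[p])‖ ‖(x.imI : ℚ_[p])‖ ^ 2)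
      ((p : ℝ)⁻¹ * max ‖(x.imJ : ℚ_[p])‖ ‖(x.imK : ℚ_[p])‖ ^ 2) ∧
    (x ≠ 0 → max ‖(x.re : ℚ_[p])‖ ‖(x.imI : ℚ_[p])‖ ^ 2 ≠
      (p : ℝ)⁻¹ * max ‖(x.imJ : ℚ_[p])‖ ‖(x.imK : ℚ_[p])‖ ^ 2) := by
  have hp0' : (0 : ℝ) < p := by exact_mod_cast hp.out.pos
  have e1 := h.padic_norm_eq hin (x.re : ℚ_[p]) x.imI
  have e2 : ‖(e : ℚ_[p]) * ((x.imJ : ℚ_[p]) ^ 2 - Δ * (x.imK : ℚ_[p]) ^ 2)‖ =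
      (p : ℝ)⁻¹ * max ‖(x.imJ : ℚ_[p])‖ ‖(x.imK : ℚ_[p])‖ ^ 2 := by
    rw [norm_mul, he, h.padic_norm_eq hin]
  have e3 : ((nrd x : ℚ) : ℚ_[p]) = ((x.re : ℚ_[p]) ^ 2 - Δ * (x.imI : ℚ_[p]) ^ 2) -
      (e : ℚ_[p]) * ((x.imJ : ℚ_[p]) ^ 2 - Δ * (x.imK : ℚ_[p]) ^ 2) := by
    rw [nrd_eq]; push_cast; ring
  have hne : x ≠ 0 → max ‖(x.re : ℚ_[p])‖ ‖(x.imI : ℚ_[p])‖ ^ 2 ≠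
      (p : ℝ)⁻¹ * max ‖(x.imJ : ℚ_[p])‖ ‖(x.imK : ℚ_[p])‖ ^ 2 := by
    intro hx heq
    rcases exists_max_norm_eq_zpow (x.re : ℚ_[p]) (x.imI : ℚ_[p]) with ⟨hr, hi⟩ | ⟨a, ha⟩
    · rcases exists_max_norm_eq_zpow (x.imJ : ℚ_[p]) (x.imK : ℚ_[p]) with ⟨hj, hk⟩ | ⟨c, hc⟩
      · refine hx ?_
        norm_cast at hr hi hj hk
        ext <;> assumption
      · rw [hr, hi, hc] at heq
        have : 0 < (p : ℝ)⁻¹ * ((p : ℝ) ^ c) ^ 2 := by positivity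
        rw [← heq] at this
        simp at this
    · rcases exists_max_norm_eq_zpow (x.imJ : ℚ_[p]) (x.imK : ℚ_[p]) with ⟨hj, hk⟩ | ⟨c, hc⟩
      · rw [hj, hk, ha] at heq
        have : 0 < ((p : ℝ) ^ a) ^ 2 := by positivity
        rw [heq] at this
        simp at this
      · rw [ha, hc, ← zpow_natCast, ← zpow_natCast, ← zpow_mul, ← zpow_mul, ← zpow_neg_one,
          ← zpow_add₀ hp0'.ne'] at heq
        have := zpow_right_injective₀ hp0' one_lt_prime_real.ne' heq
        push_cast at this
        omega
  refine ⟨?_, hne⟩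
  by_cases hx : x = 0
  · subst hx; simp
  · rw [e3, padic_norm_sub_eq_max, e1, e2]
    rw [e1, e2]; exact hne hx

/-- Local description of a maximal order at a ramified prime. -/
theorem IsMaximalOrder.mem_of_norm_nrd_le_one {O : Subring ℍ[ℚ, α, β]} (hO : IsMaximalOrder O)
    (h : IsEvenImaginaryQuadratic Δ s)
    (hα : α ≠ 0) (hβ : β ≠ 0) (φ : K →ₐ[ℚ] ℍ[ℚ, α, β]) [hp : Fact p.Prime]
    (hin : (Ideal.span {(p : 𝓞 K)}).IsPrime) (hram : IsRamifiedAt ℍ[ℚ, α, β] p)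
    {x : ℍ[ℚ, α, β]} (hx : x ∈ awayFrom O p) (hn : ‖((nrd x : ℚ) : ℚ_[p])‖ ≤ 1) : x ∈ O := by
  obtain ⟨e, he, E, -, hE⟩ := h.exists_ramified_coords hα hβ φ hin hram
  have hp1 : (1 : ℝ) < p := one_lt_prime_real
  have hp0' : (0 : ℝ) < p := by exact_mod_cast hp.out.pos
  have hΔ := h.norm_disc hin (p := p)
  have he1 : ‖(e : ℚ_[p])‖ ≤ 1 := he ▸ inv_le_one_of_one_le₀ hp1.le
  obtain ⟨R, hR⟩ : ∃ R : Subring ℚ, ∀ q : ℚ, q ∈ R ↔ ‖(q : ℚ_[p])‖ ≤ 1 :=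
    ⟨(PadicInt.subring p).comap (Rat.castHom ℚ_[p]), fun q => Iff.rfl⟩
  have hΔR : (Δ : ℚ) ∈ R := by rw [hR]; push_cast; exact hΔ.le
  have heR : e ∈ R := (hR e).2 he1
  let V' : Subring ℍ[ℚ, (Δ : ℚ), e] :=
    { carrier := {x | x.re ∈ R ∧ x.imI ∈ R ∧ x.imJ ∈ R ∧ x.imK ∈ R}
      mul_mem' := by
        rintro x y ⟨h1, h2, h3, h4⟩ ⟨g1, g2, g3, g4⟩
        simp only [Set.mem_ofPred_eq, QuaternionAlgebra.re_mul, QuaternionAlgebra.imI_mul,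
          QuaternionAlgebra.imJ_mul, QuaternionAlgebra.imK_mul]
        have hz := R.zero_mem
        refine ⟨?_, ?_, ?_, ?_⟩ <;>
          repeat' first | assumption | apply R.add_mem | apply R.sub_mem | apply R.mul_mem
      one_mem' := by simp
      add_mem' := by
        rintro x y ⟨h1, h2, h3, h4⟩ ⟨g1, g2, g3, g4⟩
        exact ⟨add_mem h1 g1, add_mem h2 g2, add_mem h3 g3, add_mem h4 g4⟩
      zero_mem' := by simp
      neg_mem' := by
        rintro x ⟨h1, h2, h3, h4⟩
        exact ⟨neg_mem h1, neg_mem h2, neg_mem h3, neg_mem h4⟩ }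
  -- By the maximum formula, integrality of the norm is integrality of all four coordinates; this
  -- shows that the elements of integral norm form a ring.
  have hV' : ∀ x : ℍ[ℚ, (Δ : ℚ), e], x ∈ V' ↔ ‖((nrd x : ℚ) : ℚ_[p])‖ ≤ 1 := by
    intro x
    have hJ : (p : ℝ)⁻¹ * max ‖(x.imJ : ℚ_[p])‖ ‖(x.imK : ℚ_[p])‖ ^ 2 ≤ 1 ↔
        max ‖(x.imJ : ℚ_[p])‖ ‖(x.imK : ℚ_[p])‖ ≤ 1 := by
      rcases exists_max_norm_eq_zpow (x.imJ : ℚ_[p]) (x.imK : ℚ_[p]) with ⟨hj, hk⟩ | ⟨c, hc⟩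
      · rw [hj, hk]; simp
      · rw [hc, ← zpow_natCast, ← zpow_mul, ← zpow_neg_one, ← zpow_add₀ hp0'.ne', ← zpow_zero (p : ℝ),
          zpow_le_zpow_iff_right₀ hp1, zpow_le_zpow_iff_right₀ hp1]
        push_cast; omega
    rw [(h.norm_nrd_eq hin he x).1, max_le_iff, hJ, max_le_iff,
      pow_le_one_iff_of_nonneg (le_max_of_le_left (norm_nonneg _)) two_ne_zero, max_le_iff, and_assoc]
    rw [← hR, ← hR, ← hR, ← hR]
    exact Iff.rfl
  let V : Subring ℍ[ℚ, α, β] := V'.comap (E.symm : ℍ[ℚ, α, β] →+* ℍ[ℚ, (Δ : ℚ), e])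
  have hV : ∀ x, x ∈ V ↔ ‖((nrd x : ℚ) : ℚ_[p])‖ ≤ 1 := by
    intro x
    have h1 := hV' (E.symm x)
    rw [← hE, AlgEquiv.apply_symm_apply] at h1
    exact h1
  refine hO.mem_of_mem_awayFrom hα hβ p (V := V) ?_ ?_ hx ((hV x).2 hn)
  · intro y hy
    have h1 := (hV y).1 hy
    have h2 := (hV _).1 (add_mem V.one_mem hy)
    rw [← hR] at h1 h2 ⊢
    have h3 : trd y = nrd (1 + y) - 1 - nrd y := by rw [nrd_one_add]; ring
    rw [h3]
    exact sub_mem (sub_mem h2 R.one_mem) h1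
  · intro y hy
    rw [hV]
    obtain ⟨n, hn⟩ := hO.1.exists_nrd_eq hy
    rw [hn]; push_cast; exact Padic.norm_int_le_one n

/-- Conjugation by `b` preserves the reduction of `φ` modulo the maximal ideal at a ramified prime
exactly if `Nrd(b)` has even valuation. -/
theorem IsEvenImaginaryQuadratic.norm_nrd_sub_conj (h : IsEvenImaginaryQuadratic Δ s)
    (hα : α ≠ 0) (hβ : β ≠ 0) (φ : K →ₐ[ℚ] ℍ[ℚ, α, β]) [hp : Fact p.Prime]
    (hin : (Ideal.span {(p : 𝓞 K)}).IsPrime) (hram : IsRamifiedAt ℍ[ℚ, α, β] p)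
    (b : (ℍ[ℚ, α, β])ˣ) :
    (‖((nrd (φ s - conjEmbedding φ b s) : ℚ) : ℚ_[p])‖ < 1 ∧
      ∃ k : ℤ, ‖((nrd (b : ℍ[ℚ, α, β]) : ℚ) : ℚ_[p])‖ = (p : ℝ) ^ (2 * k)) ∨
    (‖((nrd (φ s - conjEmbedding φ b s) : ℚ) : ℚ_[p])‖ = 1 ∧
      ∃ k : ℤ, ‖((nrd (b : ℍ[ℚ, α, β]) : ℚ) : ℚ_[p])‖ = (p : ℝ) ^ (2 * k - 1)) := by
  obtain ⟨e, he, E, hEs, hE⟩ := h.exists_ramified_coords hα hβ φ hin hram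
  have hp0' : (0 : ℝ) < p := by exact_mod_cast hp.out.pos
  have h2 := padic_norm_two (h.ne_two_of_inert hp.out hin)
  have hΔ := h.norm_disc hin (p := p)
  obtain ⟨x, hx⟩ := E.surjective (b : ℍ[ℚ, α, β])
  have hx0 : x ≠ 0 := by
    rintro rfl
    rw [map_zero] at hx
    exact b.ne_zero hx.symm
  -- The commutator with `φ(s)` sees only the `k j`-part of `b`, and it equals `b (φ(s) - b⁻¹ φ(s)
  -- b)`.
  have e1 : nrd ((b : ℍ[ℚ, α, β]) * φ s - φ s * (b : ℍ[ℚ, α, β])) = 4 * Δ * e * (x.imJ ^ 2 - Δ * x.imK ^ 2) := by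
    rw [← hx, ← hEs, ← map_mul, ← map_mul, ← map_sub, hE, nrd_eq]
    simp; ring
  have e2 : ((nrd (φ s - conjEmbedding φ b s) : ℚ) : ℚ_[p]) * ((nrd (b : ℍ[ℚ, α, β]) : ℚ) : ℚ_[p]) =
      4 * Δ * e * ((x.imJ : ℚ_[p]) ^ 2 - Δ * (x.imK : ℚ_[p]) ^ 2) := by
    have : nrd (φ s - conjEmbedding φ b s) * nrd (b : ℍ[ℚ, α, β]) =
        4 * Δ * e * (x.imJ ^ 2 - Δ * x.imK ^ 2) := by
      rw [← e1, mul_comm, ← nrd_mul, mul_sub, conjEmbedding_apply, ← mul_assoc, ← mul_assoc,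
        Units.mul_inv, one_mul]
    exact_mod_cast congrArg (Rat.cast (K := ℚ_[p])) this
  have e3 : ‖((nrd (φ s - conjEmbedding φ b s) : ℚ) : ℚ_[p])‖ * ‖((nrd (b : ℍ[ℚ, α, β]) : ℚ) : ℚ_[p])‖ =
      (p : ℝ)⁻¹ * max ‖(x.imJ : ℚ_[p])‖ ‖(x.imK : ℚ_[p])‖ ^ 2 := by
    rw [← norm_mul, e2, show (4 : ℚ_[p]) = 2 * 2 by norm_num, norm_mul, norm_mul, norm_mul,
      norm_mul, h2, hΔ, he, h.padic_norm_eq hin]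
    ring
  obtain ⟨f1, f2⟩ := h.norm_nrd_eq hin he x
  rw [← hE, hx] at f1
  have f2 := f2 hx0
  have hb : 0 < ‖((nrd (b : ℍ[ℚ, α, β]) : ℚ) : ℚ_[p])‖ :=
    norm_pos_iff.2 (by exact_mod_cast nrd_unit_ne_zero b)
  -- If the `k j`-part dominates, `Nrd b` has odd valuation and the quotient of norms is a unit;
  -- otherwise `Nrd b` has even valuation and the quotient is not a unit.
  rcases lt_or_gt_of_ne f2 with hlt | hlt
  · right
    rw [max_eq_right hlt.le] at f1
    refine ⟨?_, ?_⟩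
    · rw [← f1] at e3
      exact mul_right_cancel₀ hb.ne' (e3.trans (one_mul _).symm)
    · rcases exists_max_norm_eq_zpow (x.imJ : ℚ_[p]) (x.imK : ℚ_[p]) with ⟨hj, hk⟩ | ⟨c, hc⟩
      · rw [f1, hj, hk] at hb; simp at hb
      · refine ⟨c, ?_⟩
        rw [f1, hc, ← zpow_natCast, ← zpow_mul, ← zpow_neg_one, ← zpow_add₀ hp0'.ne']
        congr 1; push_cast; ring
  · left
    rw [max_eq_left hlt.le] at f1
    refine ⟨?_, ?_⟩
    · rw [← e3, ← f1] at hlt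
      exact (mul_lt_iff_lt_one_left hb).1 hlt
    · rcases exists_max_norm_eq_zpow (x.re : ℚ_[p]) (x.imI : ℚ_[p]) with ⟨hj, hk⟩ | ⟨c, hc⟩
      · rw [f1, hj, hk] at hb; simp at hb
      · refine ⟨c, ?_⟩
        rw [f1, hc, ← zpow_natCast, ← zpow_mul, mul_comm]; rfl

end Ramified

/-! ### Integrality in `O_{B,p}`, and the reduction modulo `θ`. -/

section LocalOrder

variable {α β : ℚ} {O : Subring ℍ[ℚ, α, β]} {p : ℕ} [hp : Fact p.Prime]

theorem padic_tmul_smul (w : ℚ_[p]) (q : ℚ) (z : ℍ[ℚ, α, β]) :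
    w • ((1 : ℚ_[p]) ⊗ₜ[ℚ] (q • z)) = (w * q) ⊗ₜ[ℚ] z := by
  have : q • (1 : ℚ_[p]) = q := by rw [Algebra.smul_def, mul_one, eq_ratCast]
  rw [TensorProduct.tmul_smul, TensorProduct.smul_tmul', this, TensorProduct.smul_tmul',
    smul_eq_mul]

theorem tmul_mem_localOrder {b : ℍ[ℚ, α, β]} (hb : b ∈ O) :
    (1 : ℚ_[p]) ⊗ₜ[ℚ] b ∈ localOrder O p :=
  Submodule.subset_span ⟨b, hb, rfl⟩

theorem mul_mem_localOrder {x y : ℚ_[p] ⊗[ℚ] ℍ[ℚ, α, β]} (hx : x ∈ localOrder O p)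
    (hy : y ∈ localOrder O p) : x * y ∈ localOrder O p := by
  induction hx using Submodule.span_induction with
  | mem x hx =>
    obtain ⟨a, ha, rfl⟩ := hx
    induction hy using Submodule.span_induction with
    | mem y hy =>
      obtain ⟨b, hb, rfl⟩ := hy
      simp only
      rw [Algebra.TensorProduct.tmul_mul_tmul, one_mul]
      exact tmul_mem_localOrder (mul_mem ha hb)
    | zero => rw [mul_zero]; exact zero_mem _
    | add y z _ _ hy hz => rw [mul_add]; exact add_mem hy hz
    | smul c y _ hy => rw [mul_smul_comm]; exact Submodule.smul_mem _ _ hy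
  | zero => rw [zero_mul]; exact zero_mem _
  | add x z _ _ hx hz => rw [add_mul]; exact add_mem hx hz
  | smul c x _ hx => rw [smul_mul_assoc]; exact Submodule.smul_mem _ _ hx

/-- The reduced trace as a linear functional. -/
def trdLinear (α β : ℚ) : ℍ[ℚ, α, β] →ₗ[ℚ] ℚ where
  toFun := trd
  map_add' := trd_add
  map_smul' := trd_smul

theorem norm_trd_le_one_of_mem_localOrder (hO : IsOrder O) {z : ℍ[ℚ, α, β]}
    (hz : (1 : ℚ_[p]) ⊗ₜ[ℚ] z ∈ localOrder O p) : ‖((trd z : ℚ) : ℚ_[p])‖ ≤ 1 := by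
  let T : (ℚ_[p] ⊗[ℚ] ℍ[ℚ, α, β]) →ₗ[ℚ_[p]] ℚ_[p] :=
    (TensorProduct.AlgebraTensorModule.rid ℚ ℚ_[p] ℚ_[p]).toLinearMap ∘ₗ
      (trdLinear α β).baseChange ℚ_[p]
  have hT : ∀ b : ℍ[ℚ, α, β], T (1 ⊗ₜ b) = ((trd b : ℚ) : ℚ_[p]) := by
    intro b
    simp only [T, LinearMap.comp_apply, LinearMap.baseChange_tmul]
    change trd b • (1 : ℚ_[p]) = _
    rw [Algebra.smul_def, mul_one, eq_ratCast]
  have key : ∀ x ∈ localOrder O p, ‖T x‖ ≤ 1 := by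
    intro x hx
    induction hx using Submodule.span_induction with
    | mem x hx =>
      obtain ⟨b, hb, rfl⟩ := hx
      obtain ⟨n, hn⟩ := hO.exists_trd_eq hb
      simp only
      rw [hT, hn]; push_cast; exact Padic.norm_int_le_one n
    | zero => rw [map_zero, norm_zero]; exact zero_le_one
    | add x y _ _ hx hy => rw [map_add]; exact (Padic.nonarchimedean _ _).trans (max_le hx hy)
    | smul c x _ hx =>
      have : T (c • x) = (c : ℚ_[p]) * T x := by
        rw [← smul_eq_mul, ← map_smul]; rfl
      rw [this, norm_mul]
      exact mul_le_one₀ (PadicInt.norm_le_one c) (norm_nonneg _) hx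
  rw [← hT]; exact key _ hz

/-- The scalar `star z * z = nrd z` lies in the local order and has trace `2 nrd z`, where `2` is a
unit. -/
theorem norm_nrd_le_one_of_mem_localOrder (hO : IsOrder O) (hp2 : p ≠ 2) {z : ℍ[ℚ, α, β]}
    (hz : (1 : ℚ_[p]) ⊗ₜ[ℚ] z ∈ localOrder O p) : ‖((nrd z : ℚ) : ℚ_[p])‖ ≤ 1 := by
  have h1 := norm_trd_le_one_of_mem_localOrder hO hz
  have h2 : (1 : ℚ_[p]) ⊗ₜ[ℚ] star z ∈ localOrder O p := by
    let c : ℤ_[p] := ⟨_, h1⟩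
    have e : (1 : ℚ_[p]) ⊗ₜ[ℚ] star z =
        c • ((1 : ℚ_[p]) ⊗ₜ[ℚ] (1 : ℍ[ℚ, α, β])) - (1 : ℚ_[p]) ⊗ₜ[ℚ] z := by
      have e1 : c • ((1 : ℚ_[p]) ⊗ₜ[ℚ] (1 : ℍ[ℚ, α, β])) =
          (1 : ℚ_[p]) • ((1 : ℚ_[p]) ⊗ₜ[ℚ] (trd z • (1 : ℍ[ℚ, α, β]))) := by
        rw [padic_tmul_smul, one_mul]
        change ((trd z : ℚ) : ℚ_[p]) • ((1 : ℚ_[p]) ⊗ₜ[ℚ] (1 : ℍ[ℚ, α, β])) = _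
        rw [TensorProduct.smul_tmul', smul_eq_mul, mul_one]
      rw [e1, one_smul, star_eq_trd_sub, TensorProduct.tmul_sub]
    rw [e]
    exact sub_mem (Submodule.smul_mem _ _ (tmul_mem_localOrder O.one_mem)) hz
  have h3 := mul_mem_localOrder h2 hz
  rw [Algebra.TensorProduct.tmul_mul_tmul, one_mul, star_mul_self_eq] at h3
  have h4 := norm_trd_le_one_of_mem_localOrder hO h3
  rw [trd_smul, trd_one] at h4
  push_cast at h4
  rwa [norm_mul, padic_norm_two hp2, mul_one] at h4

end LocalOrder

/-- `θ` is a uniformizer and `O_{B,p}` is given by integrality of the norm, so divisibility by `θ`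
is read off the norm. Since `o_k = ℤ + ℤ √Δ`, the difference at `√Δ` determines all the others. -/
theorem sameReduction_iff {α β : ℚ} {O : Subring ℍ[ℚ, α, β]} {p : ℕ} [hp : Fact p.Prime]
    {K : Type*} [Field K] [NumberField K] {Δ : ℤ} {s : K} (h : IsEvenImaginaryQuadratic Δ s)
    (hO : IsOrder O) (hp2 : p ≠ 2)
    (hmem : ∀ x ∈ awayFrom O p, ‖((nrd x : ℚ) : ℚ_[p])‖ ≤ 1 → x ∈ O)
    {θ : ℍ[ℚ, α, β]} (hθ : ‖((nrd θ : ℚ) : ℚ_[p])‖ = (p : ℝ)⁻¹)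
    (i j : K →ₐ[ℚ] ℍ[ℚ, α, β]) :
    SameReduction O θ i j p ↔ ‖((nrd (i s - j s) : ℚ) : ℚ_[p])‖ < 1 := by
  have hp1 : (1 : ℝ) < p := one_lt_prime_real
  have hp0 : (0 : ℝ) < p := zero_lt_one.trans hp1
  have hθ0 : nrd θ ≠ 0 := by
    intro h0; rw [h0, Rat.cast_zero, norm_zero] at hθ
    exact (inv_pos.2 hp0).ne hθ
  obtain ⟨t, rfl⟩ := isUnit_of_nrd_ne_zero hθ0
  constructor
  · intro hred
    obtain ⟨x, hx, hxe⟩ := hred ⟨s, h.isIntegral_gen⟩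
    change (1 : ℚ_[p]) ⊗ₜ[ℚ] (i s - j s) = _ at hxe
    set y := i s - j s
    have e1 : x = (1 : ℚ_[p]) ⊗ₜ[ℚ] (((t⁻¹ : (ℍ[ℚ, α, β])ˣ) : ℍ[ℚ, α, β]) * y) := by
      have e2 : (1 : ℚ_[p]) ⊗ₜ[ℚ] (((t⁻¹ : (ℍ[ℚ, α, β])ˣ) : ℍ[ℚ, α, β]) * y) =
          ((1 : ℚ_[p]) ⊗ₜ[ℚ] ((t⁻¹ : (ℍ[ℚ, α, β])ˣ) : ℍ[ℚ, α, β])) * ((1 : ℚ_[p]) ⊗ₜ[ℚ] y) := by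
        rw [Algebra.TensorProduct.tmul_mul_tmul, one_mul]
      rw [e2, hxe, ← mul_assoc, Algebra.TensorProduct.tmul_mul_tmul, one_mul, Units.inv_mul,
        ← Algebra.TensorProduct.one_def, one_mul]
    rw [e1] at hx
    have h1 := norm_nrd_le_one_of_mem_localOrder hO hp2 hx
    have h2 : nrd y = nrd (t : ℍ[ℚ, α, β]) *
        nrd (((t⁻¹ : (ℍ[ℚ, α, β])ˣ) : ℍ[ℚ, α, β]) * y) := by
      rw [← nrd_mul, ← mul_assoc, Units.mul_inv, one_mul]
    rw [h2]; push_cast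
    rw [norm_mul, hθ]
    exact lt_of_le_of_lt (mul_le_of_le_one_right (inv_pos.2 hp0).le h1) (inv_lt_one_of_one_lt₀ hp1)
  · intro hlt a
    obtain ⟨u, v, huv⟩ := h.exists_int_coords a.isIntegral_coe
    replace huv : (a : K) = _ := huv
    have e1 : i (a : K) - j (a : K) = (v : ℚ) • (i s - j s) := by
      rw [huv, map_add, map_add, map_smul, map_smul, map_smul, map_smul, map_one, map_one, smul_sub]
      abel
    set z := ((t⁻¹ : (ℍ[ℚ, α, β])ˣ) : ℍ[ℚ, α, β]) * (i (a : K) - j (a : K)) with hz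
    have hle : ‖((nrd (i s - j s) : ℚ) : ℚ_[p])‖ ≤ (p : ℝ)⁻¹ := by
      have := (Padic.norm_le_pow_iff_norm_lt_pow_add_one ((nrd (i s - j s) : ℚ) : ℚ_[p]) (-1)).2
        (by simpa using hlt)
      rwa [zpow_neg_one] at this
    have hzn : ‖((nrd z : ℚ) : ℚ_[p])‖ ≤ 1 := by
      rw [hz, nrd_mul, nrd_coe_inv, e1, nrd_smul]
      push_cast
      rw [norm_mul, norm_inv, hθ, inv_inv, norm_mul, norm_pow]
      have h1 := pow_le_one₀ (n := 2) (norm_nonneg _) (Padic.norm_int_le_one (p := p) v)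
      calc (p : ℝ) * (‖(v : ℚ_[p])‖ ^ 2 * ‖((nrd (i s - j s) : ℚ) : ℚ_[p])‖)
          ≤ p * (1 * (p : ℝ)⁻¹) := by gcongr
        _ = 1 := by rw [one_mul, mul_inv_cancel₀ hp0.ne']
    obtain ⟨M, hM, hMz⟩ := hO.exists_natCast_smul_mem z
    -- The part `n` of the denominator prime to `p` is a unit of `ℤ_p`, so `n z ∈ O` suffices for
    -- `z` to be in the local order.
    obtain ⟨k, n, hpn, hMn⟩ := Nat.exists_eq_pow_mul_and_not_dvd hM.ne' p hp.out.ne_one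
    have hnz : (n : ℚ) • z ∈ O := by
      refine hmem _ ⟨k, ?_⟩ ?_
      · rw [smul_smul]
        rw [hMn] at hMz
        exact_mod_cast hMz
      · rw [nrd_smul]
        push_cast
        rw [norm_mul, norm_pow]
        refine mul_le_one₀ (pow_le_one₀ (norm_nonneg _) ?_) (norm_nonneg _) hzn
        exact_mod_cast Padic.norm_int_le_one (p := p) n
    have hn1 : ‖((n : ℤ_[p]))‖ = 1 := by
      rw [PadicInt.norm_def]
      have := padic_norm_int_eq_one (p := p) (z := n) (by exact_mod_cast hpn)
      exact_mod_cast this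
    obtain ⟨w, hw⟩ := (PadicInt.isUnit_iff.2 hn1).exists_left_inv
    refine ⟨(1 : ℚ_[p]) ⊗ₜ[ℚ] z, ?_, ?_⟩
    · have e2 : (1 : ℚ_[p]) ⊗ₜ[ℚ] z = w • ((1 : ℚ_[p]) ⊗ₜ[ℚ] ((n : ℚ) • z)) := by
        have e3 : w • ((1 : ℚ_[p]) ⊗ₜ[ℚ] ((n : ℚ) • z)) =
            (w : ℚ_[p]) • ((1 : ℚ_[p]) ⊗ₜ[ℚ] ((n : ℚ) • z)) := rfl
        have hw' : (w : ℚ_[p]) * (n : ℚ_[p]) = 1 := by exact_mod_cast congrArg (fun q : ℤ_[p] => (q : ℚ_[p])) hw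
        rw [e3, padic_tmul_smul, Rat.cast_natCast, hw']
      rw [e2]
      exact Submodule.smul_mem _ _ (tmul_mem_localOrder hnz)
    · rw [Algebra.TensorProduct.tmul_mul_tmul, one_mul, hz, ← mul_assoc, Units.mul_inv, one_mul]

/-! ### The ideal attached to `b`, its index and the conductor. -/

section LeftIdeal

variable {α β : ℚ} {O : Subring ℍ[ℚ, α, β]} {K : Type*} [Field K] [NumberField K] {Δ : ℤ} {s : K}

theorem IsOrder.isIntegral_of_map_mem (hO : IsOrder O) (h : IsEvenImaginaryQuadratic Δ s)
    (φ : K →ₐ[ℚ] ℍ[ℚ, α, β]) {x : K} (hx : φ x ∈ O) : IsIntegral ℤ x := by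
  obtain ⟨t, ht⟩ := hO.exists_trd_eq hx
  obtain ⟨n, hn⟩ := hO.exists_nrd_eq hx
  exact h.isIntegral_of_trace_norm (by rw [← h.trd_map φ, ht]) (by rw [← h.nrd_map φ, hn])

/-- The fractional ideal of all `x` with `φ(x) b ∈ O`. -/
noncomputable def leftIdeal (hO : IsOrder O) (h : IsEvenImaginaryQuadratic Δ s)
    (φ : K →ₐ[ℚ] ℍ[ℚ, α, β]) (hφ : ∀ a : 𝓞 K, φ a ∈ O) (b : (ℍ[ℚ, α, β])ˣ) :
    FractionalIdeal (𝓞 K)⁰ K :=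
  ⟨{ carrier := {x | φ x * (b : ℍ[ℚ, α, β]) ∈ O}
     add_mem' := fun {x y} hx hy => by
      change φ (x + y) * (b : ℍ[ℚ, α, β]) ∈ O
      rw [map_add, add_mul]; exact add_mem hx hy
     zero_mem' := by
      change φ 0 * (b : ℍ[ℚ, α, β]) ∈ O
      rw [map_zero, zero_mul]; exact O.zero_mem
     smul_mem' := fun a x hx => by
      change φ (a • x) * (b : ℍ[ℚ, α, β]) ∈ O
      rw [Algebra.smul_def, map_mul, mul_assoc]
      exact mul_mem (hφ a) hx }, by
    obtain ⟨M, hM, hMb⟩ := hO.exists_natCast_smul_mem ((b⁻¹ : (ℍ[ℚ, α, β])ˣ) : ℍ[ℚ, α, β])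
    refine ⟨(M : 𝓞 K), mem_nonZeroDivisors_of_ne_zero (by exact_mod_cast hM.ne'), fun x hx => ?_⟩
    have hx : φ x * (b : ℍ[ℚ, α, β]) ∈ O := hx
    have h1 : φ ((M : ℚ) • x) ∈ O := by
      have h2 := mul_mem hx hMb
      rwa [mul_smul_comm, mul_assoc, Units.mul_inv, mul_one, ← map_smul] at h2
    refine ⟨⟨(M : ℚ) • x, hO.isIntegral_of_map_mem h φ h1⟩, ?_⟩
    change (M : ℚ) • x = (M : 𝓞 K) • x
    rw [Algebra.smul_def, Algebra.smul_def]; simp⟩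

variable (hO : IsOrder O) (h : IsEvenImaginaryQuadratic Δ s)
    (φ : K →ₐ[ℚ] ℍ[ℚ, α, β]) (hφ : ∀ a : 𝓞 K, φ a ∈ O) (b : (ℍ[ℚ, α, β])ˣ)

theorem mem_leftIdeal {x : K} :
    x ∈ leftIdeal hO h φ hφ b ↔ φ x * (b : ℍ[ℚ, α, β]) ∈ O := Iff.rfl

theorem leftIdeal_ne_zero : leftIdeal hO h φ hφ b ≠ 0 := by
  obtain ⟨M, hM, hMb⟩ := hO.exists_natCast_smul_mem (b : ℍ[ℚ, α, β])
  intro h0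
  have h1 : (M : ℚ) • (1 : K) ∈ leftIdeal hO h φ hφ b := by
    rw [mem_leftIdeal, map_smul, map_one, smul_mul_assoc, one_mul]; exact hMb
  rw [h0, FractionalIdeal.mem_zero_iff] at h1
  rcases smul_eq_zero.1 h1 with h2 | h2
  · exact hM.ne' (by exact_mod_cast h2)
  · exact one_ne_zero h2

theorem star_mul_map_mul_eq (x : K) : star (b : ℍ[ℚ, α, β]) * φ x * (b : ℍ[ℚ, α, β]) =
    nrd (b : ℍ[ℚ, α, β]) • conjEmbedding φ b x := by
  rw [conjEmbedding_apply, coe_inv_eq, smul_mul_assoc, smul_mul_assoc, smul_smul,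
    mul_inv_cancel₀ (nrd_unit_ne_zero b), one_smul]

theorem abs_smul_mem {q : ℚ} {x : ℍ[ℚ, α, β]} (hx : q • x ∈ O) : |q| • x ∈ O := by
  rcases abs_choice q with hq | hq <;> rw [hq]
  · exact hx
  · rw [neg_smul]; exact neg_mem hx

/-- The products `star (φ(a) b) * (φ(c) b) = nrd b • i(ā c)`, with `a, c` in the ideal, lie in `O`,
and the `ā c` generate `N(I) o_k`. -/
theorem smul_conjEmbedding_mem {x : K} (hx : IsIntegral ℤ x) :
    (FractionalIdeal.absNorm (leftIdeal hO h φ hφ b) * |nrd (b : ℍ[ℚ, α, β])|) •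
      conjEmbedding φ b x ∈ O := by
  have key : ∀ z ∈ AddSubgroup.closure {z | ∃ a ∈ leftIdeal hO h φ hφ b,
      ∃ c ∈ leftIdeal hO h φ hφ b, z = conj a * c},
      star (b : ℍ[ℚ, α, β]) * φ z * (b : ℍ[ℚ, α, β]) ∈ O := by
    intro z hz
    induction hz using AddSubgroup.closure_induction with
    | mem z hz =>
      obtain ⟨a, ha, c, hc, rfl⟩ := hz
      have h1 := mul_mem (hO.star_mem ha) hc
      rwa [star_mul, h.star_map, mul_assoc, ← mul_assoc (φ (conj a)), ← map_mul, ← mul_assoc] at h1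
    | zero => rw [map_zero, mul_zero, zero_mul]; exact O.zero_mem
    | add y z _ _ hy hz => rw [map_add, mul_add, add_mul]; exact add_mem hy hz
    | neg y _ hy => rw [map_neg, mul_neg, neg_mul]; exact neg_mem hy
  have h1 := key _ (h.absNorm_smul_mem_closure (leftIdeal_ne_zero hO h φ hφ b) hx)
  rw [star_mul_map_mul_eq, map_smul, smul_smul] at h1
  have h2 := abs_smul_mem h1
  rwa [abs_mul, abs_of_pos (absNorm_pos (leftIdeal_ne_zero hO h φ hφ b)), mul_comm] at h2

theorem exists_nat_eq_absNorm_mul : ∃ N : ℕ, 0 < N ∧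
    FractionalIdeal.absNorm (leftIdeal hO h φ hφ b) * |nrd (b : ℍ[ℚ, α, β])| = N := by
  have hpos : 0 < FractionalIdeal.absNorm (leftIdeal hO h φ hφ b) * |nrd (b : ℍ[ℚ, α, β])| :=
    mul_pos (absNorm_pos (leftIdeal_ne_zero hO h φ hφ b)) (abs_pos.2 (nrd_unit_ne_zero b))
  have h1 := smul_conjEmbedding_mem hO h φ hφ b isIntegral_one
  rw [map_one] at h1
  obtain ⟨n, hn⟩ := hO.exists_int_of_smul_one_mem h1
  have hn0 : 0 < n := by rw [hn] at hpos; exact_mod_cast hpos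
  lift n to ℕ using hn0.le
  exact ⟨n, by exact_mod_cast hn0, by exact_mod_cast hn⟩

/-- The conductor of the embedding `i`. -/
noncomputable def embeddingConductor (s : K) (O : Subring ℍ[ℚ, α, β])
    (i : K →ₐ[ℚ] ℍ[ℚ, α, β]) : ℕ :=
  sInf {c : ℕ | 0 < c ∧ (c : ℚ) • i s ∈ O}

/-- The integers `n` with `n i(s) ∈ O` form a subgroup of `ℤ`, so division with remainder shows that
its least positive element divides the others. -/
theorem embeddingConductor_spec {i : K →ₐ[ℚ] ℍ[ℚ, α, β]} {N : ℕ} (hN : 0 < N)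
    (hNi : (N : ℚ) • i s ∈ O) :
    0 < embeddingConductor s O i ∧ (embeddingConductor s O i : ℚ) • i s ∈ O ∧
      embeddingConductor s O i ∣ N := by
  have h1 : embeddingConductor s O i ∈ {c : ℕ | 0 < c ∧ (c : ℚ) • i s ∈ O} :=
    Nat.sInf_mem ⟨N, hN, hNi⟩
  refine ⟨h1.1, h1.2, ?_⟩
  by_contra hdvd
  have h2 : 0 < N % embeddingConductor s O i :=
    Nat.pos_of_ne_zero fun h0 => hdvd (Nat.dvd_of_mod_eq_zero h0)
  have h3 : N % embeddingConductor s O i ∈ {c : ℕ | 0 < c ∧ (c : ℚ) • i s ∈ O} := by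
    refine ⟨h2, ?_⟩
    have e : ((N % embeddingConductor s O i : ℕ) : ℚ) =
        N - (N / embeddingConductor s O i : ℕ) * (embeddingConductor s O i : ℚ) := by
      have := Nat.mod_add_div N (embeddingConductor s O i)
      rw [eq_sub_iff_add_eq]
      rw [mul_comm] at this
      exact_mod_cast this
    rw [e, sub_smul, mul_smul]
    exact sub_mem hNi (nsmul_mem_of_mem _ h1.2)
  exact absurd (Nat.sInf_le h3) (not_le.2 (Nat.mod_lt _ h1.1))

theorem not_isIntegral_inv (h : IsEvenImaginaryQuadratic Δ s) {p : ℕ} (hp : p.Prime) :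
    ¬ IsIntegral ℤ ((p : ℚ)⁻¹ • (1 : K)) := by
  intro h1
  have hp0 : (p : ℚ) ≠ 0 := by exact_mod_cast hp.ne_zero
  obtain ⟨n, hn⟩ := IsIntegrallyClosed.isIntegral_iff.1 (Algebra.isIntegral_norm ℚ h1)
  rw [h.norm_smul, map_one, mul_one] at hn
  simp only [eq_intCast] at hn
  have hn' : n * p ^ 2 = 1 := by
    have : (n : ℚ) * p ^ 2 = 1 := by rw [hn]; field_simp
    exact_mod_cast this
  exact (Nat.prime_iff_prime_int.1 hp).not_isUnit (isUnit_of_dvd_one ⟨n * p, by rw [← hn']; ring⟩)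

/-- The fractional ideal of `b` is not contained in its multiple by a prime number. -/
theorem exists_mem_leftIdeal_not_smul_mem {p : ℕ} (hp : p.Prime) :
    ∃ x ∈ leftIdeal hO h φ hφ b, ¬ (p : ℚ)⁻¹ • (φ x * (b : ℍ[ℚ, α, β])) ∈ O := by
  by_contra! hcon
  refine not_isIntegral_inv h hp
    (isIntegral_of_forall_mul_mem (leftIdeal_ne_zero hO h φ hφ b) fun y hy => ?_)
  rw [mem_leftIdeal, smul_mul_assoc, one_mul, map_smul, smul_mul_assoc]
  exact hcon y hy

end LeftIdeal

/-! ### A rank-one lemma for `2 × 2` matrices. -/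

section MatrixLemma

/-- `X.adjugate * Y = 0` says that the columns of `Y` are proportional to a nonzero column of `X`.
For `Y = S * X` this makes that column an eigenvector of `S`. -/
theorem exists_smul_of_adjugate_mul_eq_zero {F : Type*} [Field F]
    {X S : Matrix (Fin 2) (Fin 2) F} (hX : X ≠ 0)
    (hSX : X.adjugate * (S * X) = 0) :
    ∃ a : F, ∀ Y : Matrix (Fin 2) (Fin 2) F, X.adjugate * Y = 0 → S * Y = a • Y := by
  have key : ∀ Y : Matrix (Fin 2) (Fin 2) F, X.adjugate * Y = 0 →
      ∀ j k, X 0 k * Y 1 j = X 1 k * Y 0 j := by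
    intro Y hY j k
    have h0 := congrFun (congrFun hY 0) j
    have h1 := congrFun (congrFun hY 1) j
    rw [Matrix.adjugate_fin_two] at h0 h1
    simp [Matrix.mul_apply, Fin.sum_univ_two] at h0 h1
    fin_cases k
    · simp only [Fin.zero_eta]; linear_combination h1
    · simp only [Fin.mk_one]; linear_combination -h0
  obtain ⟨k, hk⟩ : ∃ k, X 0 k ≠ 0 ∨ X 1 k ≠ 0 := by
    by_contra! hcon
    refine hX (Matrix.ext fun i j => ?_)
    fin_cases i
    · exact (hcon j).1
    · exact (hcon j).2
  have hS := key _ hSX k k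
  rw [Matrix.mul_apply, Matrix.mul_apply, Fin.sum_univ_two, Fin.sum_univ_two] at hS
  rcases hk with hk | hk
  · refine ⟨S 0 0 + S 0 1 * X 1 k / X 0 k, fun Y hY => Matrix.ext fun i j => ?_⟩
    have h1 := key Y hY j k
    have h2 : Y 1 j = X 1 k * Y 0 j / X 0 k := by field_simp; linear_combination h1
    rw [Matrix.mul_apply, Fin.sum_univ_two, Matrix.smul_apply, smul_eq_mul]
    fin_cases i
    · simp only [Fin.zero_eta]; rw [h2]; field_simp
    · simp only [Fin.mk_one]; rw [h2]; field_simp; linear_combination (Y 0 j) * hS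
  · refine ⟨S 1 0 * X 0 k / X 1 k + S 1 1, fun Y hY => Matrix.ext fun i j => ?_⟩
    have h1 := key Y hY j k
    have h2 : Y 0 j = X 0 k * Y 1 j / X 1 k := by field_simp; linear_combination -h1
    rw [Matrix.mul_apply, Fin.sum_univ_two, Matrix.smul_apply, smul_eq_mul]
    fin_cases i
    · simp only [Fin.zero_eta]; rw [h2]; field_simp; linear_combination -(Y 1 j) * hS
    · simp only [Fin.mk_one]; rw [h2]; field_simp

end MatrixLemma

/-! ### The index at unramified primes. -/

section LocalIndices

variable {α β : ℚ} {O : Subring ℍ[ℚ, α, β]} {K : Type*} [Field K] [NumberField K] {Δ : ℤ} {s : K}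
  {p : ℕ}

/-- At an unramified prime the index of `b` is the conductor of the conjugate embedding. -/
theorem not_dvd_of_not_isRamifiedAt (hα : α ≠ 0) (hβ : β ≠ 0) (hO : IsMaximalOrder O)
    (h : IsEvenImaginaryQuadratic Δ s)
    (φ : K →ₐ[ℚ] ℍ[ℚ, α, β]) (hφ : ∀ a : 𝓞 K, φ a ∈ O) (b : (ℍ[ℚ, α, β])ˣ)
    [hp : Fact p.Prime] (hsplit : ¬ IsRamifiedAt ℍ[ℚ, α, β] p) {c t : ℕ}
    (hc : (c : ℚ) • conjEmbedding φ b s ∈ O)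
    (hN : FractionalIdeal.absNorm (leftIdeal hO.1 h φ hφ b) * |nrd (b : ℍ[ℚ, α, β])| =
      ((c * t : ℕ) : ℚ)) : ¬ p ∣ t := by
  rintro ⟨t, rfl⟩
  have hp0 : (p : ℚ) ≠ 0 := by exact_mod_cast hp.out.ne_zero
  have hI := leftIdeal_ne_zero hO.1 h φ hφ b
  have hI0 := (absNorm_pos hI).ne'
  obtain ⟨r, hr0, hrstar⟩ := hO.exists_residue hα hβ p hsplit
  have hrp : ∀ (x y : O), (x : ℍ[ℚ, α, β]) = (p : ℚ) • (y : ℍ[ℚ, α, β]) → r x = 0 := by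
    intro x y hxy
    have : x = p • y := by
      apply Subtype.ext
      rw [hxy, Nat.cast_smul_eq_nsmul]; rfl
    rw [this, map_nsmul]
    ext i j
    simp
  -- `c i(o_k)` is contained in `O`, as `o_k = ℤ + ℤ √Δ`; the extra factor `p` in the index makes `N
  -- i(x)` divisible by `p`.
  have hconj : ∀ x : K, IsIntegral ℤ x →
      ∃ w ∈ O, ((c * (p * t) : ℕ) : ℚ) • conjEmbedding φ b x = (p : ℚ) • w := by
    intro x hx
    obtain ⟨u, v, rfl⟩ := h.exists_int_coords hx
    refine ⟨(u : ℚ) • ((c * t : ℕ) : ℚ) • (1 : ℍ[ℚ, α, β]) +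
      (v : ℚ) • ((t : ℕ) : ℚ) • ((c : ℚ) • conjEmbedding φ b s),
      add_mem (zsmul_mem_of_mem _ (nsmul_mem_of_mem _ O.one_mem))
        (zsmul_mem_of_mem _ (nsmul_mem_of_mem _ hc)), ?_⟩
    rw [map_add, map_smul, map_smul, map_one, smul_add, smul_add]
    simp only [smul_smul]
    push_cast
    congr 2 <;> ring
  have hmul : ∀ x (hx : x ∈ leftIdeal hO.1 h φ hφ b) y (hy : y ∈ leftIdeal hO.1 h φ hφ b),
      (r ⟨_, hx⟩).adjugate * r ⟨_, hy⟩ = 0 := by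
    intro x hx y hy
    rw [← hrstar ⟨_, hx⟩ ⟨_, hO.1.star_mem hx⟩ rfl, ← map_mul]
    obtain ⟨w, hw, hwe⟩ := hconj _ (h.isIntegral_conj_mul hI hx hy)
    have e1 : star (φ x * (b : ℍ[ℚ, α, β])) * (φ y * (b : ℍ[ℚ, α, β])) =
        nrd (b : ℍ[ℚ, α, β]) • conjEmbedding φ b (conj x * y) := by
      rw [← star_mul_map_mul_eq, star_mul, h.star_map φ, map_mul]
      simp only [mul_assoc]
    have e2 : ∃ ε : ℤ, nrd (b : ℍ[ℚ, α, β]) = ε * |nrd (b : ℍ[ℚ, α, β])| := by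
      rcases abs_choice (nrd (b : ℍ[ℚ, α, β])) with hq | hq
      · exact ⟨1, by rw [hq]; simp⟩
      · exact ⟨-1, by rw [hq]; simp⟩
    obtain ⟨ε, hε⟩ := e2
    refine hrp _ ⟨(ε : ℚ) • w, zsmul_mem_of_mem ε hw⟩ ?_
    change star (φ x * (b : ℍ[ℚ, α, β])) * (φ y * (b : ℍ[ℚ, α, β])) = (p : ℚ) • ((ε : ℚ) • w)
    rw [e1, smul_comm, ← hwe, ← hN, map_smul, smul_smul, smul_smul]
    congr 1
    field_simp
    linarith [hε]
  obtain ⟨x, hx, hxp⟩ := exists_mem_leftIdeal_not_smul_mem hO.1 h φ hφ b hp.out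
  have hsx : ∀ y ∈ leftIdeal hO.1 h φ hφ b, s * y ∈ leftIdeal hO.1 h φ hφ b := by
    intro y hy
    have := Submodule.smul_mem (leftIdeal hO.1 h φ hφ b : Submodule (𝓞 K) K)
      (⟨s, h.isIntegral_gen⟩ : 𝓞 K) hy
    exact this
  have hS : φ s ∈ O := hφ ⟨s, h.isIntegral_gen⟩
  have hrs : ∀ y (hy : y ∈ leftIdeal hO.1 h φ hφ b),
      r ⟨_, hsx y hy⟩ = r ⟨φ s, hS⟩ * r ⟨_, hy⟩ := by
    intro y hy
    rw [← map_mul]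
    congr 1
    apply Subtype.ext
    change φ (s * y) * (b : ℍ[ℚ, α, β]) = φ s * (φ y * (b : ℍ[ℚ, α, β]))
    rw [map_mul, mul_assoc]
  obtain ⟨a, ha⟩ := exists_smul_of_adjugate_mul_eq_zero (S := r ⟨φ s, hS⟩)
    (fun h0 => hxp (hr0 ⟨_, hx⟩ h0)) (by rw [← hrs]; exact hmul x hx _ (hsx x hx))
  obtain ⟨z, rfl⟩ := ZMod.intCast_surjective a
  -- `φ(s)` acts modulo `p` as the scalar `z` on the reduction of `φ(I) b`, so `(s - z) / p` maps
  -- the ideal into itself.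
  refine h.not_isIntegral hp.out z (isIntegral_of_forall_mul_mem hI fun y hy => ?_)
  have h1 := ha _ (hmul x hx y hy)
  rw [← hrs] at h1
  have h2 : r (⟨_, hsx y hy⟩ - z • ⟨_, hy⟩) = 0 := by
    rw [map_sub, h1, map_zsmul, sub_eq_zero]
    ext i j; simp
  have h3 := hr0 _ h2
  rw [mem_leftIdeal]
  convert h3 using 1
  change φ ((p : ℚ)⁻¹ • (s - (z : ℚ) • (1 : K)) * y) * (b : ℍ[ℚ, α, β]) =
    (p : ℚ)⁻¹ • (φ (s * y) * (b : ℍ[ℚ, α, β]) - z • (φ y * (b : ℍ[ℚ, α, β])))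
  rw [smul_mul_assoc, map_smul, smul_mul_assoc, sub_mul, smul_mul_assoc, one_mul, map_sub, map_smul,
    sub_mul, smul_mul_assoc, Int.cast_smul_eq_zsmul]

end LocalIndices

/-! ### The index at ramified primes. -/

section RamifiedIndices

variable {α β : ℚ} {O : Subring ℍ[ℚ, α, β]} {K : Type*} [Field K] [NumberField K] {Δ : ℤ} {s : K}
  {p : ℕ}

/-- With nonzero trace `x` would be a rational scalar, whose square cannot be negative. -/
theorem nrd_eq_of_sq_eq_neg {d : ℚ} (hd : 0 < d) {x : ℍ[ℚ, α, β]} (hx : x * x = (-d) • 1) :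
    nrd x = d := by
  have h1 := mul_self_eq x
  rw [hx] at h1
  have h2 := nrd_mul x x
  rw [hx, nrd_smul, nrd_one] at h2
  by_cases ht : trd x = 0
  · rw [ht, zero_smul, zero_sub, ← neg_smul] at h1
    have h3 := congrArg QuaternionAlgebra.re h1
    simp at h3
    exact h3.symm
  · have h3 : x = ((trd x)⁻¹ * (nrd x - d)) • (1 : ℍ[ℚ, α, β]) := by
      rw [mul_smul, sub_smul, eq_comm, inv_smul_eq_iff₀ ht, sub_eq_add_neg, ← neg_smul, h1]
      abel
    rw [h3, smul_mul_smul_comm, mul_one] at hx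
    have h4 := congrArg QuaternionAlgebra.re hx
    simp only [QuaternionAlgebra.re_smul, QuaternionAlgebra.re_one, smul_eq_mul, mul_one] at h4
    nlinarith [mul_self_nonneg ((trd x)⁻¹ * (nrd x - d))]

theorem padic_norm_of_squarefree [hp : Fact p.Prime] {D : ℕ} (hD : Squarefree D) (hpD : p ∣ D) :
    ‖((D : ℚ) : ℚ_[p])‖ = (p : ℝ)⁻¹ := by
  obtain ⟨e, rfl⟩ := hpD
  have he : ¬ (p : ℤ) ∣ (e : ℤ) := by
    intro h1
    obtain ⟨f, rfl⟩ := Int.natCast_dvd_natCast.1 h1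
    exact hp.out.not_isUnit (hD p ⟨f, by ring⟩)
  have h1 := padic_norm_int_eq_one he
  push_cast at h1 ⊢
  rw [norm_mul, h1, mul_one, Padic.norm_p]

/-- At a prime where the order is maximal and the algebra is division, conductors are prime
to `p`. -/
theorem not_dvd_embeddingConductor [hp : Fact p.Prime] (h : IsEvenImaginaryQuadratic Δ s)
    (hmem : ∀ x ∈ awayFrom O p, ‖((nrd x : ℚ) : ℚ_[p])‖ ≤ 1 → x ∈ O)
    {i : K →ₐ[ℚ] ℍ[ℚ, α, β]} {N : ℕ} (hN : 0 < N) (hNi : (N : ℚ) • i s ∈ O) :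
    ¬ p ∣ embeddingConductor s O i := by
  obtain ⟨h1, h2, -⟩ := embeddingConductor_spec hN hNi
  rintro ⟨c, hc⟩
  have hp0 : (p : ℚ) ≠ 0 := by exact_mod_cast hp.out.ne_zero
  have h3 : (c : ℚ) • i s ∈ O := by
    refine hmem _ ?_ ?_
    · convert inv_smul_mem_awayFrom hp.out.ne_zero h2 using 1
      rw [hc, smul_smul]
      push_cast
      rw [inv_mul_cancel_left₀ hp0]
    · rw [nrd_smul, h.nrd_map_gen i]
      have := Padic.norm_int_le_one (p := p) ((c : ℤ) ^ 2 * (-Δ))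
      push_cast at this ⊢
      exact this
  have hc0 : 0 < c := Nat.pos_of_ne_zero fun h0 => by rw [h0] at hc; omega
  have h4 : embeddingConductor s O i ≤ c := Nat.sInf_le ⟨hc0, h3⟩
  have := Nat.mul_le_mul_right c hp.out.two_le
  omega

variable (hO : IsOrder O) (h : IsEvenImaginaryQuadratic Δ s)
    (φ : K →ₐ[ℚ] ℍ[ℚ, α, β]) (hφ : ∀ a : 𝓞 K, φ a ∈ O) (b : (ℍ[ℚ, α, β])ˣ)

/-- If `p² ∣ N`, then `p⁻¹ φ(x) b` has `p`-integral norm for every `x` in the ideal, hence lies in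
`O`; then `1/p` would preserve the ideal. -/
theorem not_sq_dvd_index [hp : Fact p.Prime]
    (hmem : ∀ x ∈ awayFrom O p, ‖((nrd x : ℚ) : ℚ_[p])‖ ≤ 1 → x ∈ O) {N : ℕ}
    (hN : FractionalIdeal.absNorm (leftIdeal hO h φ hφ b) * |nrd (b : ℍ[ℚ, α, β])| = N) :
    ¬ p ^ 2 ∣ N := by
  rintro ⟨c, rfl⟩
  have hp0 : (p : ℚ) ≠ 0 := by exact_mod_cast hp.out.ne_zero
  obtain ⟨x, hx, hxp⟩ := exists_mem_leftIdeal_not_smul_mem hO h φ hφ b hp.out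
  refine hxp (hmem _ (inv_smul_mem_awayFrom hp.out.ne_zero hx) ?_)
  obtain ⟨n, hn⟩ := h.exists_norm_eq_mul_absNorm (leftIdeal_ne_zero hO h φ hφ b) hx
  have e : |nrd ((p : ℚ)⁻¹ • (φ x * (b : ℍ[ℚ, α, β])))| = ((|n| * c : ℤ) : ℚ) := by
    rw [nrd_smul, nrd_mul, h.nrd_map, hn, mul_assoc (n : ℚ), abs_mul, abs_mul, abs_mul,
      abs_of_pos (absNorm_pos (leftIdeal_ne_zero hO h φ hφ b)), hN, abs_of_pos (by positivity)]
    push_cast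
    field_simp
  have h1 := Padic.norm_int_le_one (p := p) (|n| * c)
  have h2 : ((|n| * c : ℤ) : ℚ_[p]) = ((((|n| * c : ℤ) : ℚ)) : ℚ_[p]) := (Rat.cast_intCast _).symm
  rw [h2, ← e] at h1
  rcases abs_choice (nrd ((p : ℚ)⁻¹ • (φ x * (b : ℍ[ℚ, α, β])))) with hq | hq
  · rwa [hq] at h1
  · rw [hq] at h1; push_cast at h1; rwa [norm_neg] at h1

/-- At an inert prime `N(I)` agrees up to a unit with the norm of an element, whose valuation is
even. -/
theorem exists_padic_norm_index [hp : Fact p.Prime] (hin : (Ideal.span {(p : 𝓞 K)}).IsPrime)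
    {N : ℕ}
    (hN : FractionalIdeal.absNorm (leftIdeal hO h φ hφ b) * |nrd (b : ℍ[ℚ, α, β])| = N) :
    ∃ k : ℤ, ‖(N : ℚ_[p])‖ = (p : ℝ) ^ (2 * k) * ‖((nrd (b : ℍ[ℚ, α, β]) : ℚ) : ℚ_[p])‖ := by
  have hI := leftIdeal_ne_zero hO h φ hφ b
  obtain ⟨x, -, n, hn, hpn⟩ := h.exists_norm_not_dvd hp.out hin hI
  obtain ⟨u, v, rfl⟩ := h.exists_coords x
  rw [h.norm_coords] at hn
  have hn' : ((u ^ 2 - Δ * v ^ 2 : ℚ) : ℚ_[p]) =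
      n * ((FractionalIdeal.absNorm (leftIdeal hO h φ hφ b) : ℚ) : ℚ_[p]) := by
    rw [hn]; push_cast; rfl
  have h1 : ‖((FractionalIdeal.absNorm (leftIdeal hO h φ hφ b) : ℚ) : ℚ_[p])‖ =
      max ‖(u : ℚ_[p])‖ ‖(v : ℚ_[p])‖ ^ 2 := by
    rw [← h.padic_norm_eq hin, ← one_mul ‖_‖, ← padic_norm_int_eq_one hpn, ← norm_mul,
      ← hn']
    push_cast; rfl
  have hN' : ‖(N : ℚ_[p])‖ = ‖((FractionalIdeal.absNorm (leftIdeal hO h φ hφ b) : ℚ) : ℚ_[p])‖ *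
      ‖((nrd (b : ℍ[ℚ, α, β]) : ℚ) : ℚ_[p])‖ := by
    have e : (N : ℚ_[p]) = ((N : ℚ) : ℚ_[p]) := by push_cast; rfl
    rw [e, ← hN, Rat.cast_mul, norm_mul]
    congr 1
    rcases abs_choice (nrd (b : ℍ[ℚ, α, β])) with hq | hq <;> rw [hq]
    rw [Rat.cast_neg, norm_neg]
  rcases exists_max_norm_eq_zpow (u : ℚ_[p]) (v : ℚ_[p]) with ⟨hu, hv⟩ | ⟨k, hk⟩
  · exfalso
    rw [hu, hv, norm_zero, max_self, zero_pow two_ne_zero, norm_eq_zero] at h1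
    exact (absNorm_pos hI).ne' (by exact_mod_cast h1)
  · refine ⟨k, ?_⟩
    rw [hN', h1, hk, mul_comm 2 k, zpow_mul]
    rfl

/-- As `v_p(N) ≤ 1`, divisibility by `p` is the parity of `v_p(N)`, which is that of `v_p(nrd b)`.
-/
theorem dvd_index_iff [hp : Fact p.Prime] (hin : (Ideal.span {(p : 𝓞 K)}).IsPrime)
    (hmem : ∀ x ∈ awayFrom O p, ‖((nrd x : ℚ) : ℚ_[p])‖ ≤ 1 → x ∈ O) {N : ℕ}
    (hN : FractionalIdeal.absNorm (leftIdeal hO h φ hφ b) * |nrd (b : ℍ[ℚ, α, β])| = N) :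
    p ∣ N ↔ ¬ ∃ k : ℤ, ‖((nrd (b : ℍ[ℚ, α, β]) : ℚ) : ℚ_[p])‖ = (p : ℝ) ^ (2 * k) := by
  have hpr := one_lt_prime_real (p := p)
  have hp0 : (p : ℝ) ≠ 0 := by positivity
  obtain ⟨k, hk⟩ := exists_padic_norm_index hO h φ hφ b hin hN
  constructor
  · rintro ⟨c, hc⟩ ⟨l, hl⟩
    have hpc : ¬ (p : ℤ) ∣ (c : ℤ) := by
      intro h1
      obtain ⟨f, rfl⟩ := Int.natCast_dvd_natCast.1 h1
      exact not_sq_dvd_index hO h φ hφ b hmem hN ⟨f, by rw [hc]; ring⟩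
    have h1 := padic_norm_int_eq_one hpc
    rw [hc, hl, ← zpow_add₀ hp0] at hk
    push_cast at hk h1
    rw [norm_mul, h1, mul_one, Padic.norm_p, ← zpow_neg_one] at hk
    have := zpow_right_injective₀ (by positivity) hpr.ne' hk
    omega
  · intro hcon
    by_contra hpN
    have h1 := padic_norm_int_eq_one (p := p) (z := N) (by exact_mod_cast hpN)
    push_cast at h1
    refine hcon ⟨-k, ?_⟩
    rw [mul_neg, zpow_neg]
    refine eq_inv_of_mul_eq_one_right ?_
    rw [← hk, h1]

end RamifiedIndices

/-! ### The index is the conductor times the Frobenius type. -/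

section IndexFormula

variable {α β : ℚ} {O : Subring ℍ[ℚ, α, β]} {K : Type*} [Field K] [NumberField K] {Δ : ℤ} {s : K}

theorem IsEvenImaginaryQuadratic.algHom_ext (h : IsEvenImaginaryQuadratic Δ s)
    {i j : K →ₐ[ℚ] ℍ[ℚ, α, β]} (hij : i s = j s) : i = j := by
  ext1 x
  obtain ⟨u, v, rfl⟩ := h.exists_coords x
  rw [map_add, map_add, map_smul, map_smul, map_smul, map_smul, map_one, map_one, hij]

theorem map_natCast_mul_eq_smul (i : K →ₐ[ℚ] ℍ[ℚ, α, β]) (m : ℕ) (x : K) :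
    i (m * x) = (m : ℚ) • i x := by
  rw [map_mul, map_natCast, Nat.cast_smul_eq_nsmul, nsmul_eq_mul]

theorem IsEvenImaginaryQuadratic.eq_of_isInduced (h : IsEvenImaginaryQuadratic Δ s)
    {m : ℕ} (hm : 0 < m) {ξ : ℍ[ℚ, α, β]} {i j : K →ₐ[ℚ] ℍ[ℚ, α, β]} (hi : IsInduced s m ξ i)
    (hj : IsInduced s m ξ j) : j = i := by
  refine h.algHom_ext (smul_right_injective _ (by positivity : (m : ℚ) ≠ 0) ?_)
  change (m : ℚ) • j s = (m : ℚ) • i s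
  rw [← map_natCast_mul_eq_smul, ← map_natCast_mul_eq_smul]
  exact Eq.trans hj hi.symm

/-- Only one embedding is induced by `ξ`, and its values on `ℤ[c √Δ]` lie in `O` as soon as its
value at `c √Δ` does. -/
theorem conductor_eq (h : IsEvenImaginaryQuadratic Δ s)
    {m : ℕ} (hm : 0 < m) {ξ : ℍ[ℚ, α, β]} {i : K →ₐ[ℚ] ℍ[ℚ, α, β]} (hi : IsInduced s m ξ i) :
    conductor s O m ξ = embeddingConductor s O i := by
  rw [conductor, embeddingConductor]
  congr 1
  ext c
  constructor
  · rintro ⟨hc, j, hj, hjO⟩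
    obtain rfl := h.eq_of_isInduced hm hi hj
    refine ⟨hc, ?_⟩
    rw [← map_natCast_mul_eq_smul]
    exact hjO _ (Algebra.subset_adjoin rfl)
  · rintro ⟨hc, hcO⟩
    refine ⟨hc, i, hi, fun x hx => ?_⟩
    induction hx using Algebra.adjoin_induction with
    | mem x hx =>
      rw [Set.mem_singleton_iff.1 hx, map_natCast_mul_eq_smul]
      exact hcO
    | algebraMap n =>
      rw [eq_intCast, map_intCast]
      exact intCast_mem O n
    | add x y _ _ hx hy => rw [map_add]; exact add_mem hx hy
    | mul x y _ _ hx hy => rw [map_mul]; exact mul_mem hx hy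

open Classical in
theorem localFrobeniusType_eq (h : IsEvenImaginaryQuadratic Δ s) {θ : ℍ[ℚ, α, β]}
    {φ : K →ₐ[ℚ] ℍ[ℚ, α, β]}
    {m : ℕ} (hm : 0 < m) {ξ : ℍ[ℚ, α, β]} {i : K →ₐ[ℚ] ℍ[ℚ, α, β]} (hi : IsInduced s m ξ i)
    (p : ℕ) [Fact p.Prime] :
    localFrobeniusType s O θ φ m ξ p = if SameReduction O θ φ i p then 1 else p := by
  rw [localFrobeniusType]
  congr 1
  refine propext ⟨?_, fun hs => ⟨i, hi, hs⟩⟩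
  rintro ⟨j, hj, hs⟩
  rwa [h.eq_of_isInduced hm hi hj] at hs

/-- The index of `b` is the product of the conductor and the Frobenius type. -/
theorem absNorm_mul_abs_nrd_eq (hα : α ≠ 0) (hβ : β ≠ 0) (hO : IsMaximalOrder O)
    (h : IsEvenImaginaryQuadratic Δ s) {D : ℕ} (hD : IsDiscriminant ℍ[ℚ, α, β] D)
    (hinert : ∀ p : ℕ, p.Prime → p ∣ D → (Ideal.span {(p : 𝓞 K)}).IsPrime)
    {θ : ℍ[ℚ, α, β]} (hθ : θ ^ 2 = -(D : ℍ[ℚ, α, β]))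
    (φ : K →ₐ[ℚ] ℍ[ℚ, α, β]) (hφ : ∀ a : 𝓞 K, φ a ∈ O) (b : (ℍ[ℚ, α, β])ˣ)
    {m : ℕ} (hm : 0 < m) {ξ : ℍ[ℚ, α, β]} (hi : IsInduced s m ξ (conjEmbedding φ b)) :
    FractionalIdeal.absNorm (leftIdeal hO.1 h φ hφ b) * |nrd (b : ℍ[ℚ, α, β])| =
      ((conductor s O m ξ * frobeniusType s O θ D φ m ξ : ℕ) : ℚ) := by
  obtain ⟨N, hN0, hN⟩ := exists_nat_eq_absNorm_mul hO.1 h φ hφ b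
  have hNs : (N : ℚ) • conjEmbedding φ b s ∈ O := by
    rw [← hN]; exact smul_conjEmbedding_mem hO.1 h φ hφ b h.isIntegral_gen
  obtain ⟨hc0, hc, t, rfl⟩ := embeddingConductor_spec hN0 hNs
  rw [hN, conductor_eq h hm hi]
  congr 2
  have ht0 : t ≠ 0 := by rintro rfl; simp at hN0
  have hD0 : D ≠ 0 := hD.1.ne_zero
  have hnθ : nrd θ = D := by
    refine nrd_eq_of_sq_eq_neg (by positivity) ?_
    rw [← pow_two, hθ, neg_smul, Nat.cast_smul_eq_nsmul, nsmul_eq_mul, mul_one]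
  have hsupp : t.factorization.support ⊆ D.primeFactors := by
    intro p hp
    rw [Nat.support_factorization] at hp
    have hpp := Nat.prime_of_mem_primeFactors hp
    have : Fact p.Prime := ⟨hpp⟩
    rw [Nat.mem_primeFactors]
    refine ⟨hpp, ?_, hD0⟩
    by_contra hpD
    exact not_dvd_of_not_isRamifiedAt hα hβ hO h φ hφ b (mt (hD.2 p).2 hpD) hc hN
      (Nat.dvd_of_mem_primeFactors hp)
  have hterm : ∀ p : D.primeFactors,
      (haveI : Fact (p : ℕ).Prime := ⟨Nat.prime_of_mem_primeFactors p.2⟩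
      localFrobeniusType s O θ φ m ξ p) = (p : ℕ) ^ t.factorization p := by
    rintro ⟨p, hp⟩
    have hpp := Nat.prime_of_mem_primeFactors hp
    have : Fact p.Prime := ⟨hpp⟩
    have hpD := Nat.dvd_of_mem_primeFactors hp
    have hin := hinert p hpp hpD
    have hram := (hD.2 p).1 hpD
    have hmem : ∀ x ∈ awayFrom O p, ‖((nrd x : ℚ) : ℚ_[p])‖ ≤ 1 → x ∈ O :=
      fun x hx hn => hO.mem_of_norm_nrd_le_one h hα hβ φ hin hram hx hn
    have hpc := not_dvd_embeddingConductor h hmem hN0 hNs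
    have hiff := dvd_index_iff hO.1 h φ hφ b hin hmem hN
    have hsq := not_sq_dvd_index hO.1 h φ hφ b hmem hN
    -- Since `p ∤ c`, `p ∣ t` means `p ∣ N`, that is, odd valuation of `nrd b`, that is, a change of
    -- reduction.
    have hsame : SameReduction O θ φ (conjEmbedding φ b) p ↔ ¬ p ∣ t := by
      rw [sameReduction_iff h hO.1 (h.ne_two_of_inert hpp hin) hmem
        (by rw [hnθ]; exact padic_norm_of_squarefree hD.1 hpD), ← not_iff_not, not_not]
      have e : p ∣ t ↔ p ∣ embeddingConductor s O (conjEmbedding φ b) * t := by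
        rw [hpp.dvd_mul]; tauto
      rw [e, hiff]
      rcases h.norm_nrd_sub_conj hα hβ φ hin hram b with ⟨h1, h2⟩ | ⟨h1, k, hk⟩
      · exact iff_of_false (not_not.2 h1) (not_not.2 h2)
      · refine iff_of_true (by rw [h1]; exact lt_irrefl _) ?_
        rintro ⟨l, hl⟩
        rw [hk] at hl
        have hpr := one_lt_prime_real (p := p)
        have := zpow_right_injective₀ (by positivity) hpr.ne' hl
        omega
    change localFrobeniusType s O θ φ m ξ p = p ^ t.factorization p
    rw [localFrobeniusType_eq h hm hi]
    by_cases hpt : p ∣ t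
    · rw [if_neg (fun hs => hsame.1 hs hpt)]
      have h1 : 1 ≤ t.factorization p := (hpp.dvd_iff_one_le_factorization ht0).1 hpt
      have h2 : ¬ 2 ≤ t.factorization p := fun h2 =>
        hsq (((hpp.pow_dvd_iff_le_factorization ht0).2 h2).mul_left _)
      have h3 : t.factorization p = 1 := by omega
      rw [h3, pow_one]
    · rw [if_pos (hsame.2 hpt), Nat.factorization_eq_zero_of_not_dvd hpt, pow_zero]
  rw [frobeniusType, Finset.prod_congr rfl fun p _ => hterm p,
    Finset.prod_attach D.primeFactors (fun p => p ^ t.factorization p)]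
  conv_lhs => rw [← Nat.prod_factorization_pow_eq_self ht0]
  exact Finsupp.prod_of_support_subset _ hsupp _ fun p _ => pow_zero p

end IndexFormula

/-! ### Counting multiples of the class representatives. -/

section ClassRepresentatives

variable {K : Type*} [Field K] [NumberField K]

theorem classGroup_mk_eq_iff {I J : (FractionalIdeal (𝓞 K)⁰ K)ˣ} :
    ClassGroup.mk (R := 𝓞 K) K I = ClassGroup.mk K J ↔
      ∃ x : Kˣ, (I : FractionalIdeal (𝓞 K)⁰ K) * FractionalIdeal.spanSingleton (𝓞 K)⁰ (x : K) =
        J := by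
  rw [eq_comm, ← div_eq_one, ← map_div, ClassGroup.mk_eq_one_iff,
    FractionalIdeal.isPrincipal_iff]
  have hI : (I : FractionalIdeal (𝓞 K)⁰ K) ≠ 0 := I.ne_zero
  have hJ : (J : FractionalIdeal (𝓞 K)⁰ K) ≠ 0 := J.ne_zero
  rw [Units.val_div_eq_div_val]
  constructor
  · rintro ⟨x, hx⟩
    have hx0 : x ≠ 0 := by
      rintro rfl
      rw [FractionalIdeal.spanSingleton_zero] at hx
      exact div_ne_zero hJ hI hx
    refine ⟨Units.mk0 x hx0, ?_⟩
    rw [Units.val_mk0, ← hx, mul_div_cancel₀ _ hI]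
  · rintro ⟨x, hx⟩
    exact ⟨x, by rw [← hx, mul_div_cancel_left₀ _ hI]⟩

variable {ι : Type*} {𝔞 : ι → (FractionalIdeal (𝓞 K)⁰ K)ˣ}

/-- The multiples `(λ) 𝔞ᵢ` of the class representatives that are contained in `I` and have
index `r`, with a generator `λ`. -/
def IdealMultiples (𝔞 : ι → (FractionalIdeal (𝓞 K)⁰ K)ˣ) (I : FractionalIdeal (𝓞 K)⁰ K) (r : ℚ) :
    Set (ι × K) :=
  {x | x.2 ≠ 0 ∧
    (𝔞 x.1 : FractionalIdeal (𝓞 K)⁰ K) * FractionalIdeal.spanSingleton (𝓞 K)⁰ x.2 ≤ I ∧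
    FractionalIdeal.absNorm (𝔞 x.1 : FractionalIdeal (𝓞 K)⁰ K) * |Algebra.norm ℚ x.2| =
      FractionalIdeal.absNorm I * r}

theorem exists_ideal_of_le {I L : FractionalIdeal (𝓞 K)⁰ K} (hI : I ≠ 0) (hL : L ≤ I) :
    ∃ J : Ideal (𝓞 K), L = I * J ∧
      FractionalIdeal.absNorm L = FractionalIdeal.absNorm I * Ideal.absNorm J := by
  have h1 : I⁻¹ * L ≤ 1 := by
    rw [← inv_mul_cancel₀ hI]; exact mul_le_mul_right hL _
  obtain ⟨J, hJ⟩ := FractionalIdeal.le_one_iff_exists_coeIdeal.1 h1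
  have h2 : L = I * J := by rw [hJ, mul_inv_cancel_left₀ hI]
  exact ⟨J, h2, by rw [h2, map_mul, FractionalIdeal.coeIdeal_absNorm]⟩

theorem exists_unit_of_spanSingleton_eq {x y : K} (hxy :
    FractionalIdeal.spanSingleton (𝓞 K)⁰ x = FractionalIdeal.spanSingleton (𝓞 K)⁰ y) :
    ∃ u : (𝓞 K)ˣ, ((u : 𝓞 K) : K) * x = y := by
  obtain ⟨u, hu⟩ := FractionalIdeal.spanSingleton_eq_spanSingleton.1 hxy
  refine ⟨u, ?_⟩
  rw [← hu, Units.smul_def, Algebra.smul_def]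

theorem spanSingleton_unit_mul (u : (𝓞 K)ˣ) (x : K) :
    FractionalIdeal.spanSingleton (𝓞 K)⁰ (((u : 𝓞 K) : K) * x) =
      FractionalIdeal.spanSingleton (𝓞 K)⁰ x := by
  refine (FractionalIdeal.spanSingleton_eq_spanSingleton.2 ⟨u, ?_⟩).symm
  rw [Units.smul_def, Algebra.smul_def]

/-- The generators of the multiples of the class representatives that are contained in `I` and
have index `r` correspond to pairs of a unit and an integral ideal of norm `r`. -/
theorem card_idealMultiples
    (h𝔞 : Function.Bijective fun i => ClassGroup.mk (R := 𝓞 K) K (𝔞 i))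
    {I : FractionalIdeal (𝓞 K)⁰ K} (hI : I ≠ 0) {r : ℚ} (hr : 0 < r) :
    Nonempty (((𝓞 K)ˣ × {J : Ideal (𝓞 K) // (Ideal.absNorm J : ℚ) = r}) ≃
      IdealMultiples 𝔞 I r) := by
  have hne : ∀ J : {J : Ideal (𝓞 K) // (Ideal.absNorm J : ℚ) = r}, (J : Ideal (𝓞 K)) ≠ 0 := by
    rintro ⟨J, hJ⟩ h0
    rw [← hJ, (Ideal.absNorm_eq_zero_iff).2 h0] at hr
    simp at hr
  have hex : ∀ J : {J : Ideal (𝓞 K) // (Ideal.absNorm J : ℚ) = r}, ∃ x : ι × Kˣ,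
      (𝔞 x.1 : FractionalIdeal (𝓞 K)⁰ K) * FractionalIdeal.spanSingleton (𝓞 K)⁰ (x.2 : K) =
        I * ((J : Ideal (𝓞 K)) : FractionalIdeal (𝓞 K)⁰ K) := by
    intro J
    have h0 : I * ((J : Ideal (𝓞 K)) : FractionalIdeal (𝓞 K)⁰ K) ≠ 0 :=
      mul_ne_zero hI (FractionalIdeal.coeIdeal_ne_zero.2 (hne J))
    obtain ⟨i, hi⟩ := h𝔞.2 (ClassGroup.mk K (Units.mk0 _ h0))
    obtain ⟨x, hx⟩ := classGroup_mk_eq_iff.1 hi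
    exact ⟨⟨i, x⟩, hx⟩
  -- For each `J` this fixes the index `i` of the class of `I J` and one `x` with `x 𝔞ᵢ = I J`; the
  -- other choices of `x` are its unit multiples.
  choose F hF using hex
  have hF' : ∀ (u : (𝓞 K)ˣ) J, (𝔞 (F J).1 : FractionalIdeal (𝓞 K)⁰ K) *
      FractionalIdeal.spanSingleton (𝓞 K)⁰ (((u : 𝓞 K) : K) * ((F J).2 : K)) =
        I * ((J : Ideal (𝓞 K)) : FractionalIdeal (𝓞 K)⁰ K) := by
    intro u J; rw [spanSingleton_unit_mul, hF]
  refine ⟨Equiv.ofBijective (fun uJ => ⟨⟨(F uJ.2).1, ((uJ.1 : 𝓞 K) : K) * ((F uJ.2).2 : K)⟩,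
    ?_, ?_, ?_⟩) ⟨?_, ?_⟩⟩
  · exact mul_ne_zero (by exact_mod_cast uJ.1.ne_zero) (F uJ.2).2.ne_zero
  · rw [hF']
    exact (mul_le_mul_right FractionalIdeal.coeIdeal_le_one I).trans_eq (mul_one I)
  · have h1 := congrArg FractionalIdeal.absNorm (hF' uJ.1 uJ.2)
    rwa [map_mul, map_mul, FractionalIdeal.coeIdeal_absNorm, uJ.2.2,
      FractionalIdeal.absNorm_span_singleton] at h1
  · rintro ⟨u, J⟩ ⟨v, J'⟩ huv
    have h1 := congrArg Subtype.val huv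
    simp only [Prod.mk.injEq] at h1
    have h2 : J = J' := by
      have h3 := hF' u J
      rw [h1.1, h1.2, hF' v J'] at h3
      exact Subtype.ext (FractionalIdeal.coeIdeal_injective (mul_left_cancel₀ hI h3)).symm
    subst h2
    have h3 := mul_right_cancel₀ (F J).2.ne_zero h1.2
    rw [Prod.mk.injEq]
    exact ⟨Units.ext (NumberField.RingOfIntegers.coe_injective h3), rfl⟩
  · rintro ⟨⟨i, x⟩, hx0, hxI, hxr⟩
    obtain ⟨J, hJ, hJn⟩ := exists_ideal_of_le hI hxI
    rw [map_mul, FractionalIdeal.absNorm_span_singleton, hxr] at hJn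
    have hJr : (Ideal.absNorm J : ℚ) = r := (mul_left_cancel₀ (absNorm_pos hI).ne' hJn).symm
    have h1 := hF ⟨J, hJr⟩
    rw [← hJ] at h1
    have hi : (F ⟨J, hJr⟩).1 = i := by
      refine h𝔞.1 (classGroup_mk_eq_iff.2 ⟨(F ⟨J, hJr⟩).2 * (Units.mk0 x hx0)⁻¹, ?_⟩)
      rw [Units.val_mul, ← FractionalIdeal.spanSingleton_mul_spanSingleton, ← mul_assoc, h1,
        mul_assoc, FractionalIdeal.spanSingleton_mul_spanSingleton, Units.val_inv_eq_inv_val,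
        Units.val_mk0, mul_inv_cancel₀ hx0, FractionalIdeal.spanSingleton_one, mul_one]
    rw [hi] at h1
    obtain ⟨u, hu⟩ := exists_unit_of_spanSingleton_eq (mul_left_cancel₀ (𝔞 i).ne_zero h1)
    refine ⟨⟨u, ⟨J, hJr⟩⟩, Subtype.ext ?_⟩
    rw [Prod.mk.injEq]
    exact ⟨hi, hu⟩

theorem encard_idealMultiples [Finite (𝓞 K)ˣ]
    (h𝔞 : Function.Bijective fun i => ClassGroup.mk (R := 𝓞 K) K (𝔞 i))
    {I : FractionalIdeal (𝓞 K)⁰ K} (hI : I ≠ 0) {r : ℚ} (hr : 0 < r) :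
    (IdealMultiples 𝔞 I r).encard = ((Nat.card (𝓞 K)ˣ * rho K r : ℕ) : ℕ∞) := by
  obtain ⟨e⟩ := card_idealMultiples h𝔞 hI hr
  have hfin : Finite {J : Ideal (𝓞 K) // (Ideal.absNorm J : ℚ) = r} := by
    rcases isEmpty_or_nonempty {J : Ideal (𝓞 K) // (Ideal.absNorm J : ℚ) = r} with h0 | ⟨J, hJ⟩
    · infer_instance
    · refine ((Ideal.finite_setOfPred_absNorm_eq (S := 𝓞 K) (Ideal.absNorm J)).subset
        fun L hL => ?_).to_subtype
      have : (Ideal.absNorm L : ℚ) = Ideal.absNorm J := Eq.trans hL hJ.symm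
      exact_mod_cast this
  rw [← ENat.card_coe_set_eq, ← ENat.card_congr e, ENat.card_eq_coe_natCard, Nat.card_prod, rho]

end ClassRepresentatives

/-! ### The fibres of `η ↦ m η⁻¹ φ(√Δ) η`. -/

section Fibres

variable {α β : ℚ} {O : Subring ℍ[ℚ, α, β]} {K : Type*} [Field K] [NumberField K] {Δ : ℤ} {s : K}

/-- One direction uses `𝔞 𝔞⁻¹ = o_k` and `φ(o_k) ⊆ O`; the other writes `1` as a sum of products
from `𝔞⁻¹` and `𝔞` and applies it to `y`. -/
theorem mem_idealLattice_iff {φ : K →ₐ[ℚ] ℍ[ℚ, α, β]} (hφ : ∀ a : 𝓞 K, φ a ∈ O)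
    (𝔞 : (FractionalIdeal (𝓞 K)⁰ K)ˣ) {y : ℍ[ℚ, α, β]} :
    y ∈ idealLattice O φ 𝔞 ↔ ∀ x ∈ (𝔞 : FractionalIdeal (𝓞 K)⁰ K), φ x * y ∈ O := by
  constructor
  · intro hy x hx
    induction hy using AddSubgroup.closure_induction with
    | mem y hy =>
      obtain ⟨z, hz, b, hb, rfl⟩ := hy
      have h1 : x * z ∈ (1 : FractionalIdeal (𝓞 K)⁰ K) := by
        rw [← Units.mul_inv 𝔞]; exact FractionalIdeal.mul_mem_mul hx hz
      rw [← mul_assoc, ← map_mul]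
      exact mul_mem (hφ ⟨x * z, mem_one_iff_isIntegral.1 h1⟩) hb
    | zero => rw [mul_zero]; exact O.zero_mem
    | add y z _ _ hy hz => rw [mul_add]; exact add_mem hy hz
    | neg y _ hy => rw [mul_neg]; exact neg_mem hy
  · intro hy
    have key : ∀ z ∈ ((𝔞⁻¹ : (FractionalIdeal (𝓞 K)⁰ K)ˣ) : FractionalIdeal (𝓞 K)⁰ K) * 𝔞,
        φ z * y ∈ idealLattice O φ 𝔞 := by
      intro z hz
      refine FractionalIdeal.mul_induction_on hz (fun k hk l hl => ?_) (fun x y hx hy => ?_)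
      · exact AddSubgroup.subset_closure ⟨k, hk, φ l * y, hy l hl, by rw [map_mul, mul_assoc]⟩
      · rw [map_add, add_mul]; exact add_mem hx hy
    have h1 := key 1 (by rw [Units.inv_mul]; exact FractionalIdeal.one_mem_one _)
    rwa [map_one, one_mul] at h1

/-- In the coordinates adapted to `φ(√Δ)`, commuting with `i` kills the `j` and `k` coordinates. -/
theorem IsEvenImaginaryQuadratic.exists_eq_map_of_commute (h : IsEvenImaginaryQuadratic Δ s)
    (hα : α ≠ 0) (hβ : β ≠ 0) (φ : K →ₐ[ℚ] ℍ[ℚ, α, β]) {z : ℍ[ℚ, α, β]}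
    (hz : z * φ s = φ s * z) : ∃ x : K, z = φ x := by
  obtain ⟨J, hJ, htr, hn⟩ := h.exists_anticommuting hα hβ φ
  obtain ⟨E, hE, -⟩ := h.exists_algEquiv φ hJ htr hn
  obtain ⟨w, rfl⟩ := E.surjective z
  rw [← hE, ← map_mul, ← map_mul] at hz
  have hw := E.injective hz
  have h1 := congrArg QuaternionAlgebra.imK hw
  have h2 := congrArg QuaternionAlgebra.imJ hw
  simp at h1 h2
  have hΔ := h.neg_rat.ne
  have h3 : w.imJ = 0 := by linarith
  have h4 : w.imK = 0 := by
    have : (Δ : ℚ) * w.imK = 0 := by linarith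
    exact (mul_eq_zero.1 this).resolve_left hΔ
  refine ⟨w.re • (1 : K) + w.imI • s, ?_⟩
  rw [map_add, map_smul, map_smul, map_one, ← hE, ← map_one E, ← map_smul, ← map_smul, ← map_add]
  congr 1
  ext <;> simp [h3, h4]

theorem conjMap_coe (φ : K →ₐ[ℚ] ℍ[ℚ, α, β]) (m : ℕ) (b : (ℍ[ℚ, α, β])ˣ) :
    conjMap s φ m (b : ℍ[ℚ, α, β]) = (m : ℚ) • conjEmbedding φ b s := by
  rw [conjMap, Ring.inverse_unit, conjEmbedding_apply, Nat.cast_smul_eq_nsmul, nsmul_eq_mul]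

theorem natCast_mul_conj_eq (φ : K →ₐ[ℚ] ℍ[ℚ, α, β]) (m : ℕ) (b : (ℍ[ℚ, α, β])ˣ) :
    (m : ℍ[ℚ, α, β]) * (((b⁻¹ : (ℍ[ℚ, α, β])ˣ) : ℍ[ℚ, α, β]) * φ s * b) =
      (m : ℚ) • conjEmbedding φ b s := by
  rw [conjEmbedding_apply, Nat.cast_smul_eq_nsmul, nsmul_eq_mul]

theorem isUnit_of_quadForm_ne_zero {y : ℍ[ℚ, α, β]} (hy : quadForm Δ y ≠ 0) : IsUnit y :=
  isUnit_of_nrd_ne_zero (right_ne_zero_of_mul hy)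

theorem conjEmbedding_eq_iff (h : IsEvenImaginaryQuadratic Δ s)
    (hα : α ≠ 0) (hβ : β ≠ 0) (φ : K →ₐ[ℚ] ℍ[ℚ, α, β]) {b c : (ℍ[ℚ, α, β])ˣ} :
    conjEmbedding φ c s = conjEmbedding φ b s ↔ ∃ x : K, (c : ℍ[ℚ, α, β]) = φ x * b := by
  rw [conjEmbedding_apply, conjEmbedding_apply]
  constructor
  · intro hcb
    obtain ⟨x, hx⟩ := h.exists_eq_map_of_commute hα hβ φ
      (z := (c : ℍ[ℚ, α, β]) * ((b⁻¹ : (ℍ[ℚ, α, β])ˣ) : ℍ[ℚ, α, β])) (by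
        have h1 := congrArg (fun y => (c : ℍ[ℚ, α, β]) * y *
          ((b⁻¹ : (ℍ[ℚ, α, β])ˣ) : ℍ[ℚ, α, β])) hcb
        simp only [mul_assoc, Units.mul_inv_cancel_left, Units.mul_inv, mul_one] at h1
        rw [h1, mul_assoc])
    exact ⟨x, by rw [← hx, mul_assoc, Units.inv_mul, mul_one]⟩
  · rintro ⟨x, hx⟩
    rw [mul_assoc, mul_assoc, Units.inv_mul_eq_iff_eq_mul, hx, mul_assoc,
      Units.mul_inv_cancel_left, ← mul_assoc, ← mul_assoc, ← map_mul, ← map_mul, mul_comm]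

variable (hO : IsOrder O) (h : IsEvenImaginaryQuadratic Δ s)
    (φ : K →ₐ[ℚ] ℍ[ℚ, α, β]) (hφ : ∀ a : 𝓞 K, φ a ∈ O)

theorem map_mul_mem_idealLattice_iff (b : (ℍ[ℚ, α, β])ˣ) (𝔞 : (FractionalIdeal (𝓞 K)⁰ K)ˣ)
    (x : K) : φ x * (b : ℍ[ℚ, α, β]) ∈ idealLattice O φ 𝔞 ↔
      (𝔞 : FractionalIdeal (𝓞 K)⁰ K) * FractionalIdeal.spanSingleton (𝓞 K)⁰ x ≤
        leftIdeal hO h φ hφ b := by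
  rw [mem_idealLattice_iff hφ, mul_comm, FractionalIdeal.spanSingleton_mul_le_iff]
  refine forall₂_congr fun z _ => ?_
  rw [mem_leftIdeal, mul_comm x, map_mul, mul_assoc]

/-- The map `η ↦ m η⁻¹ φ(√Δ) η` takes vectors of norm `± m / N(𝔞)` to `Ω^o(|Δ| m²)`. -/
theorem conjMap_mem (hO : IsOrder O) (h : IsEvenImaginaryQuadratic Δ s)
    (φ : K →ₐ[ℚ] ℍ[ℚ, α, β]) (hφ : ∀ a : 𝓞 K, φ a ∈ O) {m : ℕ} {𝔞 : (FractionalIdeal (𝓞 K)⁰ K)ˣ} {c : (ℍ[ℚ, α, β])ˣ}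
    (hc : (c : ℍ[ℚ, α, β]) ∈ idealLattice O φ 𝔞)
    (hcm : |quadForm Δ (c : ℍ[ℚ, α, β])| =
      m / FractionalIdeal.absNorm (𝔞 : FractionalIdeal (𝓞 K)⁰ K)) :
    conjMap s φ m (c : ℍ[ℚ, α, β]) ∈ OmegaO O (|Δ| * m ^ 2) := by
  rw [conjMap_coe]
  have hI := leftIdeal_ne_zero hO h φ hφ c
  refine ⟨?_, ?_, ?_⟩
  · have h1 := (map_mul_mem_idealLattice_iff hO h φ hφ c 𝔞 1).1 (by rwa [map_one, one_mul])
    obtain ⟨J, -, hJ⟩ := exists_ideal_of_le hI h1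
    rw [FractionalIdeal.spanSingleton_one, mul_one] at hJ
    -- With `𝔞 = I J`, the norm condition makes `m` an integer multiple of the index `N(I) |nrd c|`,
    -- which already carries the conjugate of `φ(√Δ)` into `O`.
    have h2 : (m : ℚ) = ((|Δ| * Ideal.absNorm J : ℤ) : ℚ) *
        (FractionalIdeal.absNorm (leftIdeal hO h φ hφ c) * |nrd (c : ℍ[ℚ, α, β])|) := by
      rw [eq_div_iff (absNorm_pos 𝔞.ne_zero).ne', hJ, quadForm, abs_mul] at hcm
      rw [← hcm]
      push_cast
      ring
    rw [h2, mul_smul]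
    exact zsmul_mem_of_mem _ (smul_conjEmbedding_mem hO h φ hφ c h.isIntegral_gen)
  · rw [trd_smul, h.trd_map_gen, mul_zero]
  · rw [nrd_smul, h.nrd_map_gen, Int.cast_abs, abs_of_neg h.neg_rat, mul_comm]

/-- The bijection is `(i, x) ↦ φ(x) b` from `IdealMultiples`. The sign `ε` treats both forms at
once: `ε (b, b)_φ = |Δ| |nrd b|`, and multiplying `b` by `φ(x)` scales this by the positive norm of
`x`. -/
theorem encard_fibre (hα : α ≠ 0) (hβ : β ≠ 0) {m : ℕ} (hm : 0 < m)
    {ι : Type*} {𝔞 : ι → (FractionalIdeal (𝓞 K)⁰ K)ˣ}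
    (h𝔞 : Function.Bijective fun i => ClassGroup.mk (R := 𝓞 K) K (𝔞 i))
    {ε : ℚ} (hε : |ε| = 1) {X : ι → Set ℍ[ℚ, α, β]}
    (hX : ∀ i y, y ∈ X i ↔ y ∈ idealLattice O φ (𝔞 i) ∧
      quadForm Δ y = ε * (m / FractionalIdeal.absNorm (𝔞 i : FractionalIdeal (𝓞 K)⁰ K)))
    {b : (ℍ[ℚ, α, β])ˣ} (hb : 0 < ε * quadForm Δ (b : ℍ[ℚ, α, β])) :
    Set.encard {x : Σ i : ι, X i | conjMap s φ m (x.2 : ℍ[ℚ, α, β]) =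
        (m : ℚ) • conjEmbedding φ b s} =
      ((Nat.card (𝓞 K)ˣ * rho K (m / (FractionalIdeal.absNorm (leftIdeal hO h φ hφ b) *
        |nrd (b : ℍ[ℚ, α, β])| * |Δ|)) : ℕ) : ℕ∞) := by
  have hfin := h.finite_units
  have hI := leftIdeal_ne_zero hO h φ hφ b
  have hI0 := absNorm_pos hI
  have hb0 : 0 < |nrd (b : ℍ[ℚ, α, β])| := abs_pos.2 (nrd_unit_ne_zero b)
  have hm0 : (0 : ℚ) < m := by exact_mod_cast hm
  have hΔ0 : (0 : ℚ) < ((|Δ| : ℤ) : ℚ) := by exact_mod_cast abs_pos.2 h.neg.ne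
  have hε0 : ε ≠ 0 := by rintro rfl; simp at hε
  have hεb : ε * quadForm Δ (b : ℍ[ℚ, α, β]) = ((|Δ| : ℤ) : ℚ) * |nrd (b : ℍ[ℚ, α, β])| := by
    rw [← abs_of_pos hb, abs_mul, hε, quadForm, abs_mul, one_mul, Int.cast_abs]
  have hεε : ε * ε = 1 := by rw [← abs_mul_abs_self, hε, one_mul]
  rw [← encard_idealMultiples h𝔞 hI (by positivity)]
  have hnorm : ∀ (i : ι) {x : K}, x ≠ 0 → (quadForm Δ (φ x * (b : ℍ[ℚ, α, β])) =
      ε * (m / FractionalIdeal.absNorm (𝔞 i : FractionalIdeal (𝓞 K)⁰ K)) ↔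
      FractionalIdeal.absNorm (𝔞 i : FractionalIdeal (𝓞 K)⁰ K) * |Algebra.norm ℚ x| =
        FractionalIdeal.absNorm (leftIdeal hO h φ hφ b) * (m /
          (FractionalIdeal.absNorm (leftIdeal hO h φ hφ b) * |nrd (b : ℍ[ℚ, α, β])| *
            ((|Δ| : ℤ) : ℚ)))) := by
    intro i x hx
    have hA := absNorm_pos (𝔞 i).ne_zero
    have e1 : ε * quadForm Δ (φ x * (b : ℍ[ℚ, α, β])) =
        Algebra.norm ℚ x * (((|Δ| : ℤ) : ℚ) * |nrd (b : ℍ[ℚ, α, β])|) := by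
      rw [← hεb, quadForm, quadForm, nrd_mul, h.nrd_map]; ring
    have e2 : ε * (ε * (m / FractionalIdeal.absNorm (𝔞 i : FractionalIdeal (𝓞 K)⁰ K))) =
        m / FractionalIdeal.absNorm (𝔞 i : FractionalIdeal (𝓞 K)⁰ K) := by
      rw [← mul_assoc, hεε, one_mul]
    rw [← mul_right_inj' hε0, e1, e2, abs_of_pos (h.norm_pos hx), eq_div_iff hA.ne']
    have e3 : FractionalIdeal.absNorm (leftIdeal hO h φ hφ b) * (m /
          (FractionalIdeal.absNorm (leftIdeal hO h φ hφ b) * |nrd (b : ℍ[ℚ, α, β])| *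
            ((|Δ| : ℤ) : ℚ))) = m / (((|Δ| : ℤ) : ℚ) * |nrd (b : ℍ[ℚ, α, β])|) := by
      field_simp
    rw [e3, eq_div_iff (by positivity)]
    exact Eq.congr (by ring) rfl
  have hunit : ∀ {x : K}, x ≠ 0 → IsUnit (φ x * (b : ℍ[ℚ, α, β])) := fun hx =>
    ((IsUnit.mk0 _ hx).map φ).mul b.isUnit
  have hmem : ∀ x : ι × K, x ∈ IdealMultiples 𝔞 (leftIdeal hO h φ hφ b)
      (m / (FractionalIdeal.absNorm (leftIdeal hO h φ hφ b) * |nrd (b : ℍ[ℚ, α, β])| *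
        ((|Δ| : ℤ) : ℚ))) → φ x.2 * (b : ℍ[ℚ, α, β]) ∈ X x.1 := by
    rintro ⟨i, x⟩ ⟨hx0, hx1, hx2⟩
    exact (hX _ _).2 ⟨(map_mul_mem_idealLattice_iff hO h φ hφ b (𝔞 i) x).2 hx1,
      (hnorm i hx0).2 hx2⟩
  have hm' : (m : ℚ) ≠ 0 := hm0.ne'
  have hfib : ∀ (x : ι × K) (hx : x ∈ IdealMultiples 𝔞 (leftIdeal hO h φ hφ b)
      (m / (FractionalIdeal.absNorm (leftIdeal hO h φ hφ b) * |nrd (b : ℍ[ℚ, α, β])| *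
        ((|Δ| : ℤ) : ℚ)))),
      (⟨x.1, ⟨φ x.2 * (b : ℍ[ℚ, α, β]), hmem x hx⟩⟩ : Σ i : ι, X i) ∈
        {x : Σ i : ι, X i | conjMap s φ m (x.2 : ℍ[ℚ, α, β]) =
          (m : ℚ) • conjEmbedding φ b s} := by
    intro x hx
    obtain ⟨c, hc⟩ := hunit hx.1
    change conjMap s φ m (φ x.2 * (b : ℍ[ℚ, α, β])) = _
    rw [← hc, conjMap_coe, (conjEmbedding_eq_iff h hα hβ φ).2 ⟨x.2, hc⟩]
  rw [← ENat.card_coe_set_eq, ← ENat.card_coe_set_eq]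
  refine (ENat.card_congr (Equiv.ofBijective
    (fun x => ⟨_, hfib x.1 x.2⟩) ⟨?_, ?_⟩)).symm
  · rintro ⟨⟨i, x⟩, hx⟩ ⟨⟨j, y⟩, hy⟩ hxy
    have h1 := congrArg Subtype.val hxy
    have h2 : i = j := congrArg Sigma.fst h1
    subst h2
    have h3 := congrArg Subtype.val (eq_of_heq (Sigma.mk.inj h1).2)
    have h4 : x = y := φ.toRingHom.injective ((Units.mul_left_inj b).1 h3)
    subst h4
    rfl
  · rintro ⟨⟨i, ⟨y, hy⟩⟩, hyc⟩
    obtain ⟨hy1, hy2⟩ := (hX i y).1 hy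
    have hy0 : quadForm Δ y ≠ 0 := by
      rw [hy2]
      exact mul_ne_zero hε0 (div_ne_zero hm' (absNorm_pos (𝔞 i).ne_zero).ne')
    obtain ⟨c, rfl⟩ := isUnit_of_quadForm_ne_zero hy0
    change conjMap s φ m (c : ℍ[ℚ, α, β]) = _ at hyc
    rw [conjMap_coe] at hyc
    obtain ⟨x, hx⟩ := (conjEmbedding_eq_iff h hα hβ φ).1 (smul_right_injective _ hm' hyc)
    have hx0 : x ≠ 0 := by
      rintro rfl
      rw [map_zero, zero_mul] at hx
      exact nrd_unit_ne_zero c (by rw [hx]; simp)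
    rw [hx] at hy1 hy2
    refine ⟨⟨⟨i, x⟩, hx0, (map_mul_mem_idealLattice_iff hO h φ hφ b (𝔞 i) x).1 hy1,
      (hnorm i hx0).1 hy2⟩, Subtype.ext ?_⟩
    simp only [← hx]

end Fibres

/-! ### The maps `f` and `g` and their fibres. -/

section CycleCount

variable {K : Type*} [Field K] [NumberField K] {Δ : ℤ} {s : K} {α β : ℚ}

/-- Both cases of the main theorem, for the sign `ε`. -/
theorem conjMap_mem_and_encard_fibre (h : IsEvenImaginaryQuadratic Δ s) (hα : α ≠ 0) (hβ : β ≠ 0)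
    {D : ℕ} (hD : IsDiscriminant ℍ[ℚ, α, β] D)
    (hinert : ∀ p : ℕ, p.Prime → p ∣ D → (Ideal.span {(p : 𝓞 K)}).IsPrime)
    {O : Subring ℍ[ℚ, α, β]} (hO : IsMaximalOrder O)
    {θ : ℍ[ℚ, α, β]} (hθ : θ ^ 2 = -(D : ℍ[ℚ, α, β]))
    (φ : K →ₐ[ℚ] ℍ[ℚ, α, β]) (hφ : ∀ a : 𝓞 K, φ a ∈ O) {m : ℕ} (hm : 0 < m)
    {ι : Type*} {𝔞 : ι → (FractionalIdeal (𝓞 K)⁰ K)ˣ}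
    (h𝔞 : Function.Bijective fun i => ClassGroup.mk (R := 𝓞 K) K (𝔞 i))
    {ε : ℚ} (hε : |ε| = 1) {X : ι → Set ℍ[ℚ, α, β]}
    (hX : ∀ i y, y ∈ X i ↔ y ∈ idealLattice O φ (𝔞 i) ∧
      quadForm Δ y = ε * (m / FractionalIdeal.absNorm (𝔞 i : FractionalIdeal (𝓞 K)⁰ K)))
    {Y : Set ℍ[ℚ, α, β]}
    (hY : ∀ ξ, ξ ∈ Y ↔ ξ ∈ OmegaO O (|Δ| * m ^ 2) ∧ ∃ b : (ℍ[ℚ, α, β])ˣ,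
      0 < ε * quadForm Δ (b : ℍ[ℚ, α, β]) ∧
        ξ = m * (((b⁻¹ : (ℍ[ℚ, α, β])ˣ) : ℍ[ℚ, α, β]) * φ s * b)) :
    (∀ i, ∀ η ∈ X i, IsUnit η ∧ conjMap s φ m η ∈ Y) ∧
      ∀ ξ ∈ Y, Set.encard {x : Σ i : ι, X i | conjMap s φ m (x.2 : ℍ[ℚ, α, β]) = ξ} =
        ((Nat.card (𝓞 K)ˣ * rho K
          (m / (conductor s O m ξ * frobeniusType s O θ D φ m ξ * |Δ|)) : ℕ) : ℕ∞) := by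
  have hε0 : ε ≠ 0 := by rintro rfl; simp at hε
  have hεε : ε * ε = 1 := by rw [← abs_mul_abs_self, hε, one_mul]
  have hm0 : (0 : ℚ) < m := by exact_mod_cast hm
  constructor
  · intro i η hη
    obtain ⟨hη1, hη2⟩ := (hX i η).1 hη
    have hpos : 0 < m / FractionalIdeal.absNorm (𝔞 i : FractionalIdeal (𝓞 K)⁰ K) :=
      div_pos hm0 (absNorm_pos (𝔞 i).ne_zero)
    have hu : IsUnit η :=
      isUnit_of_quadForm_ne_zero (Δ := Δ) (by rw [hη2]; exact mul_ne_zero hε0 hpos.ne')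
    obtain ⟨c, rfl⟩ := hu
    refine ⟨c.isUnit, (hY _).2 ⟨conjMap_mem hO.1 h φ hφ hη1 ?_, c, ?_, ?_⟩⟩
    · rw [hη2, abs_mul, hε, one_mul, abs_of_pos hpos]
    · rw [hη2, ← mul_assoc, hεε, one_mul]; exact hpos
    · rw [conjMap_coe, natCast_mul_conj_eq]
  · intro ξ hξ
    obtain ⟨-, b, hb, rfl⟩ := (hY ξ).1 hξ
    rw [natCast_mul_conj_eq, encard_fibre hO.1 h φ hφ hα hβ hm h𝔞 hε hX hb,
      absNorm_mul_abs_nrd_eq hα hβ hO h hD hinert hθ φ hφ b hm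
        (map_natCast_mul_eq_smul (conjEmbedding φ b) m s)]
    push_cast
    rfl

end CycleCount

end QuatCycles

theorem mainTheorem4
    -- the imaginary quadratic field `k = ℚ(√Δ)`
    {K : Type*} [Field K] [NumberField K]
    (Δ : ℤ) (hΔneg : Δ < 0) (hΔsq : Squarefree Δ) (hΔeven : Even Δ)
    (s : K) (hs : s ^ 2 = (Δ : K)) (hK : Module.finrank ℚ K = 2)
    -- the indefinite quaternion algebra `B`, of discriminant `D > 1`
    (α β : ℚ) (hα : α ≠ 0) (hβ : β ≠ 0)
    (hB : QuatCycles.IsIndefinite ℍ[ℚ, α, β])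
    (D : ℕ) (hD : QuatCycles.IsDiscriminant ℍ[ℚ, α, β] D) (hD1 : 1 < D)
    (hinert : ∀ p : ℕ, p.Prime → p ∣ D → (Ideal.span {(p : 𝓞 K)}).IsPrime)
    -- a maximal order, `θ` in it, and an embedding `φ : o_k → O_B`
    (O : Subring ℍ[ℚ, α, β]) (hO : QuatCycles.IsMaximalOrder O)
    (θ : ℍ[ℚ, α, β]) (hθO : θ ∈ O) (hθ : θ ^ 2 = -(D : ℍ[ℚ, α, β]))
    (φ : K →ₐ[ℚ] ℍ[ℚ, α, β]) (hφ : ∀ a : 𝓞 K, φ a ∈ O)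
    (m : ℕ) (hm : 0 < m)
    -- representatives of the ideal classes
    {h : ℕ} (𝔞 : Fin h → (FractionalIdeal (𝓞 K)⁰ K)ˣ)
    (h𝔞 : Function.Bijective (fun i => (ClassGroup.mk (R := 𝓞 K) (K := K) (𝔞 i) : ClassGroup (𝓞 K)))) :
    ((∀ (i : Fin h), ∀ η ∈ QuatCycles.OmegaPlus Δ O φ m (𝔞 i),
        IsUnit η ∧ QuatCycles.conjMap s φ m η ∈ QuatCycles.OmegaPos Δ s O φ m) ∧
      ∀ ξ ∈ QuatCycles.OmegaPos Δ s O φ m,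
        Set.encard {x : Σ i : Fin h, QuatCycles.OmegaPlus Δ O φ m (𝔞 i) |
            QuatCycles.conjMap s φ m (x.2 : ℍ[ℚ, α, β]) = ξ} =
          ((Nat.card (𝓞 K)ˣ * QuatCycles.rho K
            (m / (QuatCycles.conductor s O m ξ * QuatCycles.frobeniusType s O θ D φ m ξ * |Δ|)) :
              ℕ) : ℕ∞)) ∧
    ((∀ (i : Fin h), ∀ η ∈ QuatCycles.OmegaMinus Δ O φ m (𝔞 i),
        IsUnit η ∧ QuatCycles.conjMap s φ m η ∈ QuatCycles.OmegaNeg Δ s O φ m) ∧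
      ∀ ξ ∈ QuatCycles.OmegaNeg Δ s O φ m,
        Set.encard {x : Σ i : Fin h, QuatCycles.OmegaMinus Δ O φ m (𝔞 i) |
            QuatCycles.conjMap s φ m (x.2 : ℍ[ℚ, α, β]) = ξ} =
          ((Nat.card (𝓞 K)ˣ * QuatCycles.rho K
            (m / (QuatCycles.conductor s O m ξ * QuatCycles.frobeniusType s O θ D φ m ξ * |Δ|)) :
              ℕ) : ℕ∞)) := by
  have hq : QuatCycles.IsEvenImaginaryQuadratic Δ s := ⟨hΔneg, hΔsq, hΔeven, hs, hK⟩
  -- The statements for `f` and `g` are the cases `ε = 1` and `ε = -1`.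
  refine ⟨QuatCycles.conjMap_mem_and_encard_fibre hq hα hβ hD hinert hO hθ φ hφ hm h𝔞
    (ε := 1) abs_one (fun i y => ?_) (fun ξ => ?_),
    QuatCycles.conjMap_mem_and_encard_fibre hq hα hβ hD hinert hO hθ φ hφ hm h𝔞
    (ε := -1) (by norm_num) (fun i y => ?_) (fun ξ => ?_)⟩
  · rw [one_mul]; exact Iff.rfl
  · simp only [one_mul]; exact Iff.rfl
  · rw [neg_one_mul]; exact Iff.rfl
  · simp only [neg_one_mul, neg_pos]; exact Iff.rfl
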